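/- Let $\mu,\gamma>0$, let $f\in C^3(\mathbb R)$ be strictly convex, let $\bar u_l>\bar u_r$ and let $s$ be given by $s(\bar u_l-\bar u_r)=f(\bar u_l)-f(\bar u_r)$. Let $\phi$ be a viscous shock profile, i.e. $\mu\phi'''-\gamma\phi''-s\phi'+f'(\phi)\phi'=0$ on $\mathbb R$, $\phi(-\infty)=\bar u_l$, $\phi(+\infty)=\bar u_r$, and put $g=(\phi-\bar u_r)/(\bar u_l-\bar u_r)$. Let $p_l,p_r>0$. Then there are constants $\delta_0,C,\theta>0$, depending only on $f,\mu,\gamma,\bar u_l,\bar u_r,p_l,p_r,\phi$, such that the following holds. For $i=l,r$ let $w_{0i}$ be a $p_i$-periodic $H^1$ function (identified with its continuous representative) with $\int_0^{p_i}w_{0i}\,dx=0$, and suppose $$\delta:=\max_{i=l,r}\|w_{0i}\|_{H^1(0,p_i)}<\delta_0 .$$ Let $u_i=u_i(\xi,t)$, $t\ge 0$, be a continuous, $p_i$-periodic in $\xi$, (weak) solution of $u_t-su_\xi+f(u)_\xi+\mu u_{\xi\xi\xi}=\gamma u_{\xi\xi}$ with $u_i(\xi,0)=\bar u_i+w_{0i}(\xi)$;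 this is the equation $u_t+f(u)_x+\mu u_{xxx}=\gamma u_{xx}$ in the coordinate $\xi=x-st$. Let $u_0$ be locally integrable and such that the two (improper) integrals in $$\eta_{\infty,1}=\int_{-\infty}^0(u_0-\phi-w_{0l})(\xi)\,d\xi+\int_0^{\infty}(u_0-\phi-w_{0r})(\xi)\,d\xi$$ converge. Then: (i) there is exactly one $\eta_0\in\mathbb R$ with $$\int_{-\infty}^{\infty}\Big\{(u_0-\bar u_l-w_{0l})(\xi)\,g(\xi-\eta_0)+(u_0-\bar u_r-w_{0r})(\xi)\,[1-g(\xi-\eta_0)]\Big\}\,d\xi=0$$ (an improper integral); (ii) with this $\eta_0$ and $g_\eta(\xi,t)=g(\xi-\eta(t))$, the problem $$\eta'(t)=\frac{\gamma\int_{\mathbb R}(u_l-u_r)g_\eta''\,d\xi+\mu\int_{\mathbb R}(u_l-u_r)g_\eta'''\,d\xi+\int_{\mathbb R}(f(u_l)-f(u_r))g_\eta'\,d\xi}{\int_{\mathbb R}(u_l-u_r)g_\eta'\,d\xi}-s,\qquad \eta(0)=\eta_0,$$ has a unique solution $\eta$ on $[0,\infty)$, and $\eta\in C^1([0,\infty))$;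 here, for every $t\ge0$ and every real value of $\eta(t)$, the integrals on the right converge absolutely and the denominator is nonzero; (iii) for all $t\ge 0$, $$|\eta'(t)|+|\eta(t)-\eta_\infty|\le C\delta e^{-\theta t},\qquad \eta_\infty=\frac{1}{\bar u_l-\bar u_r}(\eta_{\infty,1}+\eta_{\infty,2}),$$ where, with absolutely convergent time integrals, $$\begin{aligned}\eta_{\infty,2}=&\int_0^{\infty}\frac1{p_l}\int_0^{p_l}[f(u_l)-f(\bar u_l)-su_l+s\bar u_l](\xi,t)\,d\xi\,dt-\frac1{p_l}\int_0^{p_l}\int_0^{\xi}w_{0l}(y)\,dy\,d\xi\\&-\int_0^{\infty}\frac1{p_r}\int_0^{p_r}[f(u_r)-f(\bar u_r)-su_r+s\bar u_r](\xi,t)\,d\xi\,dt+\frac1{p_r}\int_0^{p_r}\int_0^{\xi}w_{0r}(y)\,dy\,d\xi .\end{aligned}$$ -/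

import Mathlib

open MeasureTheory Set Filter Topology

noncomputable section

namespace KdVBurgers

/-- `φ` is a viscous shock profile of `u_t + f(u)_x + μ u_xxx = γ u_xx` with speed `s`
connecting `ubl` (at `-∞`) to `ubr` (at `+∞`). -/
structure IsShockProfile (f : ℝ → ℝ) (μ γ s ubl ubr : ℝ) (φ : ℝ → ℝ) : Prop where
  contDiff : ContDiff ℝ 3 φ
  ode : ∀ ξ, μ * iteratedDeriv 3 φ ξ - γ * iteratedDeriv 2 φ ξ - s * deriv φ ξ
    + deriv f (φ ξ) * deriv φ ξ = 0
  tendsto_left : Tendsto φ atBot (𝓝 ubl)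
  tendsto_right : Tendsto φ atTop (𝓝 ubr)

/-- The normalized profile `g = (φ - ubr) / (ubl - ubr)`. -/
def normProfile (ubl ubr : ℝ) (φ : ℝ → ℝ) (ξ : ℝ) : ℝ := (φ ξ - ubr) / (ubl - ubr)

/-- `w` is (the continuous representative of) a `p`-periodic function of class `H¹`:
it is `p`-periodic, absolutely continuous, and its derivative is square integrable on a period. -/
structure IsPeriodicH1 (p : ℝ) (w : ℝ → ℝ) : Prop where
  periodic : Function.Periodic w p
  absCont : AbsolutelyContinuousOnInterval w 0 p
  deriv_memLp : MemLp (deriv w) 2 (volume.restrict (Ioc 0 p))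

/-- The norm of `w` in `H¹(0, p)`. -/
def h1Norm (p : ℝ) (w : ℝ → ℝ) : ℝ :=
  Real.sqrt ((∫ x in (0 : ℝ)..p, (w x) ^ 2) + ∫ x in (0 : ℝ)..p, (deriv w x) ^ 2)

/-- An admissible periodic perturbation: period `p`, class `H¹`, zero mean. -/
structure IsPerturbation (p : ℝ) (w : ℝ → ℝ) : Prop where
  h1 : IsPeriodicH1 p w
  mean_zero : (1 / p) * ∫ x in (0 : ℝ)..p, w x = 0

/-- `u = u(ξ, t)` is a global continuous `p`-periodic (in `ξ`) solution, with initial data `u₀`, of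
`u_t - s u_ξ + f(u)_ξ + μ u_ξξξ = γ u_ξξ`, which is the equation
`u_t + f(u)_x + μ u_xxx = γ u_xx` in the moving coordinate `ξ = x - s t`.
The equation is tested against periodic functions of `ξ` and integrated in time, so that every
classical periodic solution, continuous up to `t = 0`, is a solution in this sense. -/
structure IsPeriodicSolution (f : ℝ → ℝ) (μ γ s p : ℝ) (u₀ : ℝ → ℝ) (u : ℝ → ℝ → ℝ) : Prop where
  continuousOn : ContinuousOn (fun q : ℝ × ℝ => u q.1 q.2) (univ ×ˢ Ici 0)
  periodic : ∀ t, 0 ≤ t → Function.Periodic (fun ξ => u ξ t) p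
  initial : ∀ ξ, u ξ 0 = u₀ ξ
  weak : ∀ ζ : ℝ → ℝ, ContDiff ℝ 3 ζ → Function.Periodic ζ p → ∀ t, 0 ≤ t →
    (∫ ξ in (0 : ℝ)..p, u ξ t * ζ ξ) - (∫ ξ in (0 : ℝ)..p, u₀ ξ * ζ ξ)
      = ∫ τ in (0 : ℝ)..t, ∫ ξ in (0 : ℝ)..p,
          ((f (u ξ τ) - s * u ξ τ) * deriv ζ ξ
            + γ * (u ξ τ * iteratedDeriv 2 ζ ξ)
            + μ * (u ξ τ * iteratedDeriv 3 ζ ξ))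

/-- The denominator `∫ (u_l - u_r) g'(ξ - e) dξ` of the shift equation. -/
def shiftDenom (g : ℝ → ℝ) (ul ur : ℝ → ℝ → ℝ) (e t : ℝ) : ℝ :=
  ∫ ξ : ℝ, (ul ξ t - ur ξ t) * deriv g (ξ - e)

/-- The right-hand side of the shift equation `η'(t) = shiftRHS … (η t) t`. -/
def shiftRHS (f : ℝ → ℝ) (μ γ s : ℝ) (g : ℝ → ℝ) (ul ur : ℝ → ℝ → ℝ) (e t : ℝ) : ℝ :=
  (γ * (∫ ξ : ℝ, (ul ξ t - ur ξ t) * iteratedDeriv 2 g (ξ - e))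
    + μ * (∫ ξ : ℝ, (ul ξ t - ur ξ t) * iteratedDeriv 3 g (ξ - e))
    + ∫ ξ : ℝ, (f (ul ξ t) - f (ur ξ t)) * deriv g (ξ - e)) / shiftDenom g ul ur e t - s

/-- All the integrals in the right-hand side of the shift equation converge absolutely and the
denominator does not vanish. -/
structure ShiftRHSWellDefined (f : ℝ → ℝ) (g : ℝ → ℝ) (ul ur : ℝ → ℝ → ℝ) (e t : ℝ) : Prop where
  integrable₁ : Integrable fun ξ : ℝ => (ul ξ t - ur ξ t) * deriv g (ξ - e)
  integrable₂ : Integrable fun ξ : ℝ => (ul ξ t - ur ξ t) * iteratedDeriv 2 g (ξ - e)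
  integrable₃ : Integrable fun ξ : ℝ => (ul ξ t - ur ξ t) * iteratedDeriv 3 g (ξ - e)
  integrable_flux : Integrable fun ξ : ℝ => (f (ul ξ t) - f (ur ξ t)) * deriv g (ξ - e)
  denom_ne_zero : shiftDenom g ul ur e t ≠ 0

/-- `η` solves the shift equation on `[0, ∞)` with `η(0) = η₀`. -/
structure IsShiftSolution (f : ℝ → ℝ) (μ γ s : ℝ) (g : ℝ → ℝ) (ul ur : ℝ → ℝ → ℝ) (η₀ : ℝ)
    (η : ℝ → ℝ) : Prop where
  initial : η 0 = η₀
  ode : ∀ t, 0 ≤ t → HasDerivWithinAt η (shiftRHS f μ γ s g ul ur (η t) t) (Ici 0) t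

/-- `η₀` is an admissible initial shift: the (improper) integral over `ℝ` of
`u₀ - U(·, 0) = (u₀ - ul₀) g(ξ - η₀) + (u₀ - ur₀) (1 - g(ξ - η₀))` is zero. -/
def IsInitialShift (g u₀ ul₀ ur₀ : ℝ → ℝ) (η₀ : ℝ) : Prop :=
  Tendsto (fun q : ℝ × ℝ => ∫ ξ in q.1..q.2,
      ((u₀ ξ - ul₀ ξ) * g (ξ - η₀) + (u₀ ξ - ur₀ ξ) * (1 - g (ξ - η₀))))
    (atBot ×ˢ atTop) (𝓝 0)

/-- The average over a period of `f(u) - f(ub) - s u + s ub` at time `t`. -/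
def meanFlux (f : ℝ → ℝ) (s p ub : ℝ) (u : ℝ → ℝ → ℝ) (t : ℝ) : ℝ :=
  (1 / p) * ∫ ξ in (0 : ℝ)..p, (f (u ξ t) - f ub - s * u ξ t + s * ub)

/-- The average over a period of the primitive `∫₀^ξ w` of `w`. -/
def meanPrimitive (p : ℝ) (w : ℝ → ℝ) : ℝ :=
  (1 / p) * ∫ ξ in (0 : ℝ)..p, ∫ y in (0 : ℝ)..ξ, w y

/-- The contribution of the periodic solutions to the limit shift. -/
def etaInfty₂ (f : ℝ → ℝ) (s pl pr ubl ubr : ℝ) (wl wr : ℝ → ℝ) (ul ur : ℝ → ℝ → ℝ) : ℝ :=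
  (∫ t in Ioi (0 : ℝ), meanFlux f s pl ubl ul t) - meanPrimitive pl wl
    - (∫ t in Ioi (0 : ℝ), meanFlux f s pr ubr ur t) + meanPrimitive pr wr

end KdVBurgers

end

/-! The shift equation is exact: its solutions are the level curves of an explicit function. Let
`v_i = u_i - ū_i`, let `V_i` be the zero-mean periodic primitive of `v_i`, let `m_i(t)` be the mean
over a period of `f(u_i) - f(ū_i)`, and let `N_i(e,t)` be the contribution of `v_i` to the numerator
(`shiftNumerator`). Put `Φ_i(e,t) = ∫₀ᵗ m_i + ∫ V_i(ξ,t) g'(ξ-e) dξ` and `H(e,t) = (ū_l - ū_r) e -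
Φ_l + Φ_r` (`shiftPotential`, `shiftInvariant`). Integrating the equation of `u_i` once in space
gives `∂ₜΦ_i = -N_i`, where `∫ g' = -1` cancels `m_i`. Moreover `∂ₑH` is minus the denominator, and
by Rankine-Hugoniot the whole right-hand side equals `-∂ₜH/∂ₑH`.

Small `v_i` keep `∂ₑH` above `(ū_l - ū_r)/2`, so each `H(·,t)` is a bijection of the line. Its level
curve through `(η₀,0)` solves the problem and is the only solution (`exists_unique_level_curve`).
Since `V_i` decays, reading `H(η(t),t) = H(η₀,0)` for large `t` gives the limit of `η` with an
exponential rate (`exists_shift`). The condition defining `η₀` says precisely that `H(η₀,0)` equals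
`η_{∞,1}` corrected by the two mean primitives (`isInitialShift_iff`); hence `η₀` exists, is unique,
and the formula for `η_∞` follows.

Two analytic inputs remain. The derivatives of `φ` must be integrable: `ū_r` is a saddle of the
integrated profile equation, and `ū_l` becomes a damped oscillator after reversing `x`; both decay
exponentially (`IsShockProfile.isBigO_right`, `IsShockProfile.isBigO_left`). And `v_i` must be `O(δ
e^{-θt})` uniformly (`exists_periodic_decay`). As the solutions are only continuous and weak, this
is done on Fourier coefficients. Zero mean gives a spectral gap, transport and dispersion are purely
imaginary, and the quadratic remainder is controlled by Duhamel's formula, heat smoothing and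
continuation in time. The identity `∂ₜΦ_i = -N_i` is likewise checked mode by mode
(`IsModeSolution.shiftPotential_eq_add_integral`). -/

noncomputable section

namespace KdVBurgers

/-! ### Exponential decay for second order equations on a half-line -/

/-- Barrier estimate for solutions of `μ v'' - γ v' ≥ a v` that vanish at `+∞`. -/
theorem le_exp_of_ode_of_tendsto_zero {v v₁ v₂ : ℝ → ℝ} (h₁ : ∀ x, HasDerivAt v (v₁ x) x)
    (h₂ : ∀ x, HasDerivAt v₁ (v₂ x) x) {μ γ a β X M : ℝ} (hμ : 0 < μ) (ha : 0 < a)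
    (hβ : 0 < β) (hβa : μ * β ^ 2 + γ * β ≤ a) (hlim : Tendsto v atTop (𝓝 0)) (hM : 0 ≤ M)
    (hX : v X ≤ M) (hode : ∀ x, X ≤ x → 0 < v x → a * v x ≤ μ * v₂ x - γ * v₁ x) :
    ∀ x, X ≤ x → v x ≤ M * Real.exp (-β * (x - X)) := by
  set h : ℝ → ℝ := fun x => M * Real.exp (-β * (x - X)) with hh
  have hh0 : ∀ x, 0 ≤ h x := fun x => mul_nonneg hM (Real.exp_pos _).le
  have hhd : ∀ x, HasDerivAt h (-β * h x) x := by
    intro x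
    have := ((((hasDerivAt_id x).sub_const X).const_mul (-β)).exp).const_mul M
    refine this.congr_deriv ?_
    simp only [hh, id]; ring
  have hhlim : Tendsto h atTop (𝓝 0) := by
    have h1 : Tendsto (fun x : ℝ => -β * (x - X)) atTop atBot := by
      have : Tendsto (fun x : ℝ => x - X) atTop atTop := tendsto_atTop_add_const_right _ _ tendsto_id
      exact this.const_mul_atTop_of_neg (by linarith)
    have h2 := (Real.tendsto_exp_atBot.comp h1).const_mul M
    rw [mul_zero] at h2; exact h2
  intro x₁ hx₁
  by_contra! hcon
  have hlt : 0 < v x₁ - h x₁ := sub_pos.2 hcon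
  have hdlim : Tendsto (fun x => v x - h x) atTop (𝓝 0) := by simpa using hlim.sub hhlim
  obtain ⟨Y, hY1, hY2⟩ := ((hdlim.eventually (gt_mem_nhds hlt)).and (eventually_gt_atTop x₁)).exists
  have hdd : ∀ x, HasDerivAt (fun x => v x - h x) (v₁ x + β * h x) x := fun x =>
    ((h₁ x).sub (hhd x)).congr_deriv (by ring)
  have hcont : Continuous (fun x => v x - h x) :=
    continuous_iff_continuousAt.2 fun x => (hdd x).continuousAt
  obtain ⟨c, hc, hmax⟩ := isCompact_Icc.exists_isMaxOn (nonempty_Icc.2 (hx₁.trans hY2.le))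
    hcont.continuousOn
  have hcx : v x₁ - h x₁ ≤ v c - h c := hmax ⟨hx₁, hY2.le⟩
  have hcX : X ≠ c := by
    rintro rfl
    have : h X = M := by simp [hh]
    linarith
  have hcY : c ≠ Y := by rintro rfl; linarith
  have hloc : IsLocalMax (fun x => v x - h x) c := hmax.isLocalMax
    (Icc_mem_nhds (lt_of_le_of_ne hc.1 hcX) (lt_of_le_of_ne hc.2 hcY))
  have hd0 := hloc.hasDerivAt_eq_zero (hdd c)
  have hder : deriv (fun x => v x - h x) = fun x => v₁ x + β * h x := funext fun x => (hdd x).deriv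
  have hd2 : deriv (deriv (fun x => v x - h x)) c = v₂ c + β * (-β * h c) := by
    rw [hder]; exact ((h₂ c).add ((hhd c).const_mul β)).deriv
  have hvc : 0 < v c := by linarith [hh0 c]
  have hpos : 0 < deriv (deriv (fun x => v x - h x)) c := by
    rw [hd2]
    have h3 := hode c hc.1 hvc
    have h4 := mul_le_mul_of_nonneg_right hβa (hh0 c)
    have h5 : 0 < a * (v c - h c) := mul_pos ha (by linarith)
    have h6 : v₁ c = - (β * h c) := by linarith
    rw [h6] at h3
    have : 0 < μ * (v₂ c + β * (-β * h c)) := by nlinarith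
    exact pos_of_mul_pos_right this hμ.le
  -- At an interior maximum the second derivative came out positive, so the point is also a local
  -- minimum. The difference is then locally constant and its second derivative vanishes, a
  -- contradiction.
  have hmin := isLocalMin_of_deriv_deriv_pos hpos (by rw [hder]; exact hd0) hcont.continuousAt
  have heq : (fun x => v x - h x) =ᶠ[𝓝 c] fun _ => v c - h c := by
    filter_upwards [hloc, hmin] with x hx1 hx2 using le_antisymm hx1 hx2
  have : deriv (deriv (fun x => v x - h x)) c = 0 := by
    rw [heq.deriv.deriv_eq]; simp
  linarith

/-- If `v` converges at `+∞` and `v'' ≥ l v' - R e^{-βx}`, then `v'` is bounded above by a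
decaying exponential. -/
theorem deriv_le_exp_of_tendsto {v v₁ v₂ : ℝ → ℝ} (h₁ : ∀ x, HasDerivAt v (v₁ x) x)
    (h₂ : ∀ x, HasDerivAt v₁ (v₂ x) x) {l β R X L : ℝ} (hl : 0 < l) (hβ : 0 < β) (hR : 0 ≤ R)
    (hlim : Tendsto v atTop (𝓝 L))
    (hode : ∀ x, X ≤ x → l * v₁ x - R * Real.exp (-β * x) ≤ v₂ x) :
    ∀ x, X ≤ x → v₁ x ≤ R / l * Real.exp (-β * x) := by
  intro x₁ hx₁
  by_contra! hcon
  set z : ℝ → ℝ := fun x => v₁ x - R / l * Real.exp (-β * x) with hz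
  have hzd : ∀ x, HasDerivAt z (v₂ x + β * (R / l) * Real.exp (-β * x)) x := by
    intro x
    have := (h₂ x).sub ((((hasDerivAt_id x).const_mul (-β)).exp).const_mul (R / l))
    refine this.congr_deriv ?_
    simp only [id]; ring
  have hyd : ∀ x, HasDerivAt (fun x => Real.exp (-l * x) * z x)
      (Real.exp (-l * x) * (v₂ x + β * (R / l) * Real.exp (-β * x) - l * z x)) x := by
    intro x
    have := ((((hasDerivAt_id x).const_mul (-l)).exp)).mul (hzd x)
    refine this.congr_deriv ?_
    simp only [id]; ring
  have hmono : MonotoneOn (fun x => Real.exp (-l * x) * z x) (Ici X) := by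
    apply monotoneOn_of_deriv_nonneg (convex_Ici X)
      (fun x _ => (hyd x).continuousAt.continuousWithinAt)
      (fun x _ => (hyd x).differentiableAt.differentiableWithinAt)
    intro x hx
    rw [interior_Ici] at hx
    rw [(hyd x).deriv]
    apply mul_nonneg (Real.exp_pos _).le
    have h3 := hode x (le_of_lt hx)
    have h4 : 0 ≤ β * (R / l) * Real.exp (-β * x) := by positivity
    have h5 : l * z x = l * v₁ x - R * Real.exp (-β * x) := by
      simp only [hz]; field_simp
    linarith
  have hε : 0 < z x₁ := sub_pos.2 hcon
  -- `z' ≥ l z`, so once `z` is positive it can never decrease again. Then `v'` stays above a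
  -- positive constant, which is incompatible with convergence of `v`.
  have hge : ∀ y, x₁ ≤ y → z x₁ ≤ v₁ y := by
    intro y hy
    have h3 : Real.exp (-l * x₁) * z x₁ ≤ Real.exp (-l * y) * z y :=
      hmono (mem_Ici.2 hx₁) (mem_Ici.2 (hx₁.trans hy)) hy
    have h4 : Real.exp (-l * y) ≤ Real.exp (-l * x₁) := Real.exp_le_exp.2 (by nlinarith)
    have hzy : 0 < z y := by
      by_contra! hneg
      have : Real.exp (-l * y) * z y ≤ 0 := mul_nonpos_of_nonneg_of_nonpos (Real.exp_pos _).le hneg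
      have : 0 < Real.exp (-l * x₁) * z x₁ := by positivity
      linarith
    have h5 : Real.exp (-l * x₁) * z x₁ ≤ Real.exp (-l * x₁) * z y :=
      h3.trans (mul_le_mul_of_nonneg_right h4 hzy.le)
    have h6 : z x₁ ≤ z y := le_of_mul_le_mul_left h5 (Real.exp_pos _)
    have h7 : 0 ≤ R / l * Real.exp (-β * y) := by positivity
    have : z y ≤ v₁ y := by simp only [hz]; linarith
    linarith
  have hdiff : Tendsto (fun y => v (y + 1) - v y) atTop (𝓝 0) := by
    simpa using (hlim.comp (tendsto_atTop_add_const_right _ 1 tendsto_id)).sub hlim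
  obtain ⟨y, hy1, hy2⟩ := ((hdiff.eventually (gt_mem_nhds hε)).and (eventually_ge_atTop x₁)).exists
  obtain ⟨c, hc, hc2⟩ := exists_hasDerivAt_eq_slope v v₁ (show y < y + 1 by linarith)
    (fun x _ => (h₁ x).continuousAt.continuousWithinAt) (fun x _ => h₁ x)
  have h8 := hge c (hy2.trans hc.1.le)
  rw [hc2] at h8
  simp at h8
  linarith

/-- With `p = q'` and `r = p'`, the left side is the derivative of the energy `μp²/2 + bq²/2 + εqp`.
Without the cross term only `γp²` is dissipated; the cross term adds `-(εb/μ) q²`. Young's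
inequality absorbs everything else: the bounds on `ε` handle `ε p²` and the product `qp`, those on
`κ` the perturbation `e`. -/
theorem damped_energy_deriv_le {μ γ b ε κ p q r : ℝ} (hμ : 0 < μ) (hγ : 0 < γ) (hb : 0 < b)
    (hε : 0 < ε) (hε1 : ε ≤ γ / 4) (hε2 : ε ≤ μ * b / (4 * γ)) (hκ1 : κ ≤ b / 4)
    (hκ2 : κ ^ 2 ≤ γ * (ε * b / (4 * μ))) (h3 : |μ * r + γ * p + b * q| ≤ κ * |q|) :
    μ * p * r + b * q * p + ε * (p * p + q * r)
      ≤ -min (γ / (4 * μ)) (ε / (4 * μ)) * (μ * p ^ 2 + b * q ^ 2) := by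
  set e := μ * r + γ * p + b * q with he
  have hr : r = (e - γ * p - b * q) / μ := by rw [he]; field_simp; ring
  have h5 : μ * p * r + b * q * p + ε * (p * p + q * r)
      = -(γ - ε) * p ^ 2 - (ε * b / μ) * q ^ 2 - (ε / μ) * (γ * (q * p)) + e * p
        + (ε / μ) * (e * q) := by
    rw [hr]; field_simp; ring
  have hεμ : 0 < ε / μ := by positivity
  have h6 : -(γ * (q * p)) ≤ (b / 4) * q ^ 2 + (γ ^ 2 / b) * p ^ 2 := by
    have : 0 ≤ (b * q / 2 + γ * p) ^ 2 / b := by positivity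
    have h7 : (b * q / 2 + γ * p) ^ 2 / b =
      (b / 4) * q ^ 2 + (γ ^ 2 / b) * p ^ 2 + γ * (q * p) := by field_simp; ring
    linarith
  have h7 : (ε / μ) * (γ ^ 2 / b) ≤ γ / 4 := by
    have : ε * (4 * γ) ≤ μ * b := by rwa [le_div_iff₀ (by positivity)] at hε2
    rw [div_mul_div_comm, div_le_div_iff₀ (by positivity) (by positivity)]
    nlinarith
  have h8 : e * q ≤ (b / 4) * q ^ 2 := by
    calc e * q ≤ |e * q| := le_abs_self _
      _ = |e| * |q| := abs_mul _ _
      _ ≤ (κ * |q|) * |q| := by gcongr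
      _ = κ * q ^ 2 := by rw [mul_assoc, abs_mul_abs_self]; ring
      _ ≤ _ := by gcongr
  have h9 : e * p ≤ (γ / 4) * p ^ 2 + (ε * b / (4 * μ)) * q ^ 2 := by
    have h10 : e ^ 2 ≤ γ * (ε * b / (4 * μ)) * q ^ 2 := by
      have : e ^ 2 ≤ (κ * |q|) ^ 2 := by rw [← sq_abs e]; gcongr
      rw [mul_pow, sq_abs] at this
      exact this.trans (by gcongr)
    have h11 : 0 ≤ (γ * p / 2 - e) ^ 2 / γ := by positivity
    have h12 : (γ * p / 2 - e) ^ 2 / γ = (γ / 4) * p ^ 2 + e ^ 2 / γ - e * p := by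
      field_simp; ring
    have h13 : e ^ 2 / γ ≤ (ε * b / (4 * μ)) * q ^ 2 := by
      rw [div_le_iff₀ hγ]; linarith
    linarith
  have h14 : min (γ / (4 * μ)) (ε / (4 * μ)) * (μ * p ^ 2) ≤ γ / 4 * p ^ 2 := by
    have : min (γ / (4 * μ)) (ε / (4 * μ)) * μ ≤ γ / 4 := by
      calc min (γ / (4 * μ)) (ε / (4 * μ)) * μ ≤ γ / (4 * μ) * μ := by gcongr; exact min_le_left _ _
        _ = γ / 4 := by field_simp
    nlinarith [sq_nonneg (p)]
  have h15 : min (γ / (4 * μ)) (ε / (4 * μ)) * (b * q ^ 2) ≤ (ε * b / (4 * μ)) * q ^ 2 := by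
    have : min (γ / (4 * μ)) (ε / (4 * μ)) * b ≤ ε * b / (4 * μ) := by
      calc min (γ / (4 * μ)) (ε / (4 * μ)) * b ≤ ε / (4 * μ) * b := by gcongr; exact min_le_right _ _
        _ = _ := by ring
    nlinarith [sq_nonneg (q)]
  have h16 := mul_le_mul_of_nonneg_left h6 hεμ.le
  have h17 := mul_le_mul_of_nonneg_left h8 hεμ.le
  have h18 := mul_le_mul_of_nonneg_right h7 (sq_nonneg (p))
  have h19 : ε * p ^ 2 ≤ γ / 4 * p ^ 2 := by gcongr
  have h21 : ε * b / μ * q ^ 2 = 4 * (ε * b / (4 * μ) * q ^ 2) := by field_simp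
  have h22 : ε / μ * (b / 4 * q ^ 2) = ε * b / (4 * μ) * q ^ 2 := by field_simp
  rw [h5]
  linarith

/-- Exponential decay for a perturbed damped oscillator `μ q'' + γ q' + b q = o(|q|)`. -/
theorem isBigO_exp_of_damped {q p r : ℝ → ℝ} (h₁ : ∀ x, HasDerivAt q (p x) x)
    (h₂ : ∀ x, HasDerivAt p (r x) x) {μ γ b : ℝ} (hμ : 0 < μ) (hγ : 0 < γ) (hb : 0 < b)
    (hode : ∀ κ > 0, ∀ᶠ x in atTop, |μ * r x + γ * p x + b * q x| ≤ κ * |q x|) :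
    ∃ c > 0, (q =O[atTop] fun x => Real.exp (-c * x)) ∧ p =O[atTop] fun x => Real.exp (-c * x) := by
  -- The first two bounds are those of the dissipation estimate. The third makes the cross term at
  -- most a quarter of `μp² + bq²`, so that the energy is comparable with that sum. Taking the
  -- minimum with `1` gives `ε² ≤ ε`.
  obtain ⟨ε, hε, hε1, hε2, hε3⟩ : ∃ ε > 0, ε ≤ γ / 4 ∧ ε ≤ μ * b / (4 * γ) ∧ ε ^ 2 ≤ μ * b / 4 := by
    refine ⟨min (min (γ / 4) (μ * b / (4 * γ))) (min 1 (μ * b / 4)), by positivity,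
      (min_le_left _ _).trans (min_le_left _ _), (min_le_left _ _).trans (min_le_right _ _), ?_⟩
    set m := min (min (γ / 4) (μ * b / (4 * γ))) (min 1 (μ * b / 4))
    have hm0 : 0 < m := by positivity
    have hm1 : m ≤ 1 := (min_le_right _ _).trans (min_le_left _ _)
    have hm2 : m ≤ μ * b / 4 := (min_le_right _ _).trans (min_le_right _ _)
    nlinarith
  obtain ⟨κ, hκ, hκ1, hκ2⟩ : ∃ κ > 0, κ ≤ b / 4 ∧ κ ^ 2 ≤ γ * (ε * b / (4 * μ)) := by
    refine ⟨min (b / 4) (min 1 (γ * (ε * b / (4 * μ)))), by positivity, min_le_left _ _, ?_⟩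
    set m := min (b / 4) (min 1 (γ * (ε * b / (4 * μ))))
    have hm0 : 0 < m := by positivity
    have hm1 : m ≤ 1 := (min_le_right _ _).trans (min_le_left _ _)
    have hm2 : m ≤ γ * (ε * b / (4 * μ)) := (min_le_right _ _).trans (min_le_right _ _)
    nlinarith
  obtain ⟨X, hX⟩ := eventually_atTop.1 (hode κ hκ)
  set E : ℝ → ℝ := fun x => μ * p x ^ 2 / 2 + b * q x ^ 2 / 2 + ε * (q x * p x) with hE
  have hEd : ∀ x, HasDerivAt E (μ * p x * r x + b * q x * p x + ε * (p x * p x + q x * r x)) x := by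
    intro x
    have := ((((h₂ x).pow 2).const_mul μ).div_const 2).add ((((h₁ x).pow 2).const_mul b).div_const 2)
      |>.add (((h₁ x).mul (h₂ x)).const_mul ε)
    refine this.congr_deriv ?_
    simp; ring
  set c := min (γ / (4 * μ)) (ε / (4 * μ)) with hc
  have hc0 : 0 < c := by positivity
  have hcross : ∀ x, |ε * (q x * p x)| ≤ (μ * p x ^ 2 + b * q x ^ 2) / 4 := by
    intro x
    apply abs_le_of_sq_le_sq _ (by positivity)
    have h3 : (ε * (q x * p x)) ^ 2 = ε ^ 2 * (q x ^ 2 * p x ^ 2) := by ring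
    rw [h3]
    have h4 := mul_le_mul_of_nonneg_right hε3 (by positivity : 0 ≤ q x ^ 2 * p x ^ 2)
    nlinarith [sq_nonneg (μ * p x ^ 2 - b * q x ^ 2)]
  have hElow : ∀ x, (μ * p x ^ 2 + b * q x ^ 2) / 4 ≤ E x := by
    intro x; have := neg_abs_le (ε * (q x * p x)); have := hcross x; simp only [hE]; linarith
  have hEup : ∀ x, E x ≤ μ * p x ^ 2 + b * q x ^ 2 := by
    intro x; have := le_abs_self (ε * (q x * p x)); have := hcross x
    have : 0 ≤ μ * p x ^ 2 := by positivity
    have : 0 ≤ b * q x ^ 2 := by positivity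
    simp only [hE]; linarith
  have hdiss : ∀ x, X ≤ x → μ * p x * r x + b * q x * p x + ε * (p x * p x + q x * r x)
      ≤ -c * E x := by
    intro x hx
    refine (damped_energy_deriv_le hμ hγ hb hε hε1 hε2 hκ1 hκ2 (hX x hx)).trans ?_
    have := mul_le_mul_of_nonneg_left (hEup x) hc0.le
    linarith
  have hanti : AntitoneOn (fun x => Real.exp (c * x) * E x) (Ici X) := by
    have hyd : ∀ x, HasDerivAt (fun x => Real.exp (c * x) * E x)
        (Real.exp (c * x) * (μ * p x * r x + b * q x * p x + ε * (p x * p x + q x * r x)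
          + c * E x)) x := by
      intro x
      have := ((((hasDerivAt_id x).const_mul c).exp)).mul (hEd x)
      refine this.congr_deriv ?_
      simp only [id]; ring
    apply antitoneOn_of_deriv_nonpos (convex_Ici X)
      (fun x _ => (hyd x).continuousAt.continuousWithinAt)
      (fun x _ => (hyd x).differentiableAt.differentiableWithinAt)
    intro x hx
    rw [interior_Ici] at hx
    rw [(hyd x).deriv]
    exact mul_nonpos_of_nonneg_of_nonpos (Real.exp_pos _).le (by linarith [hdiss x (le_of_lt hx)])
  set A := 4 * (Real.exp (c * X) * E X) with hA
  have hS : ∀ x, X ≤ x → μ * p x ^ 2 + b * q x ^ 2 ≤ A * Real.exp (-c * x) := by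
    intro x hx
    have h3 : Real.exp (c * x) * E x ≤ Real.exp (c * X) * E X := hanti self_mem_Ici (mem_Ici.2 hx) hx
    have h4 : Real.exp (-c * x) * Real.exp (c * x) = 1 := by rw [← Real.exp_add]; simp
    have h5 := mul_le_mul_of_nonneg_left h3 (Real.exp_pos (-c * x)).le
    rw [← mul_assoc, h4, one_mul] at h5
    have := hElow x
    rw [hA]; nlinarith
  have key : ∀ (k : ℝ) (w : ℝ → ℝ), 0 < k → (∀ x, X ≤ x → k * w x ^ 2 ≤ A * Real.exp (-c * x)) →
      w =O[atTop] fun x => Real.exp (-(c / 2) * x) := by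
    intro k w hk hw
    apply Asymptotics.IsBigO.of_bound (Real.sqrt (A / k))
    filter_upwards [eventually_ge_atTop X] with x hx
    have h3 := hw x hx
    have h4 : w x ^ 2 ≤ A / k * Real.exp (-(c / 2) * x) ^ 2 := by
      have : Real.exp (-(c / 2) * x) ^ 2 = Real.exp (-c * x) := by
        rw [← Real.exp_nat_mul]; congr 1; push_cast; ring
      rw [this, div_mul_eq_mul_div, le_div_iff₀ hk]; linarith
    rw [Real.norm_eq_abs, Real.norm_eq_abs, Real.abs_exp]
    calc |w x| ≤ Real.sqrt (A / k * Real.exp (-(c / 2) * x) ^ 2) := Real.abs_le_sqrt h4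
      _ = _ := by rw [Real.sqrt_mul' _ (by positivity), Real.sqrt_sq (Real.exp_pos _).le]
  refine ⟨c / 2, by positivity, key b q hb fun x hx => ?_, key μ p hμ fun x hx => ?_⟩
  · have := hS x hx
    have : 0 ≤ μ * p x ^ 2 := by positivity
    linarith
  · have := hS x hx
    have : 0 ≤ b * q x ^ 2 := by positivity
    linarith

theorem integrable_of_isBigO_exp_neg_of_comp_neg {h : ℝ → ℝ} (hc : Continuous h) {b b' : ℝ}
    (hb : 0 < b) (hb' : 0 < b') (h₁ : h =O[atTop] fun x => Real.exp (-b * x))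
    (h₂ : (fun x => h (-x)) =O[atTop] fun x => Real.exp (-b' * x)) : Integrable h := by
  have hr : IntegrableOn h (Ioi 0) := integrable_of_isBigO_exp_neg hb hc.continuousOn h₁
  have hl : IntegrableOn (fun x => h (-x)) (Ioi 0) :=
    integrable_of_isBigO_exp_neg hb' (hc.comp continuous_neg).continuousOn h₂
  have hl' : IntegrableOn h (Iio 0) := by
    have := (Measure.measurePreserving_neg (volume : Measure ℝ)).integrableOn_comp_preimage
      (Homeomorph.neg ℝ).measurableEmbedding (f := h) (s := Iio 0)
    rw [← this]
    simpa [Function.comp_def] using hl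
  rw [← integrableOn_univ, ← Iio_union_Ici (a := (0:ℝ))]
  exact hl'.union ((integrableOn_Ici_iff_integrableOn_Ioi (by simp)).2 hr)

theorem hasDerivAt_of_contDiff_three {φ : ℝ → ℝ} (h : ContDiff ℝ 3 φ) (x : ℝ) :
    HasDerivAt φ (deriv φ x) x ∧ HasDerivAt (deriv φ) (iteratedDeriv 2 φ x) x ∧
      HasDerivAt (iteratedDeriv 2 φ) (iteratedDeriv 3 φ x) x := by
  have h1 : Differentiable ℝ (deriv φ) := by
    have := h.differentiable_iteratedDeriv 1 (by norm_num)
    rwa [iteratedDeriv_one] at this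
  have h2 : Differentiable ℝ (iteratedDeriv 2 φ) := h.differentiable_iteratedDeriv 2 (by norm_num)
  refine ⟨(h.differentiable (by norm_num) x).hasDerivAt, ?_, ?_⟩
  · have : iteratedDeriv 2 φ = deriv (deriv φ) := by
      rw [iteratedDeriv_succ, iteratedDeriv_one]
    rw [this]; exact (h1 x).hasDerivAt
  · have : iteratedDeriv 3 φ = deriv (iteratedDeriv 2 φ) := by rw [iteratedDeriv_succ]
    rw [this]; exact (h2 x).hasDerivAt

/-! ### Decay and integrability for the shock profile -/

section Profile

variable {f : ℝ → ℝ} {μ γ s ubl ubr : ℝ} {φ : ℝ → ℝ}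

/-- A profile satisfies the once integrated equation. -/
theorem IsShockProfile.first_integral (hφ : IsShockProfile f μ γ s ubl ubr φ)
    (hf : Differentiable ℝ f) (ξ : ℝ) :
    μ * iteratedDeriv 2 φ ξ - γ * deriv φ ξ = s * (φ ξ - ubr) - (f (φ ξ) - f ubr) := by
  have hd := hasDerivAt_of_contDiff_three hφ.contDiff
  set G : ℝ → ℝ := fun ξ => μ * iteratedDeriv 2 φ ξ - γ * deriv φ ξ - s * φ ξ + f (φ ξ) with hG
  have hGd : ∀ x, HasDerivAt G 0 x := by
    intro x
    obtain ⟨h1, h2, h3⟩ := hd x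
    have := (((h3.const_mul μ).sub (h2.const_mul γ)).sub (h1.const_mul s)).add
      ((hf (φ x)).hasDerivAt.comp x h1)
    exact this.congr_deriv (hφ.ode x)
  have hconst : ∀ x, G x = G ξ := fun x =>
    is_const_of_deriv_eq_zero (fun x => (hGd x).differentiableAt) (fun x => (hGd x).deriv) x ξ
  set k := G ξ - (f ubr - s * ubr) with hk
  suffices hk0 : k = 0 by
    have : G ξ = f ubr - s * ubr := by linarith
    simp only [hG] at this
    linarith
  have hy : ∀ x, HasDerivAt (fun x => μ * deriv φ x - γ * φ x)
      (G ξ + s * φ x - f (φ x)) x := by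
    intro x
    obtain ⟨h1, h2, _⟩ := hd x
    refine ((h2.const_mul μ).sub (h1.const_mul γ)).congr_deriv ?_
    rw [← hconst x]; simp only [hG]; ring
  have hylim : Tendsto (fun x => G ξ + s * φ x - f (φ x)) atTop (𝓝 k) := by
    have h1 := (hf.continuous.tendsto ubr).comp hφ.tendsto_right
    have h2 := ((hφ.tendsto_right.const_mul s).const_add (G ξ)).sub h1
    have : G ξ + s * ubr - f ubr = k := by rw [hk]; ring
    rwa [this] at h2
  -- Nothing is known yet about limits of `φ'` and `φ''`. Two mean value steps replace them by
  -- differences of `φ`: the second difference of `φ` is a difference of `φ'`, and `μφ' - γφ` has a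
  -- derivative tending to `k`. All differences of `φ` tend to `0`, hence `k = 0`.
  have hstep : ∀ x, ∃ c d, x ≤ c ∧ x ≤ d ∧ μ * ((φ (x + 1 + 1) - φ (x + 1)) - (φ (x + 1) - φ x))
      = γ * (φ (c + 1) - φ c) + (G ξ + s * φ d - f (φ d)) := by
    intro x
    have hz : ∀ x, HasDerivAt (fun x => φ (x + 1) - φ x) (deriv φ (x + 1) - deriv φ x) x := by
      intro x
      have := (hd (x + 1)).1.comp_add_const x 1
      exact this.sub (hd x).1
    obtain ⟨c, hc, hc2⟩ := exists_hasDerivAt_eq_slope _ _ (show x < x + 1 by linarith)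
      (fun x _ => (hz x).continuousAt.continuousWithinAt) (fun x _ => hz x)
    obtain ⟨d, hd1, hd2⟩ := exists_hasDerivAt_eq_slope _ _ (show c < c + 1 by linarith)
      (fun x _ => (hy x).continuousAt.continuousWithinAt) (fun x _ => hy x)
    refine ⟨c, d, hc.1.le, (hc.1.trans hd1.1).le, ?_⟩
    rw [hd2]
    simp only [add_sub_cancel_left, div_one] at hc2 ⊢
    rw [← hc2]; ring
  choose c d hcx hdx hcd using hstep
  have hct : Tendsto c atTop atTop := tendsto_atTop_mono hcx tendsto_id
  have hdt : Tendsto d atTop atTop := tendsto_atTop_mono hdx tendsto_id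
  have h1 : Tendsto (fun x : ℝ => x + 1) atTop atTop := tendsto_atTop_add_const_right _ 1 tendsto_id
  have hdiff : Tendsto (fun x => φ (x + 1) - φ x) atTop (𝓝 0) := by
    simpa using (hφ.tendsto_right.comp h1).sub hφ.tendsto_right
  have hR : Tendsto (fun x => γ * (φ (c x + 1) - φ (c x)) + (G ξ + s * φ (d x) - f (φ (d x))))
      atTop (𝓝 (γ * 0 + k)) := ((hdiff.comp hct).const_mul γ).add (hylim.comp hdt)
  have hL : Tendsto (fun x => μ * ((φ (x + 1 + 1) - φ (x + 1)) - (φ (x + 1) - φ x)))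
      atTop (𝓝 (μ * (0 - 0))) := ((hdiff.comp h1).sub hdiff).const_mul μ
  rw [funext hcd] at hL
  have := tendsto_nhds_unique hL hR
  linarith

theorem IsShockProfile.first_integral' (hφ : IsShockProfile f μ γ s ubl ubr φ)
    (hf : Differentiable ℝ f) (hRH : s * (ubl - ubr) = f ubl - f ubr) (ξ : ℝ) :
    μ * iteratedDeriv 2 φ ξ - γ * deriv φ ξ = s * (φ ξ - ubl) - (f (φ ξ) - f ubl) := by
  rw [hφ.first_integral hf]; linarith

/-- Lax's condition. -/
theorem lax_condition (hf : Differentiable ℝ f) (hconv : StrictConvexOn ℝ univ f)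
    (hlr : ubr < ubl) (hRH : s * (ubl - ubr) = f ubl - f ubr) : deriv f ubr < s ∧ s < deriv f ubl := by
  have hs : slope f ubr ubl = s := by
    rw [slope_def_field, ← hRH, mul_div_cancel_right₀ _ (by linarith)]
  constructor
  · rw [← hs]; exact hconv.deriv_lt_slope (mem_univ _) (mem_univ _) hlr (hf _)
  · rw [← hs]; exact hconv.slope_lt_deriv (mem_univ _) (mem_univ _) hlr (hf _)

/-- First order Taylor expansion along a converging function. -/
theorem eventually_abs_taylor_le {l : Filter ℝ} {c : ℝ} {ψ : ℝ → ℝ} (hf : Differentiable ℝ f)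
    (hψ : Tendsto ψ l (𝓝 c)) {κ : ℝ} (hκ : 0 < κ) :
    ∀ᶠ x in l, |f (ψ x) - f c - deriv f c * (ψ x - c)| ≤ κ * |ψ x - c| := by
  have h := (hasDerivAt_iff_isLittleO.1 (hf c).hasDerivAt).bound hκ
  filter_upwards [hψ.eventually h] with x hx
  simpa [mul_comm] using hx

/-- Since `f'(ubr) < s`, the state `ubr` is a saddle of `μψ'' - γψ' = (s - f'(ubr))ψ + o(ψ)`. The
barrier estimate applied to `φ - ubr` and to its negative gives decay of `φ`. For `φ'` the equation
is then first order and unstable with an exponentially small source, so convergence of `φ` rules out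
anything but decay. -/
theorem IsShockProfile.isBigO_right (hφ : IsShockProfile f μ γ s ubl ubr φ)
    (hf : Differentiable ℝ f) (hμ : 0 < μ) (hγ : 0 < γ) (hs : deriv f ubr < s) :
    ∃ β > 0, ((fun x => φ x - ubr) =O[atTop] fun x => Real.exp (-β * x)) ∧
      deriv φ =O[atTop] fun x => Real.exp (-β * x) := by
  have hd := hasDerivAt_of_contDiff_three hφ.contDiff
  -- Half of the spectral gap drives the barrier; the other half absorbs the Taylor remainder of
  -- `f`.
  set a := (s - deriv f ubr) / 2 with ha
  have ha0 : 0 < a := by rw [ha]; linarith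
  obtain ⟨β, hβ, hβa⟩ : ∃ β > 0, μ * β ^ 2 + γ * β ≤ a := by
    refine ⟨min 1 (a / (μ + γ)), by positivity, ?_⟩
    set m := min 1 (a / (μ + γ))
    have h0 : 0 < m := by positivity
    have h1 : m ≤ 1 := min_le_left _ _
    have h2 : m * (μ + γ) ≤ a := (le_div_iff₀ (by positivity)).1 (min_le_right _ _)
    nlinarith [mul_nonneg hμ.le h0.le]
  obtain ⟨X, hX⟩ := eventually_atTop.1 (eventually_abs_taylor_le hf hφ.tendsto_right ha0)
  have hlim : Tendsto (fun x => φ x - ubr) atTop (𝓝 0) := by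
    simpa using hφ.tendsto_right.sub_const ubr
  have hint := hφ.first_integral hf
  have hup := le_exp_of_ode_of_tendsto_zero (v := fun x => φ x - ubr) (X := X) (M := |φ X - ubr|)
    (fun x => (hd x).1.sub_const ubr) (fun x => (hd x).2.1) hμ ha0 hβ hβa hlim (abs_nonneg _)
    (le_abs_self _) (by
      intro x hx hpos
      rw [hint x]
      have h1 := hX x hx
      rw [abs_of_pos hpos] at h1
      have := (abs_le.1 h1).2
      have h2 : s - deriv f ubr = 2 * a := by rw [ha]; ring
      nlinarith)
  have hlow := le_exp_of_ode_of_tendsto_zero (v := fun x => -(φ x - ubr)) (X := X)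
    (M := |φ X - ubr|) (fun x => ((hd x).1.sub_const ubr).neg) (fun x => (hd x).2.1.neg)
    hμ ha0 hβ hβa (by simpa using hlim.neg) (abs_nonneg _) (neg_le_abs _) (by
      intro x hx hpos
      have h1 := hX x hx
      have := hint x
      rw [abs_of_neg (a := φ x - ubr) (by linarith)] at h1
      have := (abs_le.1 h1).1
      have h2 : s - deriv f ubr = 2 * a := by rw [ha]; ring
      nlinarith)
  set M := |φ X - ubr| * Real.exp (β * X) with hM
  have hM0 : 0 ≤ M := by positivity
  have habs : ∀ x, X ≤ x → |φ x - ubr| ≤ M * Real.exp (-β * x) := by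
    intro x hx
    have h1 : |φ X - ubr| * Real.exp (-β * (x - X)) = M * Real.exp (-β * x) := by
      rw [hM, mul_assoc, ← Real.exp_add]; congr 2; ring
    have h2 := hup x hx
    have h3 := hlow x hx
    rw [h1] at h2 h3
    exact abs_le.2 ⟨by linarith, h2⟩
  set B := (|s - deriv f ubr| + a) * M / μ with hB
  have hB0 : 0 ≤ B := by positivity
  have hrem : ∀ x, X ≤ x → |iteratedDeriv 2 φ x - γ / μ * deriv φ x| ≤ B * Real.exp (-β * x) := by
    intro x hx
    have h1 : iteratedDeriv 2 φ x - γ / μ * deriv φ x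
        = ((s - deriv f ubr) * (φ x - ubr)
          - (f (φ x) - f ubr - deriv f ubr * (φ x - ubr))) / μ := by
      rw [eq_div_iff hμ.ne']
      have := hint x
      field_simp
      linarith
    rw [h1, abs_div, abs_of_pos hμ, div_le_iff₀ hμ]
    calc |(s - deriv f ubr) * (φ x - ubr) - (f (φ x) - f ubr - deriv f ubr * (φ x - ubr))|
        ≤ |(s - deriv f ubr) * (φ x - ubr)| + |f (φ x) - f ubr - deriv f ubr * (φ x - ubr)| :=
          abs_sub _ _
      _ ≤ |s - deriv f ubr| * |φ x - ubr| + a * |φ x - ubr| := by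
          rw [abs_mul]; gcongr; exact hX x hx
      _ = (|s - deriv f ubr| + a) * |φ x - ubr| := by ring
      _ ≤ (|s - deriv f ubr| + a) * (M * Real.exp (-β * x)) := by gcongr; exact habs x hx
      _ = B * Real.exp (-β * x) * μ := by rw [hB]; field_simp
  have hl : 0 < γ / μ := by positivity
  have h5 := deriv_le_exp_of_tendsto (v := φ) (R := B) (X := X) (fun x => (hd x).1)
    (fun x => (hd x).2.1) hl hβ hB0 hφ.tendsto_right (fun x hx => by
      have := (abs_le.1 (hrem x hx)).1; linarith)
  have h6 := deriv_le_exp_of_tendsto (v := fun x => -φ x) (R := B) (X := X) (fun x => (hd x).1.neg)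
    (fun x => (hd x).2.1.neg) hl hβ hB0 hφ.tendsto_right.neg (fun x hx => by
      have := (abs_le.1 (hrem x hx)).2; linarith)
  refine ⟨β, hβ, Asymptotics.IsBigO.of_bound M ?_, Asymptotics.IsBigO.of_bound (B / (γ / μ)) ?_⟩
  · filter_upwards [eventually_ge_atTop X] with x hx
    rw [Real.norm_eq_abs, Real.norm_eq_abs, Real.abs_exp]
    exact habs x hx
  · filter_upwards [eventually_ge_atTop X] with x hx
    rw [Real.norm_eq_abs, Real.norm_eq_abs, Real.abs_exp]
    exact abs_le.2 ⟨by linarith [h6 x hx], h5 x hx⟩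

/-- Here `s < f'(ubl)`, and reversing `x` turns `-γφ'` into damping: `q(x) = φ(-x) - ubl` satisfies
`μq'' + γq' + (f'(ubl) - s)q = o(q)`. Oscillation is possible, so an energy is used in place of a
barrier. -/
theorem IsShockProfile.isBigO_left (hφ : IsShockProfile f μ γ s ubl ubr φ)
    (hf : Differentiable ℝ f) (hμ : 0 < μ) (hγ : 0 < γ)
    (hRH : s * (ubl - ubr) = f ubl - f ubr) (hs : s < deriv f ubl) :
    ∃ β > 0, ((fun x => φ (-x) - ubl) =O[atTop] fun x => Real.exp (-β * x)) ∧
      (fun x => deriv φ (-x)) =O[atTop] fun x => Real.exp (-β * x) := by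
  have hd := hasDerivAt_of_contDiff_three hφ.contDiff
  have hneg : ∀ {h : ℝ → ℝ} {h' : ℝ} {x : ℝ}, HasDerivAt h h' (-x) →
      HasDerivAt (fun x => h (-x)) (-h') x := by
    intro h h' x hh
    have := hh.comp x (hasDerivAt_neg x)
    exact this.congr_deriv (by ring)
  have hlim : Tendsto (fun x => φ (-x)) atTop (𝓝 ubl) :=
    hφ.tendsto_left.comp tendsto_neg_atTop_atBot
  obtain ⟨c, hc, h1, h2⟩ := isBigO_exp_of_damped (q := fun x => φ (-x) - ubl)
    (p := fun x => -deriv φ (-x)) (r := fun x => iteratedDeriv 2 φ (-x)) (b := deriv f ubl - s)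
    (fun x => (hneg (hd (-x)).1).sub_const ubl)
    (fun x => ((hneg (hd (-x)).2.1).neg).congr_deriv (by ring)) hμ hγ (by linarith) (by
      intro κ hκ
      filter_upwards [eventually_abs_taylor_le hf hlim hκ] with x hx
      refine le_trans (le_of_eq ?_) hx
      rw [← abs_neg]
      congr 1
      have := hφ.first_integral' hf hRH (-x)
      linarith)
  exact ⟨c, hc, h1, by simpa using h2.neg_left⟩

theorem IsShockProfile.exists_bound (hφ : IsShockProfile f μ γ s ubl ubr φ) :
    ∃ B, ∀ x, |φ x| ≤ B := by
  obtain ⟨X, hX⟩ := eventually_atTop.1 (hφ.tendsto_right.abs.eventually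
    (gt_mem_nhds (lt_add_one |ubr|)))
  obtain ⟨Y, hY⟩ := eventually_atBot.1 (hφ.tendsto_left.abs.eventually
    (gt_mem_nhds (lt_add_one |ubl|)))
  obtain ⟨A, hA⟩ := (isCompact_Icc (a := Y) (b := X)).exists_bound_of_continuousOn
    hφ.contDiff.continuous.continuousOn
  refine ⟨max A (max (|ubr| + 1) (|ubl| + 1)), fun x => ?_⟩
  rcases le_total x Y with h | h
  · exact le_max_of_le_right (le_max_of_le_right (hY x h).le)
  rcases le_total X x with h' | h'
  · exact le_max_of_le_right (le_max_of_le_left (hX x h').le)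
  · exact le_max_of_le_left (hA x ⟨h, h'⟩)

/-- The exponential bounds at both ends settle `φ'`. The once integrated equation then expresses
`φ''`, and the profile equation expresses `φ'''` through `φ''` and `φ'`, where `f'(φ)` is bounded
because `φ` is. -/
theorem IsShockProfile.integrable_derivs (hφ : IsShockProfile f μ γ s ubl ubr φ)
    (hf : ContDiff ℝ 1 f) (hconv : StrictConvexOn ℝ univ f) (hμ : 0 < μ) (hγ : 0 < γ)
    (hlr : ubr < ubl) (hRH : s * (ubl - ubr) = f ubl - f ubr) :
    Integrable (deriv φ) ∧ Integrable (iteratedDeriv 2 φ) ∧ Integrable (iteratedDeriv 3 φ) := by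
  have hfd : Differentiable ℝ f := hf.differentiable (by norm_num)
  obtain ⟨hs1, hs2⟩ := lax_condition hfd hconv hlr hRH
  obtain ⟨b, hb, hr1, hr2⟩ := hφ.isBigO_right hfd hμ hγ hs1
  obtain ⟨b', hb', hl1, hl2⟩ := hφ.isBigO_left hfd hμ hγ hRH hs2
  have hc1 : Continuous (deriv φ) := hφ.contDiff.continuous_deriv (by norm_num)
  have hc2 : Continuous (iteratedDeriv 2 φ) := hφ.contDiff.continuous_iteratedDeriv 2 (by norm_num)
  have hc3 : Continuous (iteratedDeriv 3 φ) := hφ.contDiff.continuous_iteratedDeriv 3 (by norm_num)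
  have hi1 : Integrable (deriv φ) := integrable_of_isBigO_exp_neg_of_comp_neg hc1 hb hb' hr2 hl2
  have hrem : ∀ {l : Filter ℝ} {c : ℝ} {ψ e : ℝ → ℝ}, Tendsto ψ l (𝓝 c) →
      ((fun x => ψ x - c) =O[l] e) → (fun x => f (ψ x) - f c) =O[l] e := by
    intro l c ψ e hψ he
    exact ((hfd c).hasDerivAt.isBigO_sub.comp_tendsto hψ).trans he
  have hi2 : Integrable (iteratedDeriv 2 φ) := by
    refine integrable_of_isBigO_exp_neg_of_comp_neg hc2 hb hb' ?_ ?_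
    · have h1 : iteratedDeriv 2 φ = fun x =>
          (1 / μ) * (γ * deriv φ x + (s * (φ x - ubr) - (f (φ x) - f ubr))) := by
        funext x
        rw [← hφ.first_integral hfd x]; field_simp; ring
      rw [h1]
      exact ((hr2.const_mul_left γ).add ((hr1.const_mul_left s).sub
        (hrem hφ.tendsto_right hr1))).const_mul_left _
    · have h1 : (fun x => iteratedDeriv 2 φ (-x)) = fun x =>
          (1 / μ) * (γ * deriv φ (-x) + (s * (φ (-x) - ubl) - (f (φ (-x)) - f ubl))) := by
        funext x
        rw [← hφ.first_integral' hfd hRH (-x)]; field_simp; ring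
      rw [h1]
      exact ((hl2.const_mul_left γ).add ((hl1.const_mul_left s).sub
        (hrem (hφ.tendsto_left.comp tendsto_neg_atTop_atBot) hl1))).const_mul_left _
  refine ⟨hi1, hi2, ?_⟩
  obtain ⟨B, hB⟩ := hφ.exists_bound
  have hfc : Continuous (deriv f) := hf.continuous_deriv (by norm_num)
  obtain ⟨D, hD⟩ := (isCompact_Icc (a := -B) (b := B)).exists_bound_of_continuousOn hfc.continuousOn
  have hi4 : Integrable (fun x => deriv f (φ x) * deriv φ x) :=
    hi1.bdd_mul (hfc.comp hφ.contDiff.continuous).aestronglyMeasurable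
      (ae_of_all _ fun x => hD _ (abs_le.1 (hB x)))
  have h1 : iteratedDeriv 3 φ = fun x =>
      (1 / μ) * (γ * iteratedDeriv 2 φ x + s * deriv φ x - deriv f (φ x) * deriv φ x) := by
    funext x
    have := hφ.ode x
    field_simp
    linarith
  rw [h1]
  exact (((hi2.const_mul γ).add (hi1.const_mul s)).sub hi4).const_mul _

end Profile

/-! ### Fourier coefficients of periodic functions -/

/-- The wave number `2πk/p`. -/
def waveNumber (p : ℝ) (k : ℤ) : ℝ := 2 * Real.pi * k / p

/-- The `k`-th Fourier coefficient of a real function on `[0, p]`. -/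
def modeCoeff (p : ℝ) (v : ℝ → ℝ) (k : ℤ) : ℂ :=
  (p : ℂ)⁻¹ * ∫ x in (0 : ℝ)..p, Complex.exp (-((waveNumber p k * x : ℝ) : ℂ) * Complex.I) * (v x : ℂ)

theorem waveNumber_sq_ge {p : ℝ} (hp : 0 < p) {k : ℤ} (hk : k ≠ 0) :
    (2 * Real.pi / p) ^ 2 ≤ waveNumber p k ^ 2 := by
  have h1 : (1 : ℝ) ≤ (k : ℝ) ^ 2 := by
    have : 0 < k ^ 2 := by positivity
    exact_mod_cast this
  have h2 : waveNumber p k ^ 2 = (2 * Real.pi / p) ^ 2 * (k : ℝ) ^ 2 := by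
    rw [waveNumber]; ring
  rw [h2]
  exact le_mul_of_one_le_right (by positivity) h1

theorem waveNumber_ne_zero {p : ℝ} (hp : 0 < p) {k : ℤ} (hk : k ≠ 0) : waveNumber p k ≠ 0 := by
  have : (k : ℝ) ≠ 0 := by exact_mod_cast hk
  have := Real.pi_pos
  rw [waveNumber]; positivity

theorem fourier_neg_coe_eq_exp {T : ℝ} (k : ℤ) (x : ℝ) :
    fourier (-k) (x : AddCircle T) = Complex.exp (-((waveNumber T k * x : ℝ) : ℂ) * Complex.I) := by
  rw [fourier_coe_apply, waveNumber]
  congr 1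
  push_cast
  ring

theorem modeCoeff_eq_fourierCoeffOn {p : ℝ} (hp : 0 < p) (v : ℝ → ℝ) (k : ℤ) :
    modeCoeff p v k = fourierCoeffOn hp (fun x => (v x : ℂ)) k := by
  rw [fourierCoeffOn_eq_integral, modeCoeff]
  simp_rw [fourier_neg_coe_eq_exp, smul_eq_mul, sub_zero]
  rw [Complex.real_smul]
  push_cast
  rw [one_div]

theorem sum_sq_modeCoeff_le {p : ℝ} (hp : 0 < p) {v : ℝ → ℝ}
    (hv : MemLp v 2 (volume.restrict (Ioc 0 p))) (S : Finset ℤ) :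
    ∑ k ∈ S, ‖modeCoeff p v k‖ ^ 2 ≤ p⁻¹ * ∫ x in (0 : ℝ)..p, v x ^ 2 := by
  have h := hasSum_sq_fourierCoeffOn hp hv.ofReal (f := fun x => (v x : ℂ))
  simp only [sub_zero, smul_eq_mul, Complex.norm_real, Real.norm_eq_abs, sq_abs] at h
  simp_rw [modeCoeff_eq_fourierCoeffOn hp]
  exact sum_le_hasSum S (fun k _ => by positivity) h

theorem sum_sq_modeCoeff_le_of_bound {p : ℝ} (hp : 0 < p) {v : ℝ → ℝ} (hv : Continuous v) {B : ℝ}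
    (hB : ∀ x, |v x| ≤ B) (S : Finset ℤ) :
    ∑ k ∈ S, ‖modeCoeff p v k‖ ^ 2 ≤ B ^ 2 := by
  have hm : MemLp v 2 (volume.restrict (Ioc 0 p)) :=
    MemLp.of_bound hv.aestronglyMeasurable B (ae_of_all _ hB)
  refine (sum_sq_modeCoeff_le hp hm S).trans ?_
  have h1 : ∫ x in (0 : ℝ)..p, v x ^ 2 ≤ ∫ x in (0 : ℝ)..p, B ^ 2 :=
    intervalIntegral.integral_mono_on hp.le ((hv.pow 2).intervalIntegrable _ _)
      (by simp) (fun x _ => sq_le_sq' (abs_le.1 (hB x)).1 (abs_le.1 (hB x)).2)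
  rw [intervalIntegral.integral_const, sub_zero, smul_eq_mul] at h1
  rw [inv_mul_le_iff₀ hp]
  exact h1

/-- A continuous periodic function is bounded by the `ℓ¹` norm of its Fourier coefficients. -/
theorem abs_le_of_sum_modeCoeff_le {p : ℝ} (hp : 0 < p) {v : ℝ → ℝ} (hv : Continuous v)
    (hper : Function.Periodic v p) {B : ℝ} (hB : ∀ S : Finset ℤ, ∑ k ∈ S, ‖modeCoeff p v k‖ ≤ B)
    (x : ℝ) : |v x| ≤ B := by
  have : Fact (0 < p) := ⟨hp⟩
  have hperC : Function.Periodic (fun x => (v x : ℂ)) p := fun x => by simp [hper x]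
  let F : C(AddCircle p, ℂ) := ⟨hperC.lift, by
    apply continuous_coinduced_dom.2
    have : (hperC.lift ∘ ((↑) : ℝ → AddCircle p)) = fun x => (v x : ℂ) := by
      funext y; exact hperC.lift_coe y
    show Continuous (hperC.lift ∘ ((↑) : ℝ → AddCircle p))
    rw [this]
    exact Complex.continuous_ofReal.comp hv⟩
  have hF : ∀ y : ℝ, F y = (v y : ℂ) := fun y => hperC.lift_coe y
  have hcoeff : ∀ k, fourierCoeff F k = modeCoeff p v k := by
    intro k
    rw [fourierCoeff_eq_intervalIntegral _ _ 0, modeCoeff, Complex.real_smul]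
    simp_rw [fourier_neg_coe_eq_exp, hF, smul_eq_mul, zero_add]
    push_cast
    rw [one_div]
  have hsum : Summable fun k => ‖fourierCoeff F k‖ := by
    simp_rw [hcoeff]
    exact summable_of_sum_le (fun _ => norm_nonneg _) hB
  have hs := has_pointwise_sum_fourier_series_of_summable hsum.of_norm (x : AddCircle p)
  have h1 : ‖F (x : AddCircle p)‖ ≤ ∑' k, ‖fourierCoeff F k‖ := by
    refine hs.norm_le_of_bounded hsum.hasSum fun k => ?_
    rw [norm_smul]
    have : ‖fourier k (x : AddCircle p)‖ = 1 := by
      rw [fourier_apply]; exact Circle.norm_coe _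
    rw [this, mul_one]
  rw [hF, Complex.norm_real, Real.norm_eq_abs] at h1
  refine h1.trans (hsum.tsum_le_of_sum_le fun S => ?_)
  simp_rw [hcoeff]
  exact hB S

theorem eq_zero_of_modeCoeff_eq_zero {p : ℝ} (hp : 0 < p) {v : ℝ → ℝ} (hv : Continuous v)
    (hper : Function.Periodic v p) (h : ∀ k, modeCoeff p v k = 0) (x : ℝ) : v x = 0 := by
  have := abs_le_of_sum_modeCoeff_le hp hv hper (B := 0) (fun S => by simp [h]) x
  exact abs_nonpos_iff.1 this

theorem integral_exp_mul_ofReal {p c : ℝ} {v : ℝ → ℝ} (hv : IntervalIntegrable v volume 0 p) :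
    ∫ x in (0 : ℝ)..p, Complex.exp (-((c * x : ℝ) : ℂ) * Complex.I) * (v x : ℂ)
      = ((∫ x in (0 : ℝ)..p, v x * Real.cos (c * x) : ℝ) : ℂ)
        - ((∫ x in (0 : ℝ)..p, v x * Real.sin (c * x) : ℝ) : ℂ) * Complex.I := by
  rw [← intervalIntegral.integral_ofReal, ← intervalIntegral.integral_ofReal,
    ← intervalIntegral.integral_mul_const, ← intervalIntegral.integral_sub]
  · apply intervalIntegral.integral_congr
    intro x _
    have h1 : -((c * x : ℝ) : ℂ) * Complex.I = ((-(c * x) : ℝ) : ℂ) * Complex.I := by push_cast; ring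
    simp only [h1]
    rw [Complex.exp_mul_I, ← Complex.ofReal_cos, ← Complex.ofReal_sin, Real.cos_neg, Real.sin_neg]
    push_cast
    ring
  · have := (hv.mul_continuousOn (g := fun x => Real.cos (c * x)) (by fun_prop))
    exact ⟨this.1.ofReal, this.2.ofReal⟩
  · have := (hv.mul_continuousOn (g := fun x => Real.sin (c * x)) (by fun_prop))
    exact IntervalIntegrable.mul_const ⟨this.1.ofReal, this.2.ofReal⟩ _

theorem modeCoeff_eq_cos_sub_sin {p : ℝ} {v : ℝ → ℝ} (hv : IntervalIntegrable v volume 0 p)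
    (k : ℤ) : modeCoeff p v k = (p : ℂ)⁻¹ *
      (((∫ x in (0 : ℝ)..p, v x * Real.cos (waveNumber p k * x) : ℝ) : ℂ)
        - ((∫ x in (0 : ℝ)..p, v x * Real.sin (waveNumber p k * x) : ℝ) : ℂ) * Complex.I) := by
  rw [modeCoeff, integral_exp_mul_ofReal hv]

theorem cos_waveNumber_periodic {p : ℝ} (hp : 0 < p) (k : ℤ) :
    Function.Periodic (fun x => Real.cos (waveNumber p k * x)) p := by
  intro x
  have : waveNumber p k * (x + p) = waveNumber p k * x + k * (2 * Real.pi) := by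
    rw [waveNumber]; field_simp
  simp only [this, Real.cos_add_int_mul_two_pi]

theorem sin_waveNumber_periodic {p : ℝ} (hp : 0 < p) (k : ℤ) :
    Function.Periodic (fun x => Real.sin (waveNumber p k * x)) p := by
  intro x
  have : waveNumber p k * (x + p) = waveNumber p k * x + k * (2 * Real.pi) := by
    rw [waveNumber]; field_simp
  simp only [this, Real.sin_add_int_mul_two_pi]

theorem absolutelyContinuousOnInterval_of_deriv_bound {h h' : ℝ → ℝ} {a b : ℝ}
    (hd : ∀ x, HasDerivAt h (h' x) x) {K : ℝ} (hK : ∀ x, |h' x| ≤ K) :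
    AbsolutelyContinuousOnInterval h a b := by
  have hK0 : 0 ≤ K := (abs_nonneg _).trans (hK 0)
  have : LipschitzWith K.toNNReal h := lipschitzWith_of_nnnorm_deriv_le
    (fun x => (hd x).differentiableAt) (fun x => by
      rw [(hd x).deriv, ← NNReal.coe_le_coe, coe_nnnorm, Real.coe_toNNReal _ hK0]; exact hK x)
  exact this.lipschitzOnWith.absolutelyContinuousOnInterval

theorem hasDerivAt_cos_mul (c x : ℝ) :
    HasDerivAt (fun x => Real.cos (c * x)) (-(c * Real.sin (c * x))) x := by
  have := ((hasDerivAt_id x).const_mul c).cos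
  exact this.congr_deriv (by simp; ring)

theorem hasDerivAt_sin_mul (c x : ℝ) :
    HasDerivAt (fun x => Real.sin (c * x)) (c * Real.cos (c * x)) x := by
  have := ((hasDerivAt_id x).const_mul c).sin
  exact this.congr_deriv (by simp; ring)

/-- Fourier coefficients of the derivative of an absolutely continuous periodic function. -/
theorem modeCoeff_deriv {p : ℝ} (hp : 0 < p) {w : ℝ → ℝ}
    (hw : AbsolutelyContinuousOnInterval w 0 p) (hper : w p = w 0) (k : ℤ) :
    modeCoeff p (deriv w) k = (waveNumber p k * Complex.I) * modeCoeff p w k := by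
  rw [modeCoeff_eq_cos_sub_sin hw.intervalIntegrable_deriv,
    modeCoeff_eq_cos_sub_sin hw.continuousOn.intervalIntegrable]
  set c := waveNumber p k with hc
  have hcosAC : AbsolutelyContinuousOnInterval (fun x => Real.cos (c * x)) 0 p :=
    absolutelyContinuousOnInterval_of_deriv_bound (hasDerivAt_cos_mul c) (K := |c|) (fun x => by
      rw [abs_neg, abs_mul]; exact mul_le_of_le_one_right (abs_nonneg _) (Real.abs_sin_le_one _))
  have hsinAC : AbsolutelyContinuousOnInterval (fun x => Real.sin (c * x)) 0 p :=
    absolutelyContinuousOnInterval_of_deriv_bound (hasDerivAt_sin_mul c) (K := |c|) (fun x => by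
      rw [abs_mul]; exact mul_le_of_le_one_right (abs_nonneg _) (Real.abs_cos_le_one _))
  have hcp : Real.cos (c * p) = 1 := by
    have := cos_waveNumber_periodic hp k 0
    simpa [hc] using this
  have hsp : Real.sin (c * p) = 0 := by
    have := sin_waveNumber_periodic hp k 0
    simpa [hc] using this
  have h1 := hcosAC.integral_mul_deriv_eq_deriv_mul hw
  have h2 := hsinAC.integral_mul_deriv_eq_deriv_mul hw
  simp only [fun x => (hasDerivAt_cos_mul c x).deriv, fun x => (hasDerivAt_sin_mul c x).deriv,
    hcp, hsp, hper, mul_zero, Real.cos_zero, Real.sin_zero] at h1 h2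
  have h3 : ∫ x in (0 : ℝ)..p, deriv w x * Real.cos (c * x)
      = c * ∫ x in (0 : ℝ)..p, w x * Real.sin (c * x) := by
    rw [← intervalIntegral.integral_const_mul]
    simp_rw [mul_comm (deriv w _)]
    rw [h1, sub_self, zero_sub, ← intervalIntegral.integral_neg]
    congr 1; funext x; ring
  have h4 : ∫ x in (0 : ℝ)..p, deriv w x * Real.sin (c * x)
      = -(c * ∫ x in (0 : ℝ)..p, w x * Real.cos (c * x)) := by
    rw [← intervalIntegral.integral_const_mul, ← intervalIntegral.integral_neg]
    simp_rw [mul_comm (deriv w _)]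
    rw [h2, zero_mul, sub_self, zero_sub, ← intervalIntegral.integral_neg]
    congr 1; funext x; ring
  rw [h3, h4]
  push_cast
  linear_combination ((p : ℂ)⁻¹ * c * ((∫ x in (0 : ℝ)..p, w x * Real.sin (c * x) : ℝ) : ℂ)) *
    Complex.I_sq

/-! ### From weak solutions to equations for the Fourier modes -/

/-- The symbol of the derivative, with the sign coming from an integration by parts. -/
def modeSymbol (p : ℝ) (k : ℤ) : ℂ := -((waveNumber p k : ℂ) * Complex.I)

/-- A time-continuous periodic zero-mean perturbation `v` of the constant state `ub` whose Fourier
modes satisfy the integrated equations; it is constant in time for negative times. -/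
structure IsModeSolution (f : ℝ → ℝ) (μ γ s p ub : ℝ) (v : ℝ → ℝ → ℝ) : Prop where
  continuous : Continuous fun q : ℝ × ℝ => v q.1 q.2
  periodic : ∀ t, Function.Periodic (fun ξ => v ξ t) p
  mean_zero : ∀ t, ∫ ξ in (0 : ℝ)..p, v ξ t = 0
  mode : ∀ k t, 0 ≤ t → modeCoeff p (fun ξ => v ξ t) k - modeCoeff p (fun ξ => v ξ 0) k =
    ∫ τ in (0 : ℝ)..t, (modeSymbol p k * modeCoeff p (fun ξ => f (ub + v ξ τ) - f ub) k
      + (-s * modeSymbol p k + γ * modeSymbol p k ^ 2 + μ * modeSymbol p k ^ 3)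
        * modeCoeff p (fun ξ => v ξ τ) k)

theorem continuous_slice {v : ℝ → ℝ → ℝ} (hv : Continuous fun q : ℝ × ℝ => v q.1 q.2) (t : ℝ) :
    Continuous fun ξ => v ξ t := hv.comp (Continuous.prodMk_left t)

theorem continuous_integral_slice {v : ℝ → ℝ → ℝ} (hv : Continuous fun q : ℝ × ℝ => v q.1 q.2)
    {ζ : ℝ → ℝ} (hζ : Continuous ζ) (a b : ℝ) : Continuous fun t => ∫ ξ in a..b, v ξ t * ζ ξ := by
  apply intervalIntegral.continuous_parametric_intervalIntegral_of_continuous'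
  exact (hv.comp continuous_swap).mul (hζ.comp continuous_snd)

theorem continuous_modeCoeff {v : ℝ → ℝ → ℝ} (hv : Continuous fun q : ℝ × ℝ => v q.1 q.2) (p : ℝ)
    (k : ℤ) : Continuous fun t => modeCoeff p (fun ξ => v ξ t) k := by
  unfold modeCoeff
  refine continuous_const.mul ?_
  apply intervalIntegral.continuous_parametric_intervalIntegral_of_continuous'
  have h1 := Complex.continuous_ofReal.comp (hv.comp continuous_swap)
  have h2 : Continuous fun q : ℝ × ℝ =>
    Complex.exp (-((waveNumber p k * q.2 : ℝ) : ℂ) * Complex.I) := by fun_prop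
  exact h2.mul h1

theorem periodic_deriv {h : ℝ → ℝ} {p : ℝ} (hh : Function.Periodic h p) :
    Function.Periodic (deriv h) p := by
  intro x
  have : (fun y => h (y + p)) = h := funext hh
  rw [← deriv_comp_add_const, this]

theorem integral_deriv_periodic_eq_zero {h h' : ℝ → ℝ} {p : ℝ} (hd : ∀ x, HasDerivAt h (h' x) x)
    (hc : Continuous h') (hp : Function.Periodic h p) : ∫ x in (0 : ℝ)..p, h' x = 0 := by
  rw [intervalIntegral.integral_eq_sub_of_hasDerivAt (fun x _ => hd x) (hc.intervalIntegrable _ _)]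
  have := hp 0
  rw [zero_add] at this
  rw [this, sub_self]

section Clamp

variable {f : ℝ → ℝ} {μ γ s p ub : ℝ} {w : ℝ → ℝ} {u : ℝ → ℝ → ℝ}

/-- The perturbation `u - ub`, frozen for negative times. -/
def clampedPerturbation (ub : ℝ) (u : ℝ → ℝ → ℝ) (ξ t : ℝ) : ℝ := u ξ (max t 0) - ub

/-- Freezing the perturbation before time `0` buys joint continuity on the whole plane, so that
parametric integrals are continuous and primitives in time are differentiable without one-sided
caveats. -/
theorem IsPeriodicSolution.continuous_clamped {u₀ : ℝ → ℝ}
    (hu : IsPeriodicSolution f μ γ s p u₀ u) :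
    Continuous fun q : ℝ × ℝ => clampedPerturbation ub u q.1 q.2 := by
  have h1 : Continuous fun q : ℝ × ℝ => (q.1, max q.2 0) := by fun_prop
  have := hu.continuousOn.comp_continuous h1 (fun q => ⟨mem_univ _, le_max_right q.2 0⟩)
  exact this.sub continuous_const

theorem clampedPerturbation_of_nonneg {t : ℝ} (ht : 0 ≤ t) (ξ : ℝ) :
    clampedPerturbation ub u ξ t = u ξ t - ub := by rw [clampedPerturbation, max_eq_left ht]

/-- The constants `ub` and `f ub` drop out because the derivatives of a periodic test function
integrate to zero over a period. The derivatives of the test function are arguments so that explicit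
trigonometric functions can be inserted. -/
theorem IsPeriodicSolution.weak_clamped (hf : Continuous f)
    (hu : IsPeriodicSolution f μ γ s p (fun ξ => ub + w ξ) u) {ζ ζ₁ ζ₂ ζ₃ : ℝ → ℝ}
    (h1 : ∀ x, HasDerivAt ζ (ζ₁ x) x) (h2 : ∀ x, HasDerivAt ζ₁ (ζ₂ x) x)
    (h3 : ∀ x, HasDerivAt ζ₂ (ζ₃ x) x) (hc3 : Continuous ζ₃) (hper : Function.Periodic ζ p)
    {t : ℝ} (ht : 0 ≤ t) :
    (∫ ξ in (0 : ℝ)..p, clampedPerturbation ub u ξ t * ζ ξ)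
      - (∫ ξ in (0 : ℝ)..p, clampedPerturbation ub u ξ 0 * ζ ξ)
    = ∫ τ in (0 : ℝ)..t,
        ((∫ ξ in (0 : ℝ)..p, (f (ub + clampedPerturbation ub u ξ τ) - f ub) * ζ₁ ξ)
          - s * (∫ ξ in (0 : ℝ)..p, clampedPerturbation ub u ξ τ * ζ₁ ξ)
          + γ * (∫ ξ in (0 : ℝ)..p, clampedPerturbation ub u ξ τ * ζ₂ ξ)
          + μ * (∫ ξ in (0 : ℝ)..p, clampedPerturbation ub u ξ τ * ζ₃ ξ)) := by
  have hd1 : deriv ζ = ζ₁ := funext fun x => (h1 x).deriv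
  have hd2 : deriv ζ₁ = ζ₂ := funext fun x => (h2 x).deriv
  have hd3 : deriv ζ₂ = ζ₃ := funext fun x => (h3 x).deriv
  have hi2 : iteratedDeriv 2 ζ = ζ₂ := by
    rw [iteratedDeriv_succ, iteratedDeriv_one, hd1, hd2]
  have hi3 : iteratedDeriv 3 ζ = ζ₃ := by rw [iteratedDeriv_succ, hi2, hd3]
  have hc0 : Continuous ζ := continuous_iff_continuousAt.2 fun x => (h1 x).continuousAt
  have hc1 : Continuous ζ₁ := continuous_iff_continuousAt.2 fun x => (h2 x).continuousAt
  have hc2 : Continuous ζ₂ := continuous_iff_continuousAt.2 fun x => (h3 x).continuousAt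
  have hp1 : Function.Periodic ζ₁ p := hd1 ▸ periodic_deriv hper
  have hp2 : Function.Periodic ζ₂ p := hd2 ▸ periodic_deriv hp1
  have hcd : ContDiff ℝ 3 ζ := by
    have e2 : ContDiff ℝ 1 ζ₂ := contDiff_one_iff_deriv.2 ⟨fun x => (h3 x).differentiableAt, hd3 ▸ hc3⟩
    have e1 : ContDiff ℝ (1 + 1) ζ₁ := contDiff_succ_iff_deriv.2
      ⟨fun x => (h2 x).differentiableAt, by simp, hd2 ▸ e2⟩
    have e0 : ContDiff ℝ (1 + 1 + 1) ζ := contDiff_succ_iff_deriv.2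
      ⟨fun x => (h1 x).differentiableAt, by simp, hd1 ▸ e1⟩
    have : (1 + 1 + 1 : WithTop ℕ∞) = 3 := by norm_num
    rwa [this] at e0
  have hweak := hu.weak ζ hcd hper t ht
  rw [hd1, hi2, hi3] at hweak
  have hvc := hu.continuous_clamped (ub := ub)
  set v := clampedPerturbation ub u with hv
  have hu0 : ∀ ξ, ub + w ξ = ub + v ξ 0 := by
    intro ξ
    rw [hv, clampedPerturbation_of_nonneg le_rfl, hu.initial]; ring
  have hut : ∀ τ, 0 ≤ τ → ∀ ξ, u ξ τ = ub + v ξ τ := by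
    intro τ hτ ξ
    rw [hv, clampedPerturbation_of_nonneg hτ]; ring
  have hII : ∀ (h : ℝ → ℝ), Continuous h → IntervalIntegrable h volume 0 p :=
    fun h hh => hh.intervalIntegrable _ _
  have hsplit : ∀ τ, ∫ ξ in (0 : ℝ)..p, (ub + v ξ τ) * ζ ξ
      = ub * (∫ ξ in (0 : ℝ)..p, ζ ξ) + ∫ ξ in (0 : ℝ)..p, v ξ τ * ζ ξ := by
    intro τ
    rw [← intervalIntegral.integral_const_mul, ← intervalIntegral.integral_add
      (hII (fun ξ => ub * ζ ξ) (by fun_prop))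
      (hII (fun ξ => v ξ τ * ζ ξ) ((continuous_slice hvc τ).mul hc0))]
    congr 1; funext ξ; ring
  simp_rw [hu0, hut t ht, hsplit] at hweak
  rw [add_sub_add_left_eq_sub] at hweak
  rw [hweak]
  apply intervalIntegral.integral_congr
  intro τ hτ
  rw [uIcc_of_le ht] at hτ
  have z1 := integral_deriv_periodic_eq_zero h1 hc1 hper
  have z2 := integral_deriv_periodic_eq_zero h2 hc2 hp1
  have z3 := integral_deriv_periodic_eq_zero h3 hc3 hp2
  have hvs := continuous_slice hvc τ
  simp only [hut τ hτ.1]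
  have e : ∀ ξ, (f (ub + v ξ τ) - s * (ub + v ξ τ)) * ζ₁ ξ + γ * ((ub + v ξ τ) * ζ₂ ξ)
      + μ * ((ub + v ξ τ) * ζ₃ ξ)
      = ((f (ub + v ξ τ) - f ub) * ζ₁ ξ - s * (v ξ τ * ζ₁ ξ) + γ * (v ξ τ * ζ₂ ξ)
        + μ * (v ξ τ * ζ₃ ξ)) + ((f ub - s * ub) * ζ₁ ξ + γ * ub * ζ₂ ξ + μ * ub * ζ₃ ξ) := by
    intro ξ; ring
  simp_rw [e]
  have i0 : IntervalIntegrable (fun ξ => (f (ub + v ξ τ) - f ub) * ζ₁ ξ) volume 0 p :=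
    hII _ (((hf.comp (continuous_const.add hvs)).sub continuous_const).mul hc1)
  have i1 : IntervalIntegrable (fun ξ => s * (v ξ τ * ζ₁ ξ)) volume 0 p :=
    hII _ (continuous_const.mul (hvs.mul hc1))
  have i2 : IntervalIntegrable (fun ξ => γ * (v ξ τ * ζ₂ ξ)) volume 0 p :=
    hII _ (continuous_const.mul (hvs.mul hc2))
  have i3 : IntervalIntegrable (fun ξ => μ * (v ξ τ * ζ₃ ξ)) volume 0 p :=
    hII _ (continuous_const.mul (hvs.mul hc3))
  have j1 : IntervalIntegrable (fun ξ => (f ub - s * ub) * ζ₁ ξ) volume 0 p := hII _ (by fun_prop)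
  have j2 : IntervalIntegrable (fun ξ => γ * ub * ζ₂ ξ) volume 0 p := hII _ (by fun_prop)
  have j3 : IntervalIntegrable (fun ξ => μ * ub * ζ₃ ξ) volume 0 p := hII _ (by fun_prop)
  rw [intervalIntegral.integral_add (((i0.sub i1).add i2).add i3) ((j1.add j2).add j3),
    intervalIntegral.integral_add ((i0.sub i1).add i2) i3,
    intervalIntegral.integral_add (i0.sub i1) i2, intervalIntegral.integral_sub i0 i1,
    intervalIntegral.integral_add (j1.add j2) j3, intervalIntegral.integral_add j1 j2]
  simp only [intervalIntegral.integral_const_mul, z1, z2, z3]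
  ring

/-- The test function `1` shows that the mean is conserved. Testing with `cos` and `sin` and
recombining amounts to testing with `exp(-iκx)`, whose derivatives are multiplication by powers of
`-iκ`, the mode symbol. -/
theorem IsPeriodicSolution.isModeSolution (hf : Continuous f) (hp : 0 < p)
    (hu : IsPeriodicSolution f μ γ s p (fun ξ => ub + w ξ) u)
    (hw : ∫ x in (0 : ℝ)..p, w x = 0) :
    IsModeSolution f μ γ s p ub (clampedPerturbation ub u) := by
  have hvc := hu.continuous_clamped (ub := ub)
  have hclamp : ∀ ξ t, clampedPerturbation ub u ξ t = clampedPerturbation ub u ξ (max t 0) := by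
    intro ξ t; simp [clampedPerturbation]
  have hinit : ∀ ξ, clampedPerturbation ub u ξ 0 = w ξ := by
    intro ξ; rw [clampedPerturbation_of_nonneg le_rfl, hu.initial]; ring
  refine ⟨hvc, ?_, ?_, ?_⟩
  · intro t x
    simp only [clampedPerturbation]
    have := hu.periodic _ (le_max_right t 0) x
    simp only at this
    rw [this]
  · intro t
    have h0 : ∀ x : ℝ, HasDerivAt (fun _ : ℝ => (0 : ℝ)) 0 x := fun x => hasDerivAt_const x 0
    have := hu.weak_clamped (ub := ub) hf (ζ := fun _ => 1) (ζ₁ := fun _ => 0) (ζ₂ := fun _ => 0) (ζ₃ := fun _ => 0)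
      (fun x => hasDerivAt_const x 1) h0 h0 continuous_const (fun x => rfl) (le_max_right t 0)
    simp only [mul_one, mul_zero, intervalIntegral.integral_zero, sub_zero, add_zero, hinit, hw]
      at this
    simp_rw [hclamp _ t]
    exact this
  · intro k t ht
    set v := clampedPerturbation ub u with hv
    set c := waveNumber p k with hc
    have hFc : Continuous fun q : ℝ × ℝ => f (ub + v q.1 q.2) - f ub :=
      (hf.comp (continuous_const.add hvc)).sub continuous_const
    have hcos := hu.weak_clamped (ub := ub) hf (ζ := fun x => Real.cos (c * x)) (ζ₁ := fun x => -(c * Real.sin (c * x)))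
      (ζ₂ := fun x => -(c * (c * Real.cos (c * x))))
      (ζ₃ := fun x => -(c * (c * -(c * Real.sin (c * x)))))
      (hasDerivAt_cos_mul c) (fun x => ((hasDerivAt_sin_mul c x).const_mul c).neg)
      (fun x => (((hasDerivAt_cos_mul c x).const_mul c).const_mul c).neg) (by fun_prop)
      (cos_waveNumber_periodic hp k) ht
    have hsin := hu.weak_clamped (ub := ub) hf (ζ := fun x => Real.sin (c * x)) (ζ₁ := fun x => c * Real.cos (c * x))
      (ζ₂ := fun x => c * -(c * Real.sin (c * x)))
      (ζ₃ := fun x => c * -(c * (c * Real.cos (c * x))))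
      (hasDerivAt_sin_mul c) (fun x => (hasDerivAt_cos_mul c x).const_mul c)
      (fun x => (((hasDerivAt_sin_mul c x).const_mul c).neg).const_mul c) (by fun_prop)
      (sin_waveNumber_periodic hp k) ht
    have pull : ∀ (h ζ : ℝ → ℝ) (a : ℝ), ∫ ξ in (0:ℝ)..p, h ξ * (a * ζ ξ)
        = a * ∫ ξ in (0:ℝ)..p, h ξ * ζ ξ := by
      intro h ζ a
      rw [← intervalIntegral.integral_const_mul]; congr 1; funext ξ; ring
    have pulln : ∀ (h ζ : ℝ → ℝ), ∫ ξ in (0:ℝ)..p, h ξ * -(ζ ξ)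
        = -∫ ξ in (0:ℝ)..p, h ξ * ζ ξ := by
      intro h ζ
      rw [← intervalIntegral.integral_neg]; congr 1; funext ξ; ring
    simp only [pull, pulln] at hcos hsin
    have hsl : ∀ τ, IntervalIntegrable (fun ξ => v ξ τ) volume 0 p := fun τ =>
      (continuous_slice hvc τ).intervalIntegrable _ _
    have hslF : ∀ τ, IntervalIntegrable (fun ξ => f (ub + v ξ τ) - f ub) volume 0 p := fun τ =>
      (continuous_slice (v := fun ξ τ => f (ub + v ξ τ) - f ub) hFc τ).intervalIntegrable _ _
    have hcc : Continuous fun x => Real.cos (c * x) := by fun_prop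
    have hsc : Continuous fun x => Real.sin (c * x) := by fun_prop
    simp_rw [modeCoeff_eq_cos_sub_sin (hsl _), modeCoeff_eq_cos_sub_sin (hslF _), modeSymbol, ← hc]
    have c1 := continuous_integral_slice hvc hcc 0 p
    have c2 := continuous_integral_slice hvc hsc 0 p
    have c3 := continuous_integral_slice (v := fun ξ τ => f (ub + v ξ τ) - f ub) hFc hcc 0 p
    have c4 := continuous_integral_slice (v := fun ξ τ => f (ub + v ξ τ) - f ub) hFc hsc 0 p
    set Ac := fun t => ∫ ξ in (0:ℝ)..p, v ξ t * Real.cos (c * ξ)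
    set As := fun t => ∫ ξ in (0:ℝ)..p, v ξ t * Real.sin (c * ξ)
    set Fc := fun t => ∫ ξ in (0:ℝ)..p, (f (ub + v ξ t) - f ub) * Real.cos (c * ξ)
    set Fs := fun t => ∫ ξ in (0:ℝ)..p, (f (ub + v ξ t) - f ub) * Real.sin (c * ξ)
    change Ac t - Ac 0 = ∫ τ in (0:ℝ)..t, (-(c * Fs τ) - s * -(c * As τ) + γ * -(c * (c * Ac τ))
      + μ * -(c * (c * -(c * As τ)))) at hcos
    change As t - As 0 = ∫ τ in (0:ℝ)..t, ((c * Fc τ) - s * (c * Ac τ) + γ * (c * -(c * As τ))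
      + μ * (c * -(c * (c * Ac τ)))) at hsin
    change (p : ℂ)⁻¹ * ((Ac t : ℂ) - (As t : ℂ) * Complex.I)
      - (p : ℂ)⁻¹ * ((Ac 0 : ℂ) - (As 0 : ℂ) * Complex.I)
      = ∫ τ in (0:ℝ)..t, (-(c * Complex.I) * ((p : ℂ)⁻¹ * ((Fc τ : ℂ) - (Fs τ : ℂ) * Complex.I))
        + (-s * -(c * Complex.I) + γ * (-(c * Complex.I)) ^ 2 + μ * (-(c * Complex.I)) ^ 3)
          * ((p : ℂ)⁻¹ * ((Ac τ : ℂ) - (As τ : ℂ) * Complex.I)))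
    have e : (p : ℂ)⁻¹ * ((Ac t : ℂ) - (As t : ℂ) * Complex.I)
      - (p : ℂ)⁻¹ * ((Ac 0 : ℂ) - (As 0 : ℂ) * Complex.I)
      = (p : ℂ)⁻¹ * (((Ac t - Ac 0 : ℝ) : ℂ) - ((As t - As 0 : ℝ) : ℂ) * Complex.I) := by
      push_cast; ring
    rw [e, hcos, hsin, ← intervalIntegral.integral_ofReal, ← intervalIntegral.integral_ofReal,
      ← intervalIntegral.integral_mul_const, ← intervalIntegral.integral_sub,
      ← intervalIntegral.integral_const_mul]
    · apply intervalIntegral.integral_congr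
      intro τ _
      have i3 : Complex.I ^ 3 = -Complex.I := by rw [pow_succ, Complex.I_sq]; ring
      have i4 : Complex.I ^ 4 = 1 := Complex.I_pow_four
      simp only
      push_cast
      ring_nf
      rw [Complex.I_sq, i3, i4]
      ring
    · apply Continuous.intervalIntegrable
      apply Complex.continuous_ofReal.comp
      fun_prop
    · apply Continuous.intervalIntegrable
      refine (Complex.continuous_ofReal.comp ?_).mul continuous_const
      fun_prop

end Clamp

/-! ### Exponential decay of small periodic perturbations -/

/-- Duhamel's formula for a scalar linear equation, as a norm bound. -/
theorem norm_le_of_integral_eq {c b : ℝ → ℂ} {l : ℂ} (hc : Continuous c) (hb : Continuous b)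
    (h : ∀ t, 0 ≤ t → c t - c 0 = ∫ τ in (0 : ℝ)..t, (l * c τ + b τ)) {t : ℝ} (ht : 0 ≤ t) :
    ‖c t‖ ≤ Real.exp (l.re * t) * ‖c 0‖
      + ∫ τ in (0 : ℝ)..t, Real.exp (l.re * (t - τ)) * ‖b τ‖ := by
  -- The integral equation holds only for `t ≥ 0`. `C` is differentiable everywhere and agrees with
  -- `c` on that half-line, which is enough for the variation of constants.
  set C : ℝ → ℂ := fun t => c 0 + ∫ τ in (0 : ℝ)..t, (l * c τ + b τ) with hC
  have hcont : Continuous fun τ => l * c τ + b τ := by fun_prop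
  have hCd : ∀ x, HasDerivAt C (l * c x + b x) x := by
    intro x
    exact (intervalIntegral.integral_hasDerivAt_right (hcont.intervalIntegrable _ _)
      (hcont.stronglyMeasurableAtFilter _ _) hcont.continuousAt).const_add _
  have hCc : ∀ x, 0 ≤ x → C x = c x := by
    intro x hx; simp only [hC]; rw [← h x hx]; ring
  have hexp : ∀ x : ℝ, HasDerivAt (fun x : ℝ => Complex.exp (l * (t - x : ℝ)))
      (Complex.exp (l * (t - x : ℝ)) * (-l)) x := by
    intro x
    have h1 : HasDerivAt (fun x : ℝ => ((t - x : ℝ) : ℂ)) (-1) x := by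
      have := ((hasDerivAt_id x).const_sub t).ofReal_comp
      simpa using this
    have := (h1.const_mul l).cexp
    exact this.congr_deriv (by ring)
  have hy : ∀ x ∈ uIcc 0 t, HasDerivAt (fun x : ℝ => Complex.exp (l * (t - x : ℝ)) * C x)
      (Complex.exp (l * (t - x : ℝ)) * b x) x := by
    intro x hx
    rw [uIcc_of_le ht] at hx
    refine ((hexp x).mul (hCd x)).congr_deriv ?_
    rw [hCc x hx.1]; ring
  have hbc : Continuous fun x : ℝ => Complex.exp (l * (t - x : ℝ)) * b x := by fun_prop
  have hF := intervalIntegral.integral_eq_sub_of_hasDerivAt hy (hbc.intervalIntegrable _ _)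
  simp only [sub_self, Complex.ofReal_zero, mul_zero, Complex.exp_zero, one_mul, sub_zero] at hF
  rw [hCc t ht, hCc 0 le_rfl] at hF
  have hct : c t = Complex.exp (l * (t : ℝ)) * c 0
      + ∫ x in (0 : ℝ)..t, Complex.exp (l * (t - x : ℝ)) * b x := by rw [hF]; ring
  have hn : ∀ x : ℝ, ‖Complex.exp (l * (x : ℝ))‖ = Real.exp (l.re * x) := by
    intro x
    rw [Complex.norm_exp]; simp
  rw [hct]
  refine (norm_add_le _ _).trans ?_
  rw [norm_mul, hn]
  gcongr
  refine (intervalIntegral.norm_integral_le_integral_norm ht).trans (le_of_eq ?_)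
  apply intervalIntegral.integral_congr
  intro x _
  simp only
  rw [norm_mul, hn]

theorem exists_quadratic_remainder {f : ℝ → ℝ} (hf : ContDiff ℝ 2 f) (ub : ℝ) :
    ∃ L, 0 ≤ L ∧ ∀ v, |v| ≤ 1 → |f (ub + v) - f ub - deriv f ub * v| ≤ L * v ^ 2 := by
  have hf1 : ContDiff ℝ 1 (deriv f) := by
    have : ContDiff ℝ (1 + 1) f := by
      have h2 : (1 + 1 : WithTop ℕ∞) = 2 := by norm_num
      rwa [h2]
    exact (contDiff_succ_iff_deriv.1 this).2.2
  have hfd : Differentiable ℝ f := hf.differentiable (by norm_num)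
  have hfd1 : Differentiable ℝ (deriv f) := hf1.differentiable (by norm_num)
  obtain ⟨L, hL⟩ := (isCompact_Icc (a := ub - 1) (b := ub + 1)).exists_bound_of_continuousOn
    (hf1.continuous_deriv (by norm_num)).continuousOn
  have hL0 : 0 ≤ L := (norm_nonneg _).trans (hL ub ⟨by linarith, by linarith⟩)
  refine ⟨L, hL0, fun v hv => ?_⟩
  obtain ⟨hv1, hv2⟩ := abs_le.1 hv
  have hsub : ∀ y, y ∈ Icc (ub - |v|) (ub + |v|) → y ∈ Icc (ub - 1) (ub + 1) := fun y hy =>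
    ⟨by linarith [hy.1], by linarith [hy.2]⟩
  have habs := abs_nonneg v
  have hub : ub ∈ Icc (ub - |v|) (ub + |v|) := ⟨by linarith, by linarith⟩
  have hubv : ub + v ∈ Icc (ub - |v|) (ub + |v|) :=
    ⟨by linarith [neg_abs_le v], by linarith [le_abs_self v]⟩
  have h1 : ∀ y ∈ Icc (ub - |v|) (ub + |v|), ‖deriv f y - deriv f ub‖ ≤ L * |v| := by
    intro y hy
    have := (convex_Icc (ub - 1) (ub + 1)).norm_image_sub_le_of_norm_deriv_le
      (fun x _ => hfd1 x) (fun x hx => hL x hx) (hsub _ hub) (hsub _ hy)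
    refine this.trans ?_
    gcongr
    rw [Real.norm_eq_abs, abs_le]
    exact ⟨by linarith [hy.1], by linarith [hy.2]⟩
  have hd : ∀ y, HasDerivAt (fun y => f y - deriv f ub * y) (deriv f y - deriv f ub) y := by
    intro y
    exact ((hfd y).hasDerivAt.sub ((hasDerivAt_id y).const_mul (deriv f ub))).congr_deriv (by ring)
  have := (convex_Icc (ub - |v|) (ub + |v|)).norm_image_sub_le_of_norm_hasDerivWithin_le
    (fun y _ => (hd y).hasDerivWithinAt) h1 hub hubv
  rw [Real.norm_eq_abs, Real.norm_eq_abs, add_sub_cancel_left, mul_assoc, abs_mul_abs_self,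
    ← sq] at this
  refine le_trans (le_of_eq ?_) this
  congr 1; ring

theorem rpow_le_exp {x a : ℝ} (hx : 0 ≤ x) (ha0 : 0 ≤ a) (ha : a ≤ 1) : x ^ a ≤ Real.exp x := by
  have h := Real.add_one_le_exp x
  rcases le_total x 1 with h1 | h1
  · exact (Real.rpow_le_one hx h1 ha0).trans (by linarith)
  · calc x ^ a ≤ x ^ (1 : ℝ) := Real.rpow_le_rpow_of_exponent_le h1 ha
      _ ≤ _ := by rw [Real.rpow_one]; linarith

/-- Smoothing bound for the multiplier of the derivative of the heat semigroup. -/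
theorem exists_heat_multiplier_bound {p γ : ℝ} (hp : 0 < p) (hγ : 0 < γ) :
    ∃ A, 0 < A ∧ ∀ (k : ℤ) (σ : ℝ), 0 < σ →
      |waveNumber p k| * Real.exp (-(γ * waveNumber p k ^ 2) * σ) ≤
        A * Real.exp (-(γ * (2 * Real.pi / p) ^ 2 / 2) * σ) * σ ^ (-(7 / 8) : ℝ)
          * |(k : ℝ)| ^ (-(3 / 4) : ℝ) := by
  set w := 2 * Real.pi / p with hw
  have hw0 : 0 < w := by positivity
  set B := γ / 2 * w ^ 2 with hB
  have hB0 : 0 < B := by positivity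
  refine ⟨w * B ^ (-(7 / 8) : ℝ), by positivity, fun k σ hσ => ?_⟩
  -- For `k = 0` the wave number vanishes, and so does the right side because the real power `0 ^
  -- (-3/4)` is `0`; the zero mode costs nothing.
  rcases eq_or_ne k 0 with rfl | hk
  · have : waveNumber p 0 = 0 := by simp [waveNumber]
    rw [this, abs_zero, zero_mul]; positivity
  have hk0 : 0 < |(k : ℝ)| := abs_pos.2 (by exact_mod_cast hk)
  have hwk : |waveNumber p k| = w * |(k : ℝ)| := by
    rw [waveNumber, mul_div_right_comm, abs_mul, abs_of_pos hw0]
  have hsq : γ / 2 * waveNumber p k ^ 2 = B * |(k : ℝ)| ^ 2 := by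
    rw [← sq_abs (waveNumber p k), hwk, hB]; ring
  -- Half of the heat exponent is kept for decay in time, the other half `e^{-y} ≤ y^{-7/8}` for
  -- smoothing. Any power strictly between `3/4` and `1` would do: below `1` the singularity in `σ`
  -- is integrable, above `3/4` the weight left in `k` is square summable.
  set y := B * |(k : ℝ)| ^ 2 * σ with hy
  have hy0 : 0 < y := by positivity
  have e1 : Real.exp (-y) ≤ y ^ (-(7 / 8) : ℝ) := by
    rw [Real.exp_neg, Real.rpow_neg hy0.le]
    exact inv_anti₀ (Real.rpow_pos_of_pos hy0 _) (rpow_le_exp hy0.le (by norm_num) (by norm_num))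
  have e2 : y ^ (-(7 / 8) : ℝ)
      = B ^ (-(7 / 8) : ℝ) * |(k : ℝ)| ^ (-(7 / 4) : ℝ) * σ ^ (-(7 / 8) : ℝ) := by
    rw [hy, Real.mul_rpow (by positivity) hσ.le, Real.mul_rpow hB0.le (by positivity),
      ← Real.rpow_natCast |(k : ℝ)| 2, ← Real.rpow_mul hk0.le]
    norm_num
  have e3 : |(k : ℝ)| * |(k : ℝ)| ^ (-(7 / 4) : ℝ) = |(k : ℝ)| ^ (-(3 / 4) : ℝ) := by
    nth_rewrite 1 [← Real.rpow_one |(k : ℝ)|]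
    rw [← Real.rpow_add hk0]; norm_num
  have e4 : Real.exp (-(γ * waveNumber p k ^ 2) * σ) ≤ Real.exp (-(γ * w ^ 2 / 2) * σ) * Real.exp (-y) := by
    rw [← Real.exp_add]
    apply Real.exp_le_exp.2
    have h1 : γ / 2 * w ^ 2 ≤ γ / 2 * waveNumber p k ^ 2 := by
      gcongr γ / 2 * ?_
      exact waveNumber_sq_ge hp hk
    have h2 := mul_le_mul_of_nonneg_right h1 hσ.le
    have h3 : y = γ / 2 * waveNumber p k ^ 2 * σ := by rw [hy, hsq]
    rw [h3]; linarith
  calc |waveNumber p k| * Real.exp (-(γ * waveNumber p k ^ 2) * σ)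
      ≤ (w * |(k : ℝ)|) * (Real.exp (-(γ * w ^ 2 / 2) * σ) *
          (B ^ (-(7 / 8) : ℝ) * |(k : ℝ)| ^ (-(7 / 4) : ℝ) * σ ^ (-(7 / 8) : ℝ))) := by
        rw [hwk]
        gcongr
        refine e4.trans ?_
        gcongr
        rw [← e2]; exact e1
    _ = w * B ^ (-(7 / 8) : ℝ) * Real.exp (-(γ * w ^ 2 / 2) * σ) * σ ^ (-(7 / 8) : ℝ)
          * (|(k : ℝ)| * |(k : ℝ)| ^ (-(7 / 4) : ℝ)) := by ring
    _ = _ := by rw [e3]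

/-- Cauchy-Schwarz: the weight lies in `ℓ²`, and the `ℓ²` norm of the coefficients is at most the
sup norm. This converts a uniform bound on the nonlinearity into an `ℓ¹` bound on its modes. -/
theorem exists_sum_weight_le {p : ℝ} (hp : 0 < p) : ∃ Z, 0 ≤ Z ∧ ∀ {v : ℝ → ℝ} {B : ℝ},
    Continuous v → (∀ x, |v x| ≤ B) → ∀ S : Finset ℤ,
      ∑ k ∈ S, |(k : ℝ)| ^ (-(3 / 4) : ℝ) * ‖modeCoeff p v k‖ ≤ Z * B := by
  have hs : Summable fun k : ℤ => |(k : ℝ)| ^ (-(3 / 2) : ℝ) :=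
    Real.summable_abs_int_rpow (by norm_num)
  refine ⟨Real.sqrt (∑' k : ℤ, |(k : ℝ)| ^ (-(3 / 2) : ℝ)), Real.sqrt_nonneg _, ?_⟩
  intro v B hv hB S
  have hB0 : 0 ≤ B := (abs_nonneg _).trans (hB 0)
  refine (Real.sum_mul_le_sqrt_mul_sqrt S _ _).trans ?_
  gcongr
  · have : ∀ k : ℤ, (|(k : ℝ)| ^ (-(3 / 4) : ℝ)) ^ 2 = |(k : ℝ)| ^ (-(3 / 2) : ℝ) := by
      intro k
      rw [← Real.rpow_natCast, ← Real.rpow_mul (abs_nonneg _)]; norm_num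
    simp_rw [this]
    exact hs.sum_le_tsum S (fun k _ => by positivity)
  · rw [Real.sqrt_le_left hB0]
    exact sum_sq_modeCoeff_le_of_bound hp hv hB S

theorem modeCoeff_add {p : ℝ} {v w : ℝ → ℝ} (hv : Continuous v) (hw : Continuous w) (k : ℤ) :
    modeCoeff p (fun x => v x + w x) k = modeCoeff p v k + modeCoeff p w k := by
  unfold modeCoeff
  rw [← mul_add, ← intervalIntegral.integral_add
    (Continuous.intervalIntegrable (by fun_prop) _ _)
    (Continuous.intervalIntegrable (by fun_prop) _ _)]
  congr 2; funext x; push_cast; ring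

theorem modeCoeff_const_mul {p : ℝ} (a : ℝ) (v : ℝ → ℝ) (k : ℤ) :
    modeCoeff p (fun x => a * v x) k = a * modeCoeff p v k := by
  unfold modeCoeff
  rw [mul_left_comm, ← intervalIntegral.integral_const_mul (a : ℂ)]
  congr 2; funext x; push_cast; ring

theorem modeCoeff_zero_index (p : ℝ) (v : ℝ → ℝ) :
    modeCoeff p v 0 = (p : ℂ)⁻¹ * ((∫ x in (0 : ℝ)..p, v x : ℝ) : ℂ) := by
  rw [modeCoeff, ← intervalIntegral.integral_ofReal]
  simp [waveNumber]

section Decay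

variable {f : ℝ → ℝ} {μ γ s p ub : ℝ} {v : ℝ → ℝ → ℝ}

theorem IsModeSolution.modeCoeff_zero (hv : IsModeSolution f μ γ s p ub v) (t : ℝ) :
    modeCoeff p (fun ξ => v ξ t) 0 = 0 := by
  rw [modeCoeff_zero_index, hv.mean_zero]; simp

theorem IsModeSolution.continuous_remainder (hf : Continuous f)
    (hv : IsModeSolution f μ γ s p ub v) (a : ℝ) :
    Continuous fun q : ℝ × ℝ => f (ub + v q.1 q.2) - f ub - a * v q.1 q.2 := by
  have := hv.continuous
  fun_prop

/-- A linear flux `a v` can be moved into the linear part for free: like the transport and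
dispersion terms it only rotates the mode, and the growth rate has real part `-γκ²` for every `a`.
With `a = f'(ub)` the source left in Duhamel's formula is quadratic. -/
theorem IsModeSolution.norm_modeCoeff_le (hf : Continuous f) (hv : IsModeSolution f μ γ s p ub v)
    (a : ℝ) (k : ℤ) {t : ℝ} (ht : 0 ≤ t) :
    ‖modeCoeff p (fun ξ => v ξ t) k‖ ≤ Real.exp (-(γ * waveNumber p k ^ 2) * t)
        * ‖modeCoeff p (fun ξ => v ξ 0) k‖
      + ∫ τ in (0 : ℝ)..t, Real.exp (-(γ * waveNumber p k ^ 2) * (t - τ)) *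
          (|waveNumber p k| *
            ‖modeCoeff p (fun ξ => f (ub + v ξ τ) - f ub - a * v ξ τ) k‖) := by
  set z := modeSymbol p k with hz
  set l : ℂ := z * a + (-s * z + γ * z ^ 2 + μ * z ^ 3) with hl
  have hre : l.re = -(γ * waveNumber p k ^ 2) := by
    have i3 : Complex.I ^ 3 = -Complex.I := by rw [pow_succ, Complex.I_sq]; ring
    have : l = ((-(γ * waveNumber p k ^ 2) : ℝ) : ℂ)
        + ((waveNumber p k * (s - a) + μ * waveNumber p k ^ 3 : ℝ) : ℂ) * Complex.I := by
      rw [hl, hz, modeSymbol]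
      push_cast
      ring_nf
      rw [Complex.I_sq, i3]; ring
    rw [this, Complex.add_re, Complex.ofReal_re, Complex.re_ofReal_mul, Complex.I_re]; ring
  have hRc := hv.continuous_remainder hf a
  have hb : Continuous fun τ => z * modeCoeff p (fun ξ => f (ub + v ξ τ) - f ub - a * v ξ τ) k :=
    continuous_const.mul (continuous_modeCoeff
      (v := fun ξ τ => f (ub + v ξ τ) - f ub - a * v ξ τ) hRc p k)
  have h := norm_le_of_integral_eq (c := fun t => modeCoeff p (fun ξ => v ξ t) k) (l := l)
    (continuous_modeCoeff hv.continuous p k) hb (by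
      intro t ht
      rw [hv.mode k t ht]
      apply intervalIntegral.integral_congr
      intro τ _
      simp only
      have : (fun ξ => f (ub + v ξ τ) - f ub)
          = fun ξ => a * v ξ τ + (f (ub + v ξ τ) - f ub - a * v ξ τ) := by funext ξ; ring
      have hvs := continuous_slice hv.continuous τ
      rw [this, modeCoeff_add (v := fun ξ => a * v ξ τ) (continuous_const.mul hvs)
        (continuous_slice (v := fun ξ τ => f (ub + v ξ τ) - f ub - a * v ξ τ) hRc τ),
        modeCoeff_const_mul, hl]
      ring) ht
  have hzn : ‖z‖ = |waveNumber p k| := by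
    rw [hz, modeSymbol, norm_neg, norm_mul, Complex.norm_I, mul_one, Complex.norm_real,
      Real.norm_eq_abs]
  simp only [norm_mul, hzn, hre] at h
  exact h

theorem integral_sub_rpow (t : ℝ) :
    IntervalIntegrable (fun τ => (t - τ) ^ (-(7 / 8) : ℝ)) volume 0 t ∧
      ∫ τ in (0 : ℝ)..t, (t - τ) ^ (-(7 / 8) : ℝ) = 8 * t ^ (1 / 8 : ℝ) := by
  constructor
  · have := (intervalIntegral.intervalIntegrable_rpow' (a := 0) (b := t)
      (r := (-(7 / 8) : ℝ)) (by norm_num)).comp_sub_left t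
    simpa using this.symm
  · rw [intervalIntegral.integral_comp_sub_left (fun x => x ^ (-(7 / 8) : ℝ)) t,
      sub_self, sub_zero, integral_rpow (Or.inl (by norm_num))]
    rw [Real.zero_rpow (by norm_num)]
    norm_num
    ring

/-- The decay estimate that drives the continuation argument. -/
theorem exists_sum_modeCoeff_le (hf : ContDiff ℝ 2 f) (μ s ub : ℝ) (hp : 0 < p) (hγ : 0 < γ) :
    ∃ C, 0 < C ∧ ∀ {v : ℝ → ℝ → ℝ}, IsModeSolution f μ γ s p ub v → ∀ {a K t : ℝ}, 0 ≤ K → K ≤ 1 →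
      0 ≤ t → (∀ S : Finset ℤ, ∑ k ∈ S, ‖modeCoeff p (fun ξ => v ξ 0) k‖ ≤ a) →
      (∀ τ ∈ Ico 0 t, ∀ ξ, |v ξ τ| ≤ K * Real.exp (-(γ * (2 * Real.pi / p) ^ 2 / 4) * τ)) →
      ∀ S : Finset ℤ, ∑ k ∈ S, ‖modeCoeff p (fun ξ => v ξ t) k‖
        ≤ (a + C * K ^ 2) * Real.exp (-(γ * (2 * Real.pi / p) ^ 2 / 4) * t) := by
  obtain ⟨L, hL0, hL⟩ := exists_quadratic_remainder hf ub
  obtain ⟨A, hA0, hA⟩ := exists_heat_multiplier_bound hp hγ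
  obtain ⟨Z, hZ0, hZ⟩ := exists_sum_weight_le hp
  set θ := γ * (2 * Real.pi / p) ^ 2 / 4 with hθ
  have hθ0 : 0 < θ := by positivity
  have hθ2 : γ * (2 * Real.pi / p) ^ 2 / 2 = 2 * θ := by rw [hθ]; ring
  rw [hθ2] at hA
  -- `8` comes from `∫₀ᵗ (t-τ)^{-7/8} dτ = 8 t^{1/8}`, and `1 + 1/θ` from absorbing `t^{1/8}` into
  -- half of the decay rate; the final `+ 1` only ensures positivity.
  refine ⟨8 * (1 + 1 / θ) * (A * Z * L) + 1, by positivity, ?_⟩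
  intro v hv a K t hK0 hK1 ht hinit hbound S
  have hfc : Continuous f := hf.continuous
  have hRc := hv.continuous_remainder hfc (deriv f ub)
  set R : ℝ → ℝ → ℝ := fun ξ τ => f (ub + v ξ τ) - f ub - deriv f ub * v ξ τ with hR
  set I : ℤ → ℝ → ℝ := fun k τ => Real.exp (-(γ * waveNumber p k ^ 2) * (t - τ)) *
          (|waveNumber p k| * ‖modeCoeff p (fun ξ => R ξ τ) k‖) with hI
  have hIc : ∀ k, Continuous (I k) := by
    intro k
    have := continuous_modeCoeff (v := R) hRc p k
    simp only [hI]
    fun_prop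
  -- The square of the assumed decay has the same rate `2θ` as the retained heat factor, so the
  -- product no longer depends on `τ`.
  have hexp1 : ∀ τ, Real.exp (-(2 * θ) * (t - τ)) * Real.exp (-θ * τ) ^ 2
      = Real.exp (-(2 * θ) * t) := by
    intro τ
    rw [← Real.exp_nat_mul, ← Real.exp_add]; congr 1; push_cast; ring
  have hpoint : ∀ τ ∈ Ioo 0 t, ∑ k ∈ S, I k τ
      ≤ (A * Z * L * K ^ 2 * Real.exp (-(2 * θ) * t)) * (t - τ) ^ (-(7 / 8) : ℝ) := by
    intro τ hτ
    have hσ : 0 < t - τ := by linarith [hτ.2]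
    have hb := hbound τ ⟨hτ.1.le, hτ.2⟩
    have he1 : Real.exp (-θ * τ) ≤ 1 := Real.exp_le_one_iff.2 (by nlinarith [hτ.1])
    have hRb : ∀ ξ, |R ξ τ| ≤ L * (K * Real.exp (-θ * τ)) ^ 2 := by
      intro ξ
      have h1 : |v ξ τ| ≤ 1 := (hb ξ).trans (by
        calc K * Real.exp (-θ * τ) ≤ 1 * 1 := by gcongr
          _ = 1 := by norm_num)
      refine (hL _ h1).trans ?_
      rw [← sq_abs (v ξ τ)]
      gcongr
      exact hb ξ
    have h2 := hZ (continuous_slice (v := R) hRc τ) hRb S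
    calc ∑ k ∈ S, I k τ
        ≤ ∑ k ∈ S, (A * Real.exp (-(2 * θ) * (t - τ)) * (t - τ) ^ (-(7 / 8) : ℝ)) *
            (|(k : ℝ)| ^ (-(3 / 4) : ℝ) * ‖modeCoeff p (fun ξ => R ξ τ) k‖) := by
          apply Finset.sum_le_sum
          intro k _
          have h3 := mul_le_mul_of_nonneg_right (hA k (t - τ) hσ)
            (norm_nonneg (modeCoeff p (fun ξ => R ξ τ) k))
          refine le_trans (le_of_eq ?_) (h3.trans (le_of_eq ?_))
          · simp only [hI]; ring
          · ring
      _ = (A * Real.exp (-(2 * θ) * (t - τ)) * (t - τ) ^ (-(7 / 8) : ℝ)) *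
            ∑ k ∈ S, |(k : ℝ)| ^ (-(3 / 4) : ℝ) * ‖modeCoeff p (fun ξ => R ξ τ) k‖ := by
          rw [Finset.mul_sum]
      _ ≤ (A * Real.exp (-(2 * θ) * (t - τ)) * (t - τ) ^ (-(7 / 8) : ℝ)) *
            (Z * (L * (K * Real.exp (-θ * τ)) ^ 2)) := by
          gcongr
      _ = (A * Z * L * K ^ 2 * (Real.exp (-(2 * θ) * (t - τ)) * Real.exp (-θ * τ) ^ 2))
            * (t - τ) ^ (-(7 / 8) : ℝ) := by ring
      _ = _ := by rw [hexp1]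
  have hint : ∑ k ∈ S, ∫ τ in (0 : ℝ)..t, I k τ
      ≤ (A * Z * L * K ^ 2 * Real.exp (-(2 * θ) * t)) * (8 * t ^ (1 / 8 : ℝ)) := by
    rw [← intervalIntegral.integral_finsetSum (fun k _ => (hIc k).intervalIntegrable _ _),
      ← (integral_sub_rpow t).2, ← intervalIntegral.integral_const_mul]
    apply intervalIntegral.integral_mono_on_of_le_Ioo ht
    · exact Continuous.intervalIntegrable (continuous_finsetSum _ fun k _ => hIc k) _ _
    · exact (integral_sub_rpow t).1.const_mul _
    · exact hpoint
  have htail : Real.exp (-(2 * θ) * t) * t ^ (1 / 8 : ℝ) ≤ (1 + 1 / θ) * Real.exp (-θ * t) := by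
    have h1 : Real.exp (-(2 * θ) * t) = Real.exp (-θ * t) * Real.exp (-(θ * t)) := by
      rw [← Real.exp_add]; congr 1; ring
    have h2 : t ^ (1 / 8 : ℝ) ≤ 1 + t := by
      rcases le_total t 1 with h | h
      · exact (Real.rpow_le_one ht h (by norm_num)).trans (by linarith)
      · calc t ^ (1 / 8 : ℝ) ≤ t ^ (1 : ℝ) :=
              Real.rpow_le_rpow_of_exponent_le h (by norm_num)
          _ ≤ _ := by rw [Real.rpow_one]; linarith
    have h3 : Real.exp (-(θ * t)) * (1 + t) ≤ 1 + 1 / θ := by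
      rw [Real.exp_neg, inv_mul_le_iff₀ (Real.exp_pos _)]
      have h4 := Real.add_one_le_exp (θ * t)
      have h5 : (θ * t + 1) * (1 + 1 / θ) ≤ Real.exp (θ * t) * (1 + 1 / θ) := by gcongr
      refine le_trans ?_ h5
      have h6 : (θ * t + 1) * (1 + 1 / θ) = θ * t + t + 1 + 1 / θ := by field_simp; ring
      rw [h6]
      have : 0 ≤ θ * t := by positivity
      have : 0 ≤ 1 / θ := by positivity
      linarith
    calc Real.exp (-(2 * θ) * t) * t ^ (1 / 8 : ℝ)
        ≤ Real.exp (-(2 * θ) * t) * (1 + t) := by gcongr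
      _ = (Real.exp (-(θ * t)) * (1 + t)) * Real.exp (-θ * t) := by rw [h1]; ring
      _ ≤ _ := by gcongr
  have hlin : ∑ k ∈ S, Real.exp (-(γ * waveNumber p k ^ 2) * t)
        * ‖modeCoeff p (fun ξ => v ξ 0) k‖ ≤ a * Real.exp (-θ * t) := by
    refine le_trans ?_ (mul_le_mul_of_nonneg_right (hinit S) (Real.exp_pos (-θ * t)).le)
    rw [Finset.sum_mul]
    apply Finset.sum_le_sum
    intro k _
    -- Only the zero mode is not damped by the semigroup, and it vanishes by the zero-mean
    -- condition.
    rcases eq_or_ne k 0 with rfl | hk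
    · simp [hv.modeCoeff_zero]
    · rw [mul_comm]
      gcongr
      have h1 : γ * (2 * Real.pi / p) ^ 2 ≤ γ * waveNumber p k ^ 2 := by
        gcongr γ * ?_
        exact waveNumber_sq_ge hp hk
      have : γ * (2 * Real.pi / p) ^ 2 = 4 * θ := by rw [hθ]; ring
      nlinarith
  calc ∑ k ∈ S, ‖modeCoeff p (fun ξ => v ξ t) k‖
      ≤ ∑ k ∈ S, (Real.exp (-(γ * waveNumber p k ^ 2) * t) * ‖modeCoeff p (fun ξ => v ξ 0) k‖
          + ∫ τ in (0 : ℝ)..t, I k τ) :=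
        Finset.sum_le_sum fun k _ => hv.norm_modeCoeff_le hfc (deriv f ub) k ht
    _ ≤ a * Real.exp (-θ * t)
        + (A * Z * L * K ^ 2 * Real.exp (-(2 * θ) * t)) * (8 * t ^ (1 / 8 : ℝ)) := by
        rw [Finset.sum_add_distrib]; gcongr
    _ = a * Real.exp (-θ * t)
        + 8 * (A * Z * L * K ^ 2) * (Real.exp (-(2 * θ) * t) * t ^ (1 / 8 : ℝ)) := by ring
    _ ≤ a * Real.exp (-θ * t)
        + 8 * (A * Z * L * K ^ 2) * ((1 + 1 / θ) * Real.exp (-θ * t)) := by gcongr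
    _ = (a + 8 * (1 + 1 / θ) * (A * Z * L) * K ^ 2) * Real.exp (-θ * t) := by ring
    _ ≤ _ := by
        gcongr
        linarith

end Decay

/-- Continuation argument: a bound that is strictly improved wherever it holds, holds always. -/
theorem abs_le_of_improvable {p K θ : ℝ} (hp : 0 < p) {v : ℝ → ℝ → ℝ}
    (hv : Continuous fun q : ℝ × ℝ => v q.1 q.2) (hper : ∀ t, Function.Periodic (fun ξ => v ξ t) p)
    (h : ∀ t, 0 ≤ t → (∀ τ ∈ Ico 0 t, ∀ ξ, |v ξ τ| ≤ K * Real.exp (-θ * τ)) →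
      ∀ ξ, |v ξ t| < K * Real.exp (-θ * t)) {t : ℝ} (ht : 0 ≤ t) (ξ : ℝ) :
    |v ξ t| ≤ K * Real.exp (-θ * t) := by
  by_contra! hcon
  obtain ⟨ξ', hξ', he⟩ := (hper t).exists_mem_Ico₀ hp ξ
  set bad : Set (ℝ × ℝ) := (Icc 0 p ×ˢ Icc 0 t) ∩ {q | K * Real.exp (-θ * q.2) ≤ |v q.1 q.2|}
    with hbad
  have hcomp : IsCompact bad :=
    (isCompact_Icc.prod isCompact_Icc).inter_right (isClosed_le (by fun_prop) hv.abs)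
  have hne : (Prod.snd '' bad).Nonempty :=
    ⟨t, (ξ', t), ⟨⟨⟨hξ'.1, hξ'.2.le⟩, ht, le_rfl⟩, by
      show K * Real.exp (-θ * t) ≤ |v ξ' t|
      rw [← he]; exact hcon.le⟩, rfl⟩
  -- Periodicity confines the failures of the strict bound to a compact set, so there is a first
  -- time of failure. The bound holds at all earlier times, and the hypothesis improves it to a
  -- strict one at that time.
  obtain ⟨t₀, ⟨⟨x, y⟩, ⟨⟨hx, hy⟩, hq⟩, rfl⟩, hmin⟩ := (hcomp.image continuous_snd).exists_isLeast hne
  simp only [mem_ofPred_eq] at hq hx hy hmin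
  refine absurd (h y hy.1 (fun τ hτ ζ => ?_) x) (not_lt.2 hq)
  by_contra! hc
  obtain ⟨ζ', hζ', he'⟩ := (hper τ).exists_mem_Ico₀ hp ζ
  have : y ≤ τ := hmin ⟨(ζ', τ), ⟨⟨⟨hζ'.1, hζ'.2.le⟩, hτ.1, hτ.2.le.trans hy.2⟩, by
      show K * Real.exp (-θ * τ) ≤ |v ζ' τ|
      rw [← he']; exact hc.le⟩, rfl⟩
  exact absurd hτ.2 (not_lt.2 this)

/-- Exponential decay of small periodic solutions. -/
theorem exists_decay {f : ℝ → ℝ} (hf : ContDiff ℝ 2 f) (μ s ub : ℝ) {γ p : ℝ} (hp : 0 < p)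
    (hγ : 0 < γ) : ∃ κ, 0 < κ ∧ ∀ {v : ℝ → ℝ → ℝ}, IsModeSolution f μ γ s p ub v →
      ∀ {a : ℝ}, a ≤ κ → (∀ S : Finset ℤ, ∑ k ∈ S, ‖modeCoeff p (fun ξ => v ξ 0) k‖ ≤ a) →
      ∀ t, 0 ≤ t → ∀ ξ, |v ξ t| ≤ 2 * a * Real.exp (-(γ * (2 * Real.pi / p) ^ 2 / 4) * t) := by
  obtain ⟨C, hC, hest⟩ := exists_sum_modeCoeff_le hf μ s ub hp hγ
  set θ := γ * (2 * Real.pi / p) ^ 2 / 4 with hθ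
  -- For `K ≤ κ₀` one has `C K² ≤ K/2`, hence `a + C K² < K` as soon as `2a < K`: this is the strict
  -- improvement required by the continuation argument.
  set κ₀ := min 1 (1 / (2 * C)) with hκ₀
  have hκ₀0 : 0 < κ₀ := by positivity
  refine ⟨κ₀ / 4, by positivity, ?_⟩
  intro v hv a ha hinit t ht ξ
  have ha0 : 0 ≤ a := by simpa using hinit ∅
  have key : ∀ K, 2 * a < K → K ≤ κ₀ → |v ξ t| ≤ K * Real.exp (-θ * t) := by
    intro K hK1 hK2
    have hK0 : 0 ≤ K := by linarith
    have hCK : C * K ≤ 1 / 2 := by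
      calc C * K ≤ C * (1 / (2 * C)) := by gcongr; exact hK2.trans (min_le_right _ _)
        _ = 1 / 2 := by field_simp
    refine abs_le_of_improvable hp hv.continuous hv.periodic (fun t ht hb ξ => ?_) ht ξ
    have h1 := abs_le_of_sum_modeCoeff_le hp (continuous_slice hv.continuous t) (hv.periodic t)
      (hest hv hK0 (hK2.trans (min_le_left _ _)) ht hinit hb) ξ
    refine h1.trans_lt (mul_lt_mul_of_pos_right ?_ (Real.exp_pos _))
    nlinarith
  -- The improvement needs `K > 2a` strictly; the constant `2a` itself is reached by letting `K`
  -- decrease to it, which also covers `a = 0`.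
  apply le_of_forall_pos_le_add
  intro ε hε
  have h1 := key (min (2 * a + ε) κ₀) (lt_min (by linarith) (by linarith)) (min_le_right _ _)
  have he : Real.exp (-θ * t) ≤ 1 := Real.exp_le_one_iff.2 (by
    have : 0 ≤ θ * t := by positivity
    linarith)
  calc |v ξ t| ≤ min (2 * a + ε) κ₀ * Real.exp (-θ * t) := h1
    _ ≤ (2 * a + ε) * Real.exp (-θ * t) := by gcongr; exact min_le_left _ _
    _ = 2 * a * Real.exp (-θ * t) + ε * Real.exp (-θ * t) := by ring
    _ ≤ 2 * a * Real.exp (-θ * t) + ε := by gcongr; exact mul_le_of_le_one_right hε.le he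

theorem h1Norm_nonneg (p : ℝ) (w : ℝ → ℝ) : 0 ≤ h1Norm p w := Real.sqrt_nonneg _

/-- The Fourier coefficients of a periodic `H¹` function are absolutely summable. -/
theorem exists_sum_modeCoeff_le_h1Norm {p : ℝ} (hp : 0 < p) : ∃ C, 0 < C ∧ ∀ {w : ℝ → ℝ},
    IsPerturbation p w → ∀ S : Finset ℤ, ∑ k ∈ S, ‖modeCoeff p w k‖ ≤ C * h1Norm p w := by
  have hs : Summable fun k : ℤ => |(k : ℝ)| ^ (-2 : ℝ) := Real.summable_abs_int_rpow (by norm_num)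
  set Z := ∑' k : ℤ, |(k : ℝ)| ^ (-2 : ℝ) with hZ
  set ω := 2 * Real.pi / p with hω
  have hω0 : 0 < ω := by positivity
  refine ⟨Real.sqrt Z * Real.sqrt p⁻¹ / ω + 1, by positivity, ?_⟩
  intro w hw S
  have hwp : w p = w 0 := by simpa using hw.h1.periodic 0
  have hw0 : ∫ x in (0 : ℝ)..p, w x = 0 := by
    have := hw.mean_zero
    rcases mul_eq_zero.1 this with h | h
    · exact absurd h (by positivity)
    · exact h
  have h0 : modeCoeff p w 0 = 0 := by rw [modeCoeff_zero_index, hw0]; simp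
  -- One factor `1/|k|` is gained from the derivative, and it is square summable against the `ℓ²`
  -- coefficients of `w'`. The mode `k = 0` is absent because `w` has zero mean.
  have hk : ∀ k : ℤ, ‖modeCoeff p w k‖ ≤ ω⁻¹ * (|(k : ℝ)|⁻¹ * ‖modeCoeff p (deriv w) k‖) := by
    intro k
    rcases eq_or_ne k 0 with rfl | hk
    · rw [h0]; simp
    rw [modeCoeff_deriv hp hw.h1.absCont hwp, norm_mul, norm_mul, Complex.norm_I, mul_one,
      Complex.norm_real, Real.norm_eq_abs]
    have hk0 : 0 < |(k : ℝ)| := abs_pos.2 (by exact_mod_cast hk)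
    have hwk : |waveNumber p k| = ω * |(k : ℝ)| := by
      rw [waveNumber, mul_div_right_comm, abs_mul, abs_of_pos hω0]
    rw [hwk]
    apply le_of_eq
    field_simp
  have hd : ∫ x in (0 : ℝ)..p, deriv w x ^ 2 ≤ h1Norm p w ^ 2 := by
    rw [h1Norm, Real.sq_sqrt]
    · have : 0 ≤ ∫ x in (0 : ℝ)..p, w x ^ 2 :=
        intervalIntegral.integral_nonneg hp.le fun x _ => sq_nonneg _
      linarith
    · exact add_nonneg (intervalIntegral.integral_nonneg hp.le fun x _ => sq_nonneg _)
        (intervalIntegral.integral_nonneg hp.le fun x _ => sq_nonneg _)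
  have hcs : ∑ k ∈ S, |(k : ℝ)|⁻¹ * ‖modeCoeff p (deriv w) k‖
      ≤ Real.sqrt Z * (Real.sqrt p⁻¹ * h1Norm p w) := by
    refine (Real.sum_mul_le_sqrt_mul_sqrt S _ _).trans ?_
    gcongr
    · have : ∀ k : ℤ, (|(k : ℝ)|⁻¹) ^ 2 = |(k : ℝ)| ^ (-2 : ℝ) := by
        intro k
        rw [Real.rpow_neg (abs_nonneg _), inv_pow]; norm_cast
      simp_rw [this]
      exact hs.sum_le_tsum S (fun k _ => by positivity)
    · rw [← Real.sqrt_sq (h1Norm_nonneg p w), ← Real.sqrt_mul (by positivity)]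
      apply Real.sqrt_le_sqrt
      refine (sum_sq_modeCoeff_le hp hw.h1.deriv_memLp S).trans ?_
      gcongr
  have hn := h1Norm_nonneg p w
  calc ∑ k ∈ S, ‖modeCoeff p w k‖
      ≤ ∑ k ∈ S, ω⁻¹ * (|(k : ℝ)|⁻¹ * ‖modeCoeff p (deriv w) k‖) := Finset.sum_le_sum fun k _ => hk k
    _ = ω⁻¹ * ∑ k ∈ S, |(k : ℝ)|⁻¹ * ‖modeCoeff p (deriv w) k‖ := by rw [Finset.mul_sum]
    _ ≤ ω⁻¹ * (Real.sqrt Z * (Real.sqrt p⁻¹ * h1Norm p w)) := by gcongr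
    _ = (Real.sqrt Z * Real.sqrt p⁻¹ / ω) * h1Norm p w := by ring
    _ ≤ _ := by gcongr; linarith

/-- Solutions with small periodic initial perturbations decay exponentially. -/
theorem exists_periodic_decay {f : ℝ → ℝ} (hf : ContDiff ℝ 2 f) (μ s ub : ℝ) {γ p : ℝ}
    (hp : 0 < p) (hγ : 0 < γ) : ∃ δ₀ C θ : ℝ, 0 < δ₀ ∧ 0 < C ∧ 0 < θ ∧
      ∀ (w : ℝ → ℝ) (u : ℝ → ℝ → ℝ), IsPerturbation p w → h1Norm p w < δ₀ →
        IsPeriodicSolution f μ γ s p (fun ξ => ub + w ξ) u →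
        IsModeSolution f μ γ s p ub (clampedPerturbation ub u) ∧
        ∀ t, 0 ≤ t → ∀ ξ,
          |clampedPerturbation ub u ξ t| ≤ C * h1Norm p w * Real.exp (-θ * t) := by
  obtain ⟨κ, hκ, hdec⟩ := exists_decay hf μ s ub hp hγ
  obtain ⟨C, hC, hsum⟩ := exists_sum_modeCoeff_le_h1Norm hp
  refine ⟨κ / C, 2 * C, γ * (2 * Real.pi / p) ^ 2 / 4, by positivity, by positivity,
    by positivity, ?_⟩
  intro w u hw hδ hu
  have hw0 : ∫ x in (0 : ℝ)..p, w x = 0 := by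
    rcases mul_eq_zero.1 hw.mean_zero with h | h
    · exact absurd h (by positivity)
    · exact h
  have hm := hu.isModeSolution hf.continuous hp hw0
  refine ⟨hm, fun t ht ξ => ?_⟩
  have hinit : (fun ξ => clampedPerturbation ub u ξ 0) = w := by
    funext ξ; rw [clampedPerturbation_of_nonneg le_rfl, hu.initial]; ring
  have h1 : C * h1Norm p w ≤ κ := by rw [lt_div_iff₀ hC] at hδ; linarith
  have := hdec hm h1 (by rw [hinit]; exact hsum hw) t ht ξ
  rw [mul_assoc 2]
  exact this

/-! ### Correlation of a periodic function with an integrable kernel -/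

/-- The correlation `e ↦ ∫ u(y + e) h(y) dy = ∫ u(ξ) h(ξ - e) dξ`. -/
def correlate (h u : ℝ → ℝ) (e : ℝ) : ℝ := ∫ y, u (y + e) * h y

theorem integral_mul_comp_sub (u h : ℝ → ℝ) (e : ℝ) :
    ∫ ξ, u ξ * h (ξ - e) = correlate h u e := by
  rw [correlate, ← integral_add_right_eq_self (fun ξ => u ξ * h (ξ - e)) e]
  simp

theorem integrable_mul_comp_sub {u h : ℝ → ℝ} (hu : Continuous u) {B : ℝ} (hB : ∀ x, |u x| ≤ B)
    (hh : Integrable h) (e : ℝ) : Integrable fun ξ => u ξ * h (ξ - e) :=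
  (hh.comp_sub_right e).bdd_mul hu.aestronglyMeasurable (ae_of_all _ hB)

theorem integrable_correlate {u h : ℝ → ℝ} (hu : Continuous u) {B : ℝ} (hB : ∀ x, |u x| ≤ B)
    (hh : Integrable h) (e : ℝ) : Integrable fun y => u (y + e) * h y :=
  hh.bdd_mul (hu.comp (continuous_add_const e)).aestronglyMeasurable (ae_of_all _ fun _ => hB _)

theorem abs_correlate_le {u h : ℝ → ℝ} {B : ℝ} (hB : ∀ x, |u x| ≤ B)
    (hh : Integrable h) (e : ℝ) : |correlate h u e| ≤ B * ∫ y, |h y| := by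
  rw [correlate, ← integral_const_mul]
  refine norm_integral_le_of_norm_le (G := ℝ) (f := fun y => u (y + e) * h y)
    (hh.abs.const_mul B) (ae_of_all _ fun y => ?_)
  rw [Real.norm_eq_abs, abs_mul]
  gcongr
  exact hB _

theorem correlate_add {u v h : ℝ → ℝ} (hu : Continuous u) {B : ℝ} (hB : ∀ x, |u x| ≤ B)
    (hv : Continuous v) {B' : ℝ} (hB' : ∀ x, |v x| ≤ B') (hh : Integrable h) (e : ℝ) :
    correlate h (fun x => u x + v x) e = correlate h u e + correlate h v e := by
  rw [correlate, correlate, correlate, ← integral_add (integrable_correlate hu hB hh e)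
    (integrable_correlate hv hB' hh e)]
  congr 1; funext y; ring

theorem correlate_sub {u v h : ℝ → ℝ} (hu : Continuous u) {B : ℝ} (hB : ∀ x, |u x| ≤ B)
    (hv : Continuous v) {B' : ℝ} (hB' : ∀ x, |v x| ≤ B') (hh : Integrable h) (e : ℝ) :
    correlate h (fun x => u x - v x) e = correlate h u e - correlate h v e := by
  rw [correlate, correlate, correlate, ← integral_sub (integrable_correlate hu hB hh e)
    (integrable_correlate hv hB' hh e)]
  congr 1; funext y; ring

theorem correlate_const (h : ℝ → ℝ) (c e : ℝ) : correlate h (fun _ => c) e = c * ∫ y, h y := by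
  rw [correlate, integral_const_mul]

theorem continuous_correlate {u : ℝ → ℝ → ℝ} {h : ℝ → ℝ}
    (hu : Continuous fun q : ℝ × ℝ => u q.1 q.2) {B : ℝ} (hB : ∀ x t, |u x t| ≤ B)
    (hh : Integrable h) : Continuous fun q : ℝ × ℝ => correlate h (fun x => u x q.2) q.1 := by
  unfold correlate
  refine continuous_of_dominated (bound := fun y => B * |h y|) (fun q => ?_) (fun q => ?_)
    (hh.abs.const_mul B) (ae_of_all _ fun y => ?_)
  · exact (integrable_correlate (continuous_slice hu q.2) (fun x => hB x q.2) hh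
      q.1).aestronglyMeasurable
  · refine ae_of_all _ fun y => ?_
    rw [Real.norm_eq_abs, abs_mul]
    gcongr
    exact hB _ _
  · have : Continuous fun q : ℝ × ℝ => (y + q.1, q.2) := by fun_prop
    exact (hu.comp this).mul continuous_const

/-- After the translation the parameter sits in the periodic factor, so the derivative falls on `u`
and the kernel need only be integrable. -/
theorem hasDerivAt_correlate {u u' h : ℝ → ℝ} (hd : ∀ x, HasDerivAt u (u' x) x)
    (hc : Continuous u') {B B' : ℝ} (hB : ∀ x, |u x| ≤ B) (hB' : ∀ x, |u' x| ≤ B')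
    (hh : Integrable h) (e : ℝ) : HasDerivAt (correlate h u) (correlate h u' e) e := by
  have huc : Continuous u := continuous_iff_continuousAt.2 fun x => (hd x).continuousAt
  refine (hasDerivAt_integral_of_dominated_loc_of_deriv_le (F := fun e y => u (y + e) * h y)
    (F' := fun e y => u' (y + e) * h y) (bound := fun y => B' * |h y|) (s := univ) univ_mem
    (Eventually.of_forall fun e => (integrable_correlate huc hB hh e).aestronglyMeasurable)
    (integrable_correlate huc hB hh e) (integrable_correlate hc hB' hh e).aestronglyMeasurable
    (ae_of_all _ fun y e _ => ?_) (hh.abs.const_mul B') (ae_of_all _ fun y e _ => ?_)).2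
  · rw [Real.norm_eq_abs, abs_mul]
    gcongr
    exact hB' _
  · have := (hd (y + e)).comp_const_add y e
    exact this.mul_const _

theorem correlate_periodic {u h : ℝ → ℝ} {p : ℝ} (hu : Function.Periodic u p) :
    Function.Periodic (correlate h u) p := by
  intro e
  unfold correlate
  congr 1; funext y
  rw [← add_assoc, hu]

/-- The value at `waveNumber p k` of the Fourier transform of `h`, with a positive phase. -/
def kernelCoeff (p : ℝ) (h : ℝ → ℝ) (k : ℤ) : ℂ :=
  ∫ y : ℝ, Complex.exp (((waveNumber p k * y : ℝ) : ℂ) * Complex.I) * (h y : ℂ)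

/-- The convolution theorem. Fubini applies since `u` is bounded and `h` integrable, and translating
a periodic function by `y` multiplies its coefficient by the phase `exp(iκy)`, whence the positive
phase in `kernelCoeff`. -/
theorem modeCoeff_correlate {u h : ℝ → ℝ} {p : ℝ} (hp : 0 < p) (hu : Continuous u)
    (hper : Function.Periodic u p) {B : ℝ} (hB : ∀ x, |u x| ≤ B) (hh : Integrable h) (k : ℤ) :
    modeCoeff p (correlate h u) k = modeCoeff p u k * kernelCoeff p h k := by
  set c := waveNumber p k with hc
  set E : ℝ → ℂ := fun x => Complex.exp (-((c * x : ℝ) : ℂ) * Complex.I) with hE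
  have hEc : Continuous E := by fun_prop
  have hEn : ∀ x, ‖E x‖ = 1 := by
    intro x
    have : -((c * x : ℝ) : ℂ) * Complex.I = ((-(c * x) : ℝ) : ℂ) * Complex.I := by push_cast; ring
    simp only [hE, this]
    exact Complex.norm_exp_ofReal_mul_I _
  have hEper : Function.Periodic E p := by
    intro x
    simp only [hE]
    have : -((c * (x + p) : ℝ) : ℂ) * Complex.I
        = -((c * x : ℝ) : ℂ) * Complex.I - k * (2 * Real.pi * Complex.I) := by
      have h1 : c * (x + p) = c * x + k * (2 * Real.pi) := by
        rw [hc, waveNumber]; field_simp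
      rw [h1]; push_cast; ring
    rw [this, Complex.exp_sub, Complex.exp_int_mul_two_pi_mul_I, div_one]
  have hinner : ∀ y, ∫ e in (0 : ℝ)..p, E e * (u (y + e) : ℂ)
      = Complex.exp (((c * y : ℝ) : ℂ) * Complex.I) * ∫ e in (0 : ℝ)..p, E e * (u e : ℂ) := by
    intro y
    have h1 : ∀ e, E e * (u (y + e) : ℂ) = Complex.exp (((c * y : ℝ) : ℂ) * Complex.I) *
        (E (y + e) * (u (y + e) : ℂ)) := by
      intro e
      rw [← mul_assoc]
      congr 1
      simp only [hE]
      rw [← Complex.exp_add]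
      congr 1
      push_cast; ring
    simp_rw [h1]
    rw [intervalIntegral.integral_const_mul,
      intervalIntegral.integral_comp_add_left (fun x => E x * (u x : ℂ))]
    congr 1
    have hP : Function.Periodic (fun x => E x * (u x : ℂ)) p := fun x => by
      simp only [hEper x, hper x]
    have := hP.intervalIntegral_add_eq y 0
    simpa using this
  have hswap : ∫ e in (0 : ℝ)..p, ∫ y, E e * ((u (y + e) : ℂ) * (h y : ℂ))
      = ∫ y, ∫ e in (0 : ℝ)..p, E e * ((u (y + e) : ℂ) * (h y : ℂ)) := by
    apply intervalIntegral_integral_swap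
    have hfin : IsFiniteMeasure ((volume : Measure ℝ).restrict (uIoc 0 p)) := by
      rw [uIoc_of_le hp.le]; infer_instance
    have h1 : Integrable (fun q : ℝ × ℝ => (h q.2 : ℂ))
        ((volume.restrict (uIoc 0 p)).prod volume) := Integrable.comp_snd (f := fun y => (h y : ℂ)) hh.ofReal _
    have h2 : Continuous fun q : ℝ × ℝ => E q.1 * (u (q.2 + q.1) : ℂ) := by fun_prop
    have h3 := h1.bdd_mul (c := B) h2.aestronglyMeasurable (ae_of_all _ fun q => by
      rw [norm_mul, hEn, one_mul, Complex.norm_real]; exact hB _)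
    refine h3.congr (ae_of_all _ fun q => ?_)
    simp only [Function.uncurry]; ring
  have hleft : ∀ e, E e * ((correlate h u e : ℝ) : ℂ) = ∫ y, E e * ((u (y + e) : ℂ) * (h y : ℂ)) := by
    intro e
    rw [integral_const_mul, correlate, ← integral_complex_ofReal]
    push_cast
    rfl
  rw [modeCoeff, kernelCoeff, modeCoeff]
  change (p : ℂ)⁻¹ * ∫ x in (0 : ℝ)..p, E x * ((correlate h u x : ℝ) : ℂ) = _
  simp_rw [hleft]
  rw [hswap]
  have hright : ∀ y, ∫ e in (0 : ℝ)..p, E e * ((u (y + e) : ℂ) * (h y : ℂ))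
      = (∫ e in (0 : ℝ)..p, E e * (u e : ℂ)) *
        (Complex.exp (((c * y : ℝ) : ℂ) * Complex.I) * (h y : ℂ)) := by
    intro y
    simp_rw [← mul_assoc]
    rw [intervalIntegral.integral_mul_const, hinner]; ring
  simp_rw [hright]
  rw [integral_const_mul, mul_assoc]

/-- Integration by parts on the line, without boundary terms because the functions involved are
integrable. The factor is the same symbol as in the mode equations, which is what lets the numerator
of the shift equation be matched with them. -/
theorem kernelCoeff_deriv {h h' : ℝ → ℝ} (hd : ∀ x, HasDerivAt h (h' x) x) (hh : Integrable h)
    (hh' : Integrable h') (p : ℝ) (k : ℤ) :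
    kernelCoeff p h' k = modeSymbol p k * kernelCoeff p h k := by
  set c := waveNumber p k with hc
  have hEd : ∀ x : ℝ, HasDerivAt (fun x : ℝ => Complex.exp (((c * x : ℝ) : ℂ) * Complex.I))
      (c * Complex.I * Complex.exp (((c * x : ℝ) : ℂ) * Complex.I)) x := by
    intro x
    have h1 : HasDerivAt (fun x : ℝ => ((c * x : ℝ) : ℂ)) (c : ℂ) x := by
      have := ((hasDerivAt_id x).const_mul c).ofReal_comp
      simpa using this
    exact ((h1.mul_const Complex.I).cexp).congr_deriv (by ring)
  have hEc : Continuous (fun x : ℝ => Complex.exp (((c * x : ℝ) : ℂ) * Complex.I)) := by fun_prop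
  have hEn : ∀ x : ℝ, ‖Complex.exp (((c * x : ℝ) : ℂ) * Complex.I)‖ ≤ 1 := fun x =>
    (Complex.norm_exp_ofReal_mul_I _).le
  have i1 : Integrable fun x : ℝ => Complex.exp (((c * x : ℝ) : ℂ) * Complex.I) * (h' x : ℂ) :=
    hh'.ofReal.bdd_mul hEc.aestronglyMeasurable (ae_of_all _ hEn)
  have i2 : Integrable fun x : ℝ => Complex.exp (((c * x : ℝ) : ℂ) * Complex.I) * (h x : ℂ) :=
    hh.ofReal.bdd_mul hEc.aestronglyMeasurable (ae_of_all _ hEn)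
  have h1 := integral_mul_deriv_eq_deriv_mul_of_integrable (fun x _ => hEd x)
    (v := fun x => (h x : ℂ)) (fun x _ => (hd x).ofReal_comp) i1 (by
      have := i2.const_mul (c * Complex.I)
      refine this.congr (ae_of_all _ fun x => ?_)
      simp only [Pi.mul_apply]; ring) i2
  rw [kernelCoeff, kernelCoeff, modeSymbol, h1, neg_mul, ← hc]
  congr 1
  rw [← integral_const_mul]
  congr 1; funext x; ring

theorem kernelCoeff_zero_index (p : ℝ) (h : ℝ → ℝ) : kernelCoeff p h 0 = ((∫ y, h y : ℝ) : ℂ) := by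
  rw [kernelCoeff, ← integral_complex_ofReal]
  simp [waveNumber]

theorem modeCoeff_integral {G : ℝ → ℝ → ℝ} (hG : Continuous fun q : ℝ × ℝ => G q.1 q.2) (p t : ℝ)
    (k : ℤ) : modeCoeff p (fun e => ∫ τ in (0 : ℝ)..t, G e τ) k
      = ∫ τ in (0 : ℝ)..t, modeCoeff p (fun e => G e τ) k := by
  unfold modeCoeff
  rw [intervalIntegral.integral_const_mul]
  congr 1
  rw [intervalIntegral_intervalIntegral_swap]
  · congr 1; funext e
    rw [intervalIntegral.integral_const_mul, intervalIntegral.integral_ofReal]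
  · have : Continuous (Function.uncurry fun (τ e : ℝ) =>
        Complex.exp (-((waveNumber p k * e : ℝ) : ℂ) * Complex.I) * (G e τ : ℂ)) := by
      have h1 := Complex.continuous_ofReal.comp (hG.comp continuous_swap)
      have h2 : Continuous fun q : ℝ × ℝ =>
        Complex.exp (-((waveNumber p k * q.2 : ℝ) : ℂ) * Complex.I) := by fun_prop
      exact h2.mul h1
    exact (this.continuousOn.integrableOn_compact (isCompact_uIcc.prod isCompact_uIcc)).mono_set
      (prod_mono uIoc_subset_uIcc uIoc_subset_uIcc)

/-! ### The potential of the shift equation -/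

/-- The zero-mean periodic primitive of `v`. -/
def meanZeroPrimitive (p : ℝ) (v : ℝ → ℝ) (ξ : ℝ) : ℝ :=
  (∫ y in (0 : ℝ)..ξ, v y) - meanPrimitive p v

section Primitive

variable {p : ℝ} {v : ℝ → ℝ}

theorem hasDerivAt_meanZeroPrimitive (hv : Continuous v) (ξ : ℝ) :
    HasDerivAt (meanZeroPrimitive p v) (v ξ) ξ :=
  (intervalIntegral.integral_hasDerivAt_right (hv.intervalIntegrable _ _)
    (hv.stronglyMeasurableAtFilter _ _) hv.continuousAt).sub_const _

theorem meanZeroPrimitive_periodic (hv : Continuous v) (hper : Function.Periodic v p)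
    (h0 : ∫ x in (0 : ℝ)..p, v x = 0) : Function.Periodic (meanZeroPrimitive p v) p := by
  intro x
  have h1 := hper.intervalIntegral_add_eq x 0
  rw [zero_add, h0] at h1
  rw [meanZeroPrimitive, meanZeroPrimitive, ← intervalIntegral.integral_add_adjacent_intervals
    (hv.intervalIntegrable 0 x) (hv.intervalIntegrable x (x + p)), h1, add_zero]

theorem integral_meanZeroPrimitive (hp : 0 < p) (hv : Continuous v) :
    ∫ x in (0 : ℝ)..p, meanZeroPrimitive p v x = 0 := by
  have hc : Continuous fun x => ∫ y in (0 : ℝ)..x, v y :=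
    intervalIntegral.continuous_primitive (fun a b => hv.intervalIntegrable a b) 0
  unfold meanZeroPrimitive
  rw [intervalIntegral.integral_sub (hc.intervalIntegrable _ _) (by simp),
    intervalIntegral.integral_const, meanPrimitive, smul_eq_mul, sub_zero]
  field_simp
  ring

theorem abs_meanZeroPrimitive_le (hp : 0 < p) (hv : Continuous v) (hper : Function.Periodic v p)
    (h0 : ∫ x in (0 : ℝ)..p, v x = 0) {B : ℝ} (hB : ∀ x, |v x| ≤ B) (ξ : ℝ) :
    |meanZeroPrimitive p v ξ| ≤ 2 * p * B := by
  have hB0 : 0 ≤ B := (abs_nonneg _).trans (hB 0)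
  have hI : ∀ x ∈ Icc 0 p, |∫ y in (0 : ℝ)..x, v y| ≤ p * B := by
    intro x hx
    have := intervalIntegral.norm_integral_le_of_norm_le_const (a := 0) (b := x) (f := v) (C := B)
      (fun y _ => hB y)
    rw [sub_zero, abs_of_nonneg hx.1] at this
    refine this.trans ?_
    rw [mul_comm]; gcongr; exact hx.2
  have hm : |meanPrimitive p v| ≤ p * B := by
    have := intervalIntegral.norm_integral_le_of_norm_le_const (a := 0) (b := p)
      (f := fun x => ∫ y in (0 : ℝ)..x, v y) (C := p * B) (fun x hx => by
        rw [uIoc_of_le hp.le] at hx; exact hI x ⟨hx.1.le, hx.2⟩)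
    rw [sub_zero, abs_of_pos hp, Real.norm_eq_abs] at this
    rw [meanPrimitive, abs_mul, abs_of_pos (by positivity : 0 < 1 / p), one_div, inv_mul_le_iff₀ hp]
    linarith
  obtain ⟨ξ', hξ', he⟩ := (meanZeroPrimitive_periodic hv hper h0).exists_mem_Ico₀ hp ξ
  rw [he, meanZeroPrimitive]
  have := abs_sub (∫ y in (0 : ℝ)..ξ', v y) (meanPrimitive p v)
  have := hI ξ' ⟨hξ'.1, hξ'.2.le⟩
  linarith

theorem modeCoeff_meanZeroPrimitive (hp : 0 < p) (hv : Continuous v) (hper : Function.Periodic v p)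
    (h0 : ∫ x in (0 : ℝ)..p, v x = 0) {B : ℝ} (hB : ∀ x, |v x| ≤ B) (k : ℤ) :
    modeCoeff p v k = -modeSymbol p k * modeCoeff p (meanZeroPrimitive p v) k := by
  have hd := hasDerivAt_meanZeroPrimitive (p := p) hv
  have hw : deriv (meanZeroPrimitive p v) = v := funext fun x => (hd x).deriv
  have hpp : meanZeroPrimitive p v p = meanZeroPrimitive p v 0 := by
    simpa using meanZeroPrimitive_periodic hv hper h0 0
  have := modeCoeff_deriv hp (absolutelyContinuousOnInterval_of_deriv_bound hd hB) hpp k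
  rw [hw] at this
  rw [this, modeSymbol]; ring

end Primitive

theorem continuous_meanZeroPrimitive {v : ℝ → ℝ → ℝ} (hv : Continuous fun q : ℝ × ℝ => v q.1 q.2)
    (p : ℝ) : Continuous fun q : ℝ × ℝ => meanZeroPrimitive p (fun ξ => v ξ q.2) q.1 := by
  have h1 : Continuous fun q : ℝ × ℝ => ∫ y in (0 : ℝ)..q.2, v y q.1 :=
    intervalIntegral.continuous_parametric_primitive_of_continuous
      (f := fun t y => v y t) (hv.comp continuous_swap)
  unfold meanZeroPrimitive meanPrimitive
  refine (h1.comp continuous_swap).sub (continuous_const.mul ?_)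
  have h2 : Continuous fun t : ℝ => ∫ x in (0 : ℝ)..p, ∫ y in (0 : ℝ)..x, v y t :=
    intervalIntegral.continuous_parametric_intervalIntegral_of_continuous' (f := fun t x =>
      ∫ y in (0 : ℝ)..x, v y t) h1 0 p
  exact h2.comp continuous_snd

/-- A kernel of the shift equation: the derivatives `h₁, h₂, h₃` of a decreasing front. -/
structure IsFrontKernel (h₁ h₂ h₃ : ℝ → ℝ) : Prop where
  int₁ : Integrable h₁
  int₂ : Integrable h₂
  int₃ : Integrable h₃
  deriv₁ : ∀ x, HasDerivAt h₁ (h₂ x) x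
  deriv₂ : ∀ x, HasDerivAt h₂ (h₃ x) x
  integral₁ : ∫ x, h₁ x = -1

/-- The flux perturbation. -/
def fluxPerturbation (f : ℝ → ℝ) (ub : ℝ) (v : ℝ → ℝ → ℝ) (ξ t : ℝ) : ℝ := f (ub + v ξ t) - f ub

/-- The average of the flux perturbation over a period. -/
def meanFluxPerturbation (f : ℝ → ℝ) (p ub : ℝ) (v : ℝ → ℝ → ℝ) (t : ℝ) : ℝ :=
  (1 / p) * ∫ ξ in (0 : ℝ)..p, fluxPerturbation f ub v ξ t

/-- The contribution of one periodic solution to the numerator of the shift equation. -/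
def shiftNumerator (f : ℝ → ℝ) (μ γ s ub : ℝ) (h₁ h₂ h₃ : ℝ → ℝ) (v : ℝ → ℝ → ℝ) (e t : ℝ) : ℝ :=
  γ * correlate h₂ (fun ξ => v ξ t) e + μ * correlate h₃ (fun ξ => v ξ t) e
    + correlate h₁ (fun ξ => fluxPerturbation f ub v ξ t) e - s * correlate h₁ (fun ξ => v ξ t) e

/-- The potential of the shift equation associated with one periodic solution. -/
def shiftPotential (f : ℝ → ℝ) (p ub : ℝ) (h₁ : ℝ → ℝ) (v : ℝ → ℝ → ℝ) (e t : ℝ) : ℝ :=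
  (∫ τ in (0 : ℝ)..t, meanFluxPerturbation f p ub v τ)
    + correlate h₁ (meanZeroPrimitive p fun ξ => v ξ t) e

section Potential

variable {f : ℝ → ℝ} {μ γ s p ub : ℝ} {v : ℝ → ℝ → ℝ} {h₁ h₂ h₃ : ℝ → ℝ}

theorem continuous_fluxPerturbation (hf : Continuous f)
    (hv : Continuous fun q : ℝ × ℝ => v q.1 q.2) :
    Continuous fun q : ℝ × ℝ => fluxPerturbation f ub v q.1 q.2 :=
  (hf.comp (continuous_const.add hv)).sub continuous_const

theorem exists_abs_fluxPerturbation_le (hf : ContDiff ℝ 2 f) (ub : ℝ) : ∃ M, 0 < M ∧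
    ∀ (v : ℝ → ℝ → ℝ) (ξ t : ℝ), |v ξ t| ≤ 1 → |fluxPerturbation f ub v ξ t| ≤ M * |v ξ t| := by
  obtain ⟨L, hL0, hL⟩ := exists_quadratic_remainder hf ub
  refine ⟨L + |deriv f ub| + 1, by positivity, fun v ξ t h => ?_⟩
  have h1 := hL _ h
  have h2 : L * v ξ t ^ 2 ≤ L * |v ξ t| := by
    rw [← sq_abs]; gcongr; nlinarith [abs_nonneg (v ξ t)]
  have h3 : fluxPerturbation f ub v ξ t
      = (f (ub + v ξ t) - f ub - deriv f ub * v ξ t) + deriv f ub * v ξ t := by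
    rw [fluxPerturbation]; ring
  rw [h3]
  refine (abs_add_le _ _).trans ?_
  rw [abs_mul]
  nlinarith [abs_nonneg (v ξ t)]

theorem continuous_meanFluxPerturbation (hf : Continuous f)
    (hv : Continuous fun q : ℝ × ℝ => v q.1 q.2) :
    Continuous (meanFluxPerturbation f p ub v) := by
  have := continuous_integral_slice (v := fluxPerturbation f ub v)
    (continuous_fluxPerturbation hf hv) (continuous_const (y := (1 : ℝ))) 0 p
  simp only [mul_one] at this
  exact continuous_const.mul this

theorem continuous_shiftNumerator (hf : Continuous f) (hv : Continuous fun q : ℝ × ℝ => v q.1 q.2)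
    (hk : IsFrontKernel h₁ h₂ h₃) {B B' : ℝ} (hB : ∀ ξ t, |v ξ t| ≤ B)
    (hB' : ∀ ξ t, |fluxPerturbation f ub v ξ t| ≤ B') :
    Continuous fun q : ℝ × ℝ => shiftNumerator f μ γ s ub h₁ h₂ h₃ v q.1 q.2 := by
  have c1 := continuous_correlate hv hB hk.int₁
  have c2 := continuous_correlate hv hB hk.int₂
  have c3 := continuous_correlate hv hB hk.int₃
  have c4 := continuous_correlate (continuous_fluxPerturbation hf hv) hB' hk.int₁
  exact (((continuous_const.mul c2).add (continuous_const.mul c3)).add c4).sub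
    (continuous_const.mul c1)

theorem IsModeSolution.hasDerivAt_shiftPotential (hp : 0 < p)
    (hv : IsModeSolution f μ γ s p ub v) (hh : Integrable h₁) {B : ℝ} (hB : ∀ ξ t, |v ξ t| ≤ B)
    (e t : ℝ) : HasDerivAt (fun e => shiftPotential f p ub h₁ v e t)
      (correlate h₁ (fun ξ => v ξ t) e) e := by
  have hvs := continuous_slice hv.continuous t
  exact (hasDerivAt_correlate (hasDerivAt_meanZeroPrimitive hvs) hvs
    (abs_meanZeroPrimitive_le hp hvs (hv.periodic t) (hv.mean_zero t) fun x => hB x t)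
    (fun x => hB x t) hh e).const_add _

theorem IsModeSolution.modeCoeff_shiftNumerator (hf : Continuous f) (hp : 0 < p)
    (hv : IsModeSolution f μ γ s p ub v) (hk : IsFrontKernel h₁ h₂ h₃) {B B' : ℝ}
    (hB : ∀ ξ t, |v ξ t| ≤ B) (hB' : ∀ ξ t, |fluxPerturbation f ub v ξ t| ≤ B') (k : ℤ) (t : ℝ) :
    modeCoeff p (fun e => shiftNumerator f μ γ s ub h₁ h₂ h₃ v e t) k =
      kernelCoeff p h₁ k * (modeCoeff p (fun ξ => fluxPerturbation f ub v ξ t) k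
        + (γ * modeSymbol p k + μ * modeSymbol p k ^ 2 - s) * modeCoeff p (fun ξ => v ξ t) k) := by
  have hvs := continuous_slice hv.continuous t
  have hFs := continuous_slice (v := fluxPerturbation f ub v)
    (continuous_fluxPerturbation hf hv.continuous) t
  have hFper : Function.Periodic (fun ξ => fluxPerturbation f ub v ξ t) p := by
    intro x
    have := hv.periodic t x
    simp only at this
    simp only [fluxPerturbation, this]
  have hct : ∀ {h : ℝ → ℝ} {u : ℝ → ℝ} {A : ℝ}, Continuous u → (∀ x, |u x| ≤ A) → Integrable h →
      Continuous (correlate h u) := by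
    intro h u A hu hA hh
    have := continuous_correlate (u := fun x _ => u x) (hu.comp continuous_fst) (fun x _ => hA x) hh
    exact this.comp (Continuous.prodMk_left 0)
  have c1 := hct hvs (fun x => hB x t) hk.int₁
  have c2 := hct hvs (fun x => hB x t) hk.int₂
  have c3 := hct hvs (fun x => hB x t) hk.int₃
  have c4 := hct hFs (fun x => hB' x t) hk.int₁
  have hform : (fun e => shiftNumerator f μ γ s ub h₁ h₂ h₃ v e t) = fun e =>
      ((γ * correlate h₂ (fun ξ => v ξ t) e + μ * correlate h₃ (fun ξ => v ξ t) e)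
      + correlate h₁ (fun ξ => fluxPerturbation f ub v ξ t) e)
      + (-s) * correlate h₁ (fun ξ => v ξ t) e := by
    funext e; rw [shiftNumerator]; ring
  rw [hform, modeCoeff_add (by fun_prop) (by fun_prop), modeCoeff_add (by fun_prop) (by fun_prop),
    modeCoeff_add (by fun_prop) (by fun_prop), modeCoeff_const_mul, modeCoeff_const_mul,
    modeCoeff_const_mul, modeCoeff_correlate hp hvs (hv.periodic t) (fun x => hB x t) hk.int₁,
    modeCoeff_correlate hp hvs (hv.periodic t) (fun x => hB x t) hk.int₂,
    modeCoeff_correlate hp hvs (hv.periodic t) (fun x => hB x t) hk.int₃,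
    modeCoeff_correlate hp hFs hFper (fun x => hB' x t) hk.int₁,
    kernelCoeff_deriv hk.deriv₂ hk.int₂ hk.int₃, kernelCoeff_deriv hk.deriv₁ hk.int₁ hk.int₂]
  push_cast
  ring

theorem modeCoeff_const {p : ℝ} (hp : 0 < p) (c : ℝ) {k : ℤ} (hk : k ≠ 0) :
    modeCoeff p (fun _ => c) k = 0 := by
  have h1 := modeCoeff_deriv hp (w := fun _ => c)
    (absolutelyContinuousOnInterval_of_deriv_bound (fun x => hasDerivAt_const x c) (K := 0)
      (by simp)) rfl k
  have h2 : modeCoeff p (deriv fun _ : ℝ => c) k = 0 := by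
    simp [modeCoeff]
  rw [h2] at h1
  have h3 : (waveNumber p k : ℂ) ≠ 0 := by exact_mod_cast waveNumber_ne_zero hp hk
  rcases mul_eq_zero.1 h1.symm with h | h
  · exact absurd h (mul_ne_zero h3 Complex.I_ne_zero)
  · exact h

/-- Formally `∂ₜV = m - (F - s v) + γ v_ξ - μ v_ξξ`, with `F` the flux perturbation and `m` its
mean, so that `V` keeps zero mean. Correlating with `h₁` and moving the derivatives onto the kernel
gives `-m` minus the numerator, and `m` is compensated by the first term of the potential. As `v`
need not be differentiable, the time-integrated identity is verified on Fourier coefficients in `e`.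
-/
theorem IsModeSolution.shiftPotential_eq_add_integral (hf : Continuous f) (hp : 0 < p)
    (hv : IsModeSolution f μ γ s p ub v) (hk : IsFrontKernel h₁ h₂ h₃) {B B' : ℝ}
    (hB : ∀ ξ t, |v ξ t| ≤ B) (hB' : ∀ ξ t, |fluxPerturbation f ub v ξ t| ≤ B') (e : ℝ) {t : ℝ}
    (ht : 0 ≤ t) : shiftPotential f p ub h₁ v e t = shiftPotential f p ub h₁ v e 0
      - ∫ τ in (0 : ℝ)..t, shiftNumerator f μ γ s ub h₁ h₂ h₃ v e τ := by
  set V : ℝ → ℝ → ℝ := fun ξ t => meanZeroPrimitive p (fun ξ => v ξ t) ξ with hV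
  have hVc : Continuous fun q : ℝ × ℝ => V q.1 q.2 := continuous_meanZeroPrimitive hv.continuous p
  have hVB : ∀ ξ t, |V ξ t| ≤ 2 * p * B := fun ξ t => abs_meanZeroPrimitive_le hp
    (continuous_slice hv.continuous t) (hv.periodic t) (hv.mean_zero t) (fun x => hB x t) ξ
  have hVper : ∀ t, Function.Periodic (fun ξ => V ξ t) p := fun t => meanZeroPrimitive_periodic
    (continuous_slice hv.continuous t) (hv.periodic t) (hv.mean_zero t)
  have hNc := continuous_shiftNumerator (μ := μ) (γ := γ) (s := s) hf hv.continuous hk hB hB'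
  have hmc : Continuous (meanFluxPerturbation f p ub v) :=
    continuous_meanFluxPerturbation hf hv.continuous
  have hXc := continuous_correlate hVc hVB hk.int₁
  set G : ℝ → ℝ → ℝ := fun e τ => meanFluxPerturbation f p ub v τ
    + shiftNumerator f μ γ s ub h₁ h₂ h₃ v e τ with hG
  have hGc : Continuous fun q : ℝ × ℝ => G q.1 q.2 := (hmc.comp continuous_snd).add hNc
  have hGi : Continuous fun e => ∫ τ in (0 : ℝ)..t, G e τ :=
    intervalIntegral.continuous_parametric_intervalIntegral_of_continuous' hGc 0 t
  -- `Θ` is the defect of the claimed identity. It is continuous and periodic in `e`, so it vanishes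
  -- once all its Fourier coefficients do.
  set Θ : ℝ → ℝ := fun e => (correlate h₁ (fun ξ => V ξ t) e
    + (-1) * correlate h₁ (fun ξ => V ξ 0) e) + ∫ τ in (0 : ℝ)..t, G e τ with hΘ
  have hXs : ∀ t, Continuous (correlate h₁ (fun ξ => V ξ t)) := fun t =>
    hXc.comp (Continuous.prodMk_left t)
  have hΘc : Continuous Θ := (((hXs t).add (continuous_const.mul (hXs 0))).add hGi)
  have hΘper : Function.Periodic Θ p := by
    intro x
    have h1 : ∀ τ, G (x + p) τ = G x τ := by
      intro τ
      have hFper : Function.Periodic (fun ξ => fluxPerturbation f ub v ξ τ) p := by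
        intro y
        have := hv.periodic τ y
        simp only at this
        simp only [fluxPerturbation, this]
      simp only [hG, shiftNumerator, correlate_periodic (hv.periodic τ) x,
        correlate_periodic hFper x]
    simp only [hΘ, h1, correlate_periodic (hVper t) x, correlate_periodic (hVper 0) x]
  have hcoeff : ∀ k, modeCoeff p Θ k = 0 := by
    intro k
    have hGk : ∀ τ, modeCoeff p (fun e => G e τ) k
        = modeCoeff p (fun _ => meanFluxPerturbation f p ub v τ) k
          + modeCoeff p (fun e => shiftNumerator f μ γ s ub h₁ h₂ h₃ v e τ) k := fun τ =>
      modeCoeff_add continuous_const (continuous_slice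
        (v := fun e τ => shiftNumerator f μ γ s ub h₁ h₂ h₃ v e τ) hNc τ) k
    simp only [hΘ]
    have hX0 : Continuous fun e => (-1) * correlate h₁ (fun ξ => V ξ 0) e :=
      continuous_const.mul (hXs 0)
    have hXt : Continuous fun e => correlate h₁ (fun ξ => V ξ t) e
        + (-1) * correlate h₁ (fun ξ => V ξ 0) e := (hXs t).add hX0
    rw [modeCoeff_add hXt hGi, modeCoeff_add (hXs t) hX0, modeCoeff_const_mul,
      modeCoeff_integral hGc,
      modeCoeff_correlate hp (continuous_slice hVc t) (hVper t) (fun x => hVB x t) hk.int₁,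
      modeCoeff_correlate hp (continuous_slice hVc 0) (hVper 0) (fun x => hVB x 0) hk.int₁]
    simp_rw [hGk, hv.modeCoeff_shiftNumerator hf hp hk hB hB']
    -- In the zero mode `V` and `v` contribute nothing, and the kernel coefficient is `∫ h₁ = -1`,
    -- so the two flux averages cancel. For the other modes `v` is the derivative of `V`, and the
    -- mode equation can be divided by the nonzero symbol.
    rcases eq_or_ne k 0 with rfl | hk0
    · have hV0 : ∀ t, modeCoeff p (fun ξ => V ξ t) 0 = 0 := by
        intro t
        rw [modeCoeff_zero_index]
        simp only [hV]
        rw [integral_meanZeroPrimitive hp (continuous_slice hv.continuous t)]; simp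
      rw [hV0, hV0]
      have hz : ∀ τ, modeCoeff p (fun _ => meanFluxPerturbation f p ub v τ) 0
          + kernelCoeff p h₁ 0 * (modeCoeff p (fun ξ => fluxPerturbation f ub v ξ τ) 0
            + (γ * modeSymbol p 0 + μ * modeSymbol p 0 ^ 2 - s)
              * modeCoeff p (fun ξ => v ξ τ) 0) = 0 := by
        intro τ
        have hpc : (p : ℂ) ≠ 0 := by exact_mod_cast hp.ne'
        rw [hv.modeCoeff_zero, kernelCoeff_zero_index, hk.integral₁, modeCoeff_zero_index,
          modeCoeff_zero_index, intervalIntegral.integral_const, meanFluxPerturbation, smul_eq_mul,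
          sub_zero]
        push_cast
        field_simp
        ring
      simp only [hz, intervalIntegral.integral_zero]
      ring
    · have hzk : modeSymbol p k ≠ 0 := by
        rw [modeSymbol, neg_ne_zero]
        exact mul_ne_zero (by exact_mod_cast waveNumber_ne_zero hp hk0) Complex.I_ne_zero
      have hprim : ∀ t, modeCoeff p (fun ξ => v ξ t) k
          = -modeSymbol p k * modeCoeff p (fun ξ => V ξ t) k := fun t =>
        modeCoeff_meanZeroPrimitive hp (continuous_slice hv.continuous t) (hv.periodic t)
          (hv.mean_zero t) (fun x => hB x t) k
      have hmode := hv.mode k t ht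
      rw [hprim t, hprim 0] at hmode
      have hint : ∫ τ in (0 : ℝ)..t, (modeCoeff p (fun _ => meanFluxPerturbation f p ub v τ) k
          + kernelCoeff p h₁ k * (modeCoeff p (fun ξ => fluxPerturbation f ub v ξ τ) k
            + (γ * modeSymbol p k + μ * modeSymbol p k ^ 2 - s)
              * modeCoeff p (fun ξ => v ξ τ) k))
          = (kernelCoeff p h₁ k * (modeSymbol p k)⁻¹) *
            ∫ τ in (0 : ℝ)..t, (modeSymbol p k * modeCoeff p (fun ξ => f (ub + v ξ τ) - f ub) k
              + (-s * modeSymbol p k + γ * modeSymbol p k ^ 2 + μ * modeSymbol p k ^ 3)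
                * modeCoeff p (fun ξ => v ξ τ) k) := by
        rw [← intervalIntegral.integral_const_mul]
        congr 1; funext τ
        rw [modeCoeff_const hp _ hk0]
        simp only [fluxPerturbation]
        field_simp
        ring
      rw [hint, ← hmode]
      push_cast
      field_simp
      ring
  have hz := eq_zero_of_modeCoeff_eq_zero hp hΘc hΘper hcoeff e
  simp only [hΘ, hG] at hz
  have hNe : Continuous fun τ => shiftNumerator f μ γ s ub h₁ h₂ h₃ v e τ :=
    hNc.comp (Continuous.prodMk_right e)
  rw [intervalIntegral.integral_add (hmc.intervalIntegrable _ _)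
    (hNe.intervalIntegrable _ _)] at hz
  simp only [shiftPotential, intervalIntegral.integral_same, zero_add]
  change _ + correlate h₁ (fun ξ => V ξ t) e = correlate h₁ (fun ξ => V ξ 0) e - _
  linarith

end Potential

/-! ### Level curves of a function with slope bounded below -/

section LevelSets

variable {H P R : ℝ → ℝ → ℝ} {c : ℝ}

/-- Hadamard's form of the increment: the averaged slope is jointly continuous and bounded below by
`c`. It takes the place of the implicit function theorem, since `H` is not assumed jointly
differentiable. -/
theorem sub_eq_mul_integral_of_hasDerivAt (hPc : Continuous fun q : ℝ × ℝ => P q.1 q.2)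
    (hP : ∀ e t, HasDerivAt (fun e => H e t) (P e t) e) (e e' t : ℝ) :
    H e' t - H e t = (e' - e) * ∫ σ in (0 : ℝ)..1, P (e + σ * (e' - e)) t := by
  have hd : ∀ σ ∈ uIcc (0 : ℝ) 1, HasDerivAt (fun σ => H (e + σ * (e' - e)) t)
      ((e' - e) * P (e + σ * (e' - e)) t) σ := by
    intro σ _
    have h1 : HasDerivAt (fun σ : ℝ => e + σ * (e' - e)) (e' - e) σ := by
      have := ((hasDerivAt_id σ).mul_const (e' - e)).const_add e
      simpa using this
    exact ((hP (e + σ * (e' - e)) t).comp σ h1).congr_deriv (mul_comm _ _)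
  have hc : Continuous fun σ : ℝ => (e' - e) * P (e + σ * (e' - e)) t := by
    have : Continuous fun σ : ℝ => (e + σ * (e' - e), t) := by fun_prop
    exact continuous_const.mul (hPc.comp this)
  have := intervalIntegral.integral_eq_sub_of_hasDerivAt hd (hc.intervalIntegrable _ _)
  rw [intervalIntegral.integral_const_mul] at this
  rw [this]; simp

theorem mean_value_ge (hPc : Continuous fun q : ℝ × ℝ => P q.1 q.2) (hlow : ∀ e t, c ≤ P e t)
    (e e' t : ℝ) : c ≤ ∫ σ in (0 : ℝ)..1, P (e + σ * (e' - e)) t := by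
  have hc : Continuous fun σ : ℝ => P (e + σ * (e' - e)) t := by
    have : Continuous fun σ : ℝ => (e + σ * (e' - e), t) := by fun_prop
    exact hPc.comp this
  have := intervalIntegral.integral_mono_on (a := 0) (b := 1) (f := fun _ => c) zero_le_one (μ := volume)
    intervalIntegrable_const (hc.intervalIntegrable _ _) (fun σ _ => hlow (e + σ * (e' - e)) t)
  simpa using this

theorem continuous_mean_value (hPc : Continuous fun q : ℝ × ℝ => P q.1 q.2) (e : ℝ) :
    Continuous fun q : ℝ × ℝ => ∫ σ in (0 : ℝ)..1, P (e + σ * (q.1 - e)) q.2 := by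
  apply intervalIntegral.continuous_parametric_intervalIntegral_of_continuous'
  have : Continuous fun r : (ℝ × ℝ) × ℝ => (e + r.2 * (r.1.1 - e), r.1.2) := by fun_prop
  exact hPc.comp this

/-- A slope at least `c > 0` forces strict monotonicity and at least linear growth in both
directions, hence a bijection of the line. -/
theorem existsUnique_eq_of_hasDerivAt (hPc : Continuous fun q : ℝ × ℝ => P q.1 q.2)
    (hP : ∀ e t, HasDerivAt (fun e => H e t) (P e t) e) (hc : 0 < c) (hlow : ∀ e t, c ≤ P e t)
    (t y : ℝ) : ∃! e, H e t = y := by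
  have hcont : Continuous fun e => H e t :=
    continuous_iff_continuousAt.2 fun e => (hP e t).continuousAt
  have hge : ∀ e e', e ≤ e' → H e t + c * (e' - e) ≤ H e' t := by
    intro e e' h
    have h1 := sub_eq_mul_integral_of_hasDerivAt hPc hP e e' t
    have h2 := mul_le_mul_of_nonneg_left (mean_value_ge hPc hlow e e' t) (sub_nonneg.2 h)
    linarith
  have hsurj : Function.Surjective fun e => H e t := by
    apply hcont.surjective
    · have h1 : Tendsto (fun e : ℝ => H 0 t + c * e) atTop atTop :=
        tendsto_atTop_add_const_left _ _ (tendsto_id.const_mul_atTop hc)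
      refine tendsto_atTop_mono' _ ?_ h1
      filter_upwards [eventually_ge_atTop 0] with e he
      have := hge 0 e he
      rwa [sub_zero] at this
    · have h1 : Tendsto (fun e : ℝ => H 0 t + c * e) atBot atBot :=
        tendsto_atBot_add_const_left _ _ (tendsto_id.const_mul_atBot hc)
      refine tendsto_atBot_mono' _ ?_ h1
      filter_upwards [eventually_le_atBot 0] with e he
      have := hge e 0 he
      linarith
  have hmono : StrictMono fun e => H e t := fun e e' h => by
    have := hge e e' h.le
    have : 0 < c * (e' - e) := mul_pos hc (sub_pos.2 h)
    simp only; linarith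
  obtain ⟨e, he⟩ := hsurj y
  exact ⟨e, he, fun e' he' => hmono.injective (he'.trans he.symm)⟩

theorem hasDerivWithinAt_of_eq_add_integral (hRc : Continuous fun q : ℝ × ℝ => R q.1 q.2)
    (hR : ∀ e t, 0 ≤ t → H e t = H e 0 + ∫ τ in (0 : ℝ)..t, R e τ) (e : ℝ) {t : ℝ} (ht : 0 ≤ t) :
    HasDerivWithinAt (fun t => H e t) (R e t) (Ici 0) t := by
  have hc : Continuous fun τ => R e τ := hRc.comp (Continuous.prodMk_right e)
  have := (intervalIntegral.integral_hasDerivAt_right (hc.intervalIntegrable 0 t)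
    (hc.stronglyMeasurableAtFilter _ _) hc.continuousAt).const_add (H e 0)
  exact this.hasDerivWithinAt.congr (fun x hx => hR e x hx) (hR e t ht)

/-- The equation `η' = -∂ₜH / ∂ₑH` is solved by following a level set of `H`, and in no other
way. -/
theorem exists_unique_level_curve (hPc : Continuous fun q : ℝ × ℝ => P q.1 q.2)
    (hRc : Continuous fun q : ℝ × ℝ => R q.1 q.2)
    (hP : ∀ e t, HasDerivAt (fun e => H e t) (P e t) e)
    (hR : ∀ e t, 0 ≤ t → H e t = H e 0 + ∫ τ in (0 : ℝ)..t, R e τ)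
    (hc : 0 < c) (hlow : ∀ e t, c ≤ P e t) (η₀ : ℝ) :
    ∃ η : ℝ → ℝ, η 0 = η₀ ∧ (∀ t, 0 ≤ t → H (η t) t = H η₀ 0) ∧
      (∀ t, 0 ≤ t → HasDerivWithinAt η (-R (η t) t / P (η t) t) (Ici 0) t) ∧
      ∀ η' : ℝ → ℝ, η' 0 = η₀ →
        (∀ t, 0 ≤ t → HasDerivWithinAt η' (-R (η' t) t / P (η' t) t) (Ici 0) t) →
        EqOn η' η (Ici 0) := by
  have hex := fun t => existsUnique_eq_of_hasDerivAt hPc hP hc hlow t (H η₀ 0)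
  choose η hη huniq using hex
  simp only at hη huniq
  have hη0 : η 0 = η₀ := (huniq 0 η₀ rfl).symm
  set Q : ℝ → ℝ → ℝ → ℝ := fun e e' t => ∫ σ in (0 : ℝ)..1, P (e + σ * (e' - e)) t with hQ
  have hQP : ∀ e t, Q e e t = P e t := by intro e t; simp [hQ]
  have hQlow : ∀ e e' t, c ≤ Q e e' t := mean_value_ge hPc hlow
  have hQc : ∀ e, Continuous fun q : ℝ × ℝ => Q e q.1 q.2 := continuous_mean_value hPc
  have hmv : ∀ e e' t, H e' t - H e t = (e' - e) * Q e e' t :=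
    sub_eq_mul_integral_of_hasDerivAt hPc hP
  have hKd : ∀ e t, 0 ≤ t → HasDerivWithinAt (fun t => H e t) (R e t) (Ici 0) t :=
    fun e t ht => hasDerivWithinAt_of_eq_add_integral hRc hR e ht
  refine ⟨η, hη0, fun t _ => hη t, fun t ht => ?_, fun η' h0 hd t ht => ?_⟩
  -- Both points lie on the same level, so the increment of `η` is minus the increment of `H` in
  -- time at fixed `e`, divided by the averaged slope. This first gives continuity of `η`, then the
  -- limit of its difference quotient.
  · have hid : ∀ t', η t' - η t = -((H (η t) t' - H (η t) t) / Q (η t) (η t') t') := by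
      intro t'
      have h1 := hmv (η t) (η t') t'
      have h2 : 0 < Q (η t) (η t') t' := hc.trans_le (hQlow _ _ _)
      rw [hη t'] at h1
      rw [hη t, ← neg_div, eq_div_iff h2.ne', ← h1]; ring
    have hK0 : Tendsto (fun t' => H (η t) t' - H (η t) t) (𝓝[Ici 0] t) (𝓝 0) := by
      have := (hKd (η t) t ht).continuousWithinAt.tendsto.sub_const (H (η t) t)
      simpa using this
    have hηc : Tendsto η (𝓝[Ici 0] t) (𝓝 (η t)) := by
      rw [tendsto_iff_norm_sub_tendsto_zero]
      have h3 : Tendsto (fun t' => |H (η t) t' - H (η t) t| / c) (𝓝[Ici 0] t) (𝓝 0) := by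
        simpa using (hK0.abs).div_const c
      refine squeeze_zero (fun _ => norm_nonneg _) (fun t' => ?_) h3
      have h2 : 0 < Q (η t) (η t') t' := hc.trans_le (hQlow _ _ _)
      rw [hid t', Real.norm_eq_abs, abs_neg, abs_div, abs_of_pos h2]
      gcongr
      exact hQlow _ _ _
    rw [hasDerivWithinAt_iff_tendsto_slope]
    have hsub : 𝓝[Ici 0 \ {t}] t ≤ 𝓝[Ici 0] t := nhdsWithin_mono _ sdiff_subset
    have hs := (hasDerivWithinAt_iff_tendsto_slope.1 (hKd (η t) t ht))
    have hQt : Tendsto (fun t' => Q (η t) (η t') t') (𝓝[Ici 0 \ {t}] t) (𝓝 (P (η t) t)) := by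
      rw [← hQP (η t) t]
      have h4 : Tendsto (fun t' => (η t', t')) (𝓝[Ici 0 \ {t}] t) (𝓝 (η t, t)) :=
        (hηc.mono_left hsub).prodMk_nhds (tendsto_id.mono_left nhdsWithin_le_nhds)
      exact ((hQc (η t)).tendsto (η t, t)).comp h4
    have hlim := (hs.neg).div hQt (hc.trans_le (hlow _ _)).ne'
    refine hlim.congr fun t' => ?_
    simp only [Pi.div_apply, slope_def_field]
    rw [hid t']
    ring
  · have ht' : 0 ≤ t := ht
    set Φ : ℝ → ℝ := fun t => H (η' t) t with hΦ
    -- Conversely, along any solution the chain rule, again through the averaged slope, makes `H`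
    -- constant; the curve then coincides with the unique level point at each time.
    have hΦd : ∀ t, 0 ≤ t → HasDerivWithinAt Φ 0 (Ici 0) t := by
      intro t ht
      rw [hasDerivWithinAt_iff_tendsto_slope]
      have hsub : 𝓝[Ici 0 \ {t}] t ≤ 𝓝[Ici 0] t := nhdsWithin_mono _ sdiff_subset
      have hs := hasDerivWithinAt_iff_tendsto_slope.1 (hKd (η' t) t ht)
      have hs' := hasDerivWithinAt_iff_tendsto_slope.1 (hd t ht)
      have hQt : Tendsto (fun t' => Q (η' t) (η' t') t') (𝓝[Ici 0 \ {t}] t) (𝓝 (P (η' t) t)) := by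
        rw [← hQP (η' t) t]
        have h4 : Tendsto (fun t' => (η' t', t')) (𝓝[Ici 0 \ {t}] t) (𝓝 (η' t, t)) :=
          ((hd t ht).continuousWithinAt.tendsto.mono_left hsub).prodMk_nhds
            (tendsto_id.mono_left nhdsWithin_le_nhds)
        exact ((hQc (η' t)).tendsto (η' t, t)).comp h4
      have hlim := (hs'.mul hQt).add hs
      have hpos : P (η' t) t ≠ 0 := (hc.trans_le (hlow _ _)).ne'
      have hzero : -R (η' t) t / P (η' t) t * P (η' t) t + R (η' t) t = 0 := by
        field_simp; ring
      rw [hzero] at hlim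
      refine hlim.congr fun t' => ?_
      simp only [slope_def_field, hΦ]
      have h1 := hmv (η' t) (η' t') t'
      have h2 : H (η' t') t' - H (η' t) t
        = (η' t' - η' t) * Q (η' t) (η' t') t' + (H (η' t) t' - H (η' t) t) := by linarith
      rw [h2]; ring
    have hconst := constant_of_has_deriv_right_zero (f := Φ) (a := 0) (b := t)
      (fun x hx => ((hΦd x hx.1).continuousWithinAt).mono Icc_subset_Ici_self)
      (fun x hx => (hΦd x hx.1).mono (Ici_subset_Ici.2 hx.1)) t ⟨ht', le_rfl⟩
    apply huniq t
    have : Φ t = H (η' 0) 0 := hconst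
    rw [h0] at this
    exact this

end LevelSets

/-! ### Mass of the initial deviation -/

/-- A window of fixed length slides to where `g` is nearly `L`. The telescoped integral of `g - g(·
- e)` leaves one such window at each end. -/
theorem tendsto_integral_window {g : ℝ → ℝ} (hg : Continuous g) {B L : ℝ} (hB : ∀ x, |g x| ≤ B)
    {l : Filter ℝ} [l.IsCountablyGenerated] (hl : Tendsto g l (𝓝 L))
    (hshift : ∀ y : ℝ, Tendsto (fun x => x + y) l l) (e : ℝ) :
    Tendsto (fun x => ∫ y in (x - e)..x, g y) l (𝓝 (e * L)) := by
  have h1 : ∀ x, ∫ y in (x - e)..x, g y = ∫ y in (-e)..0, g (x + y) := by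
    intro x
    rw [intervalIntegral.integral_comp_add_left, add_zero, sub_eq_add_neg]
  simp_rw [h1]
  have h2 : e * L = ∫ _ in (-e)..0, L := by
    rw [intervalIntegral.integral_const, smul_eq_mul]; ring
  rw [h2]
  refine intervalIntegral.tendsto_integral_filter_of_dominated_convergence (fun _ => B)
    (Eventually.of_forall fun x => (hg.comp (continuous_const_add x)).aestronglyMeasurable)
    (Eventually.of_forall fun x => ae_of_all _ fun y _ => hB _) intervalIntegrable_const
    (ae_of_all _ fun y _ => hl.comp (hshift y))

/-- The mass of the initial deviation from the ansatz with shift `e`. -/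
theorem tendsto_initial_mass {g h₁ φ u₀ wl wr : ℝ → ℝ} {ubl ubr Il Ir B B' : ℝ}
    (hφ : ∀ x, φ x = ubr + (ubl - ubr) * g x) (hd : ∀ x, HasDerivAt g (h₁ x) x)
    (hh : Continuous h₁) (hi : Integrable h₁) (hB : ∀ x, |g x| ≤ B)
    (hbot : Tendsto g atBot (𝓝 1)) (htop : Tendsto g atTop (𝓝 0)) (hwl : Continuous wl)
    (hwr : Continuous wr) (hB' : ∀ x, |∫ y in (0 : ℝ)..x, (wl y - wr y)| ≤ B')
    (hu : LocallyIntegrable u₀)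
    (hIl : Tendsto (fun R => ∫ ξ in R..(0 : ℝ), (u₀ ξ - φ ξ - wl ξ)) atBot (𝓝 Il))
    (hIr : Tendsto (fun R => ∫ ξ in (0 : ℝ)..R, (u₀ ξ - φ ξ - wr ξ)) atTop (𝓝 Ir)) (e : ℝ) :
    Tendsto (fun q : ℝ × ℝ => ∫ ξ in q.1..q.2,
      ((u₀ ξ - (ubl + wl ξ)) * g (ξ - e) + (u₀ ξ - (ubr + wr ξ)) * (1 - g (ξ - e))))
      (atBot ×ˢ atTop)
      (𝓝 (Il + Ir + correlate h₁ (fun x => ∫ y in (0 : ℝ)..x, (wl y - wr y)) e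
        - (ubl - ubr) * e)) := by
  have hg : Continuous g := continuous_iff_continuousAt.2 fun x => (hd x).continuousAt
  have hge : Continuous fun ξ => g (ξ - e) := hg.comp (continuous_id.sub continuous_const)
  have hφc : Continuous φ := by rw [funext hφ]; fun_prop
  set D : ℝ → ℝ := fun x => ∫ y in (0 : ℝ)..x, (wl y - wr y) with hD
  have hwc : Continuous fun y => wl y - wr y := hwl.sub hwr
  have hDd : ∀ x, HasDerivAt D (wl x - wr x) x := fun x =>
    intervalIntegral.integral_hasDerivAt_right (hwc.intervalIntegrable _ _)
      (hwc.stronglyMeasurableAtFilter _ _) hwc.continuousAt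
  have hDc : Continuous D := continuous_iff_continuousAt.2 fun x => (hDd x).continuousAt
  have hD0 : D 0 = 0 := by simp [hD]
  have hui : ∀ a b, IntervalIntegrable u₀ volume a b := fun a b =>
    (hu.integrableOn_isCompact isCompact_uIcc).intervalIntegrable
  have hci : ∀ {h : ℝ → ℝ} (a b : ℝ), Continuous h → IntervalIntegrable h volume a b :=
    fun a b hh => hh.intervalIntegrable a b
  have hDh : Continuous fun ξ => D ξ * h₁ (ξ - e) := hDc.mul (hh.comp (continuous_id.sub continuous_const))
  have hDi : Integrable fun ξ => D ξ * h₁ (ξ - e) := integrable_mul_comp_sub hDc hB' hi e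
  have hged : ∀ x, HasDerivAt (fun ξ => g (ξ - e)) (h₁ (x - e)) x := fun x =>
    (hd (x - e)).comp_sub_const x e
  have hwin : ∀ a b, ∫ ξ in a..b, (g ξ - g (ξ - e))
      = (∫ ξ in (b - e)..b, g ξ) - ∫ ξ in (a - e)..a, g ξ := by
    intro a b
    rw [intervalIntegral.integral_sub (hci _ _ hg) (hci _ _ hge),
      intervalIntegral.integral_comp_sub_right g e]
    have h1 := intervalIntegral.integral_add_adjacent_intervals (hci (a - e) a hg) (hci a b hg)
    have h2 := intervalIntegral.integral_add_adjacent_intervals (hci (a - e) (b - e) hg)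
      (hci (b - e) b hg)
    linarith
  have hbdd : ∀ {l : Filter ℝ} {k : ℝ → ℝ}, Tendsto k l (𝓝 0) →
      Tendsto (fun x => D x * k x) l (𝓝 0) := by
    intro l k hk
    have h1 : Tendsto (fun x => B' * |k x|) l (𝓝 0) := by simpa using hk.abs.const_mul B'
    refine squeeze_zero_norm (fun x => ?_) h1
    rw [norm_mul, Real.norm_eq_abs, Real.norm_eq_abs]
    gcongr
    exact hB' x
  have hsb : ∀ y : ℝ, Tendsto (fun x : ℝ => x + y) atBot atBot := fun y =>
    tendsto_atBot_add_const_right _ y tendsto_id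
  have hst : ∀ y : ℝ, Tendsto (fun x : ℝ => x + y) atTop atTop := fun y =>
    tendsto_atTop_add_const_right _ y tendsto_id
  -- On the left the integrand equals `(u₀ - φ - wl) + (wl - wr)(1 - g(ξ-e)) + (ubl - ubr)(g(ξ) -
  -- g(ξ-e))`. The middle term is integrated by parts against the bounded primitive `D`, whose
  -- boundary term dies as `g → 1`; the last one telescopes. On the right the comparison is with
  -- `wr`, and `g → 0` plays the same role.
  have hleft : Tendsto (fun a => ∫ ξ in a..(0 : ℝ), ((u₀ ξ - (ubl + wl ξ)) * g (ξ - e)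
      + (u₀ ξ - (ubr + wr ξ)) * (1 - g (ξ - e)))) atBot
      (𝓝 (Il + (∫ ξ in Iic 0, D ξ * h₁ (ξ - e))
        + (ubl - ubr) * ((∫ ξ in (0 - e)..0, g ξ) - e * 1))) := by
    have hform : ∀ a, ∫ ξ in a..(0 : ℝ), ((u₀ ξ - (ubl + wl ξ)) * g (ξ - e)
        + (u₀ ξ - (ubr + wr ξ)) * (1 - g (ξ - e)))
        = (∫ ξ in a..(0 : ℝ), (u₀ ξ - φ ξ - wl ξ))
          + (-(D a * (1 - g (a - e))) + ∫ ξ in a..(0 : ℝ), D ξ * h₁ (ξ - e))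
          + (ubl - ubr) * ((∫ ξ in (0 - e)..0, g ξ) - ∫ ξ in (a - e)..a, g ξ) := by
      intro a
      have hc1 : Continuous fun ξ => (wl ξ - wr ξ) * (1 - g (ξ - e)) := by fun_prop
      have h1 : ∫ ξ in a..(0 : ℝ), ((wl ξ - wr ξ) * (1 - g (ξ - e)) - D ξ * h₁ (ξ - e))
          = -(D a * (1 - g (a - e))) := by
        rw [intervalIntegral.integral_eq_sub_of_hasDerivAt
          (f := fun ξ => D ξ * (1 - g (ξ - e)))
          (f' := fun ξ => (wl ξ - wr ξ) * (1 - g (ξ - e)) - D ξ * h₁ (ξ - e)) (fun x _ => ?_) (hci _ _ (hc1.sub hDh)), hD0]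
        · ring
        · exact ((hDd x).mul ((hged x).const_sub 1)).congr_deriv (by ring)
      rw [← h1, intervalIntegral.integral_sub (hci _ _ hc1) (hci _ _ hDh), sub_add_cancel,
        ← hwin a 0, ← intervalIntegral.integral_const_mul, ← intervalIntegral.integral_add
          (((hui _ _).sub (hci _ _ hφc)).sub (hci _ _ hwl)) (hci _ _ hc1),
        ← intervalIntegral.integral_add
          ((((hui _ _).sub (hci _ _ hφc)).sub (hci _ _ hwl)).add (hci _ _ hc1))
          (hci _ _ (by fun_prop))]
      congr 1; funext ξ
      rw [hφ]; ring
    simp_rw [hform]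
    have h2 : Tendsto (fun a => D a * (1 - g (a - e))) atBot (𝓝 0) := by
      apply hbdd
      have := (hbot.comp (hsb (-e))).const_sub 1
      simpa [Function.comp_def, ← sub_eq_add_neg] using this
    have h3 := intervalIntegral_tendsto_integral_Iic (μ := volume) 0 hDi.integrableOn tendsto_id
    have h4 := tendsto_integral_window hg hB hbot hsb e
    have := (hIl.add (h2.neg.add h3)).add ((h4.const_sub (∫ ξ in (0 - e)..0, g ξ)).const_mul
      (ubl - ubr))
    simpa using this
  have hright : Tendsto (fun b => ∫ ξ in (0 : ℝ)..b, ((u₀ ξ - (ubl + wl ξ)) * g (ξ - e)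
      + (u₀ ξ - (ubr + wr ξ)) * (1 - g (ξ - e)))) atTop
      (𝓝 (Ir + (∫ ξ in Ioi 0, D ξ * h₁ (ξ - e))
        + (ubl - ubr) * (e * 0 - ∫ ξ in (0 - e)..0, g ξ))) := by
    have hform : ∀ b, ∫ ξ in (0 : ℝ)..b, ((u₀ ξ - (ubl + wl ξ)) * g (ξ - e)
        + (u₀ ξ - (ubr + wr ξ)) * (1 - g (ξ - e)))
        = (∫ ξ in (0 : ℝ)..b, (u₀ ξ - φ ξ - wr ξ))
          + (-(D b * g (b - e)) + ∫ ξ in (0 : ℝ)..b, D ξ * h₁ (ξ - e))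
          + (ubl - ubr) * ((∫ ξ in (b - e)..b, g ξ) - ∫ ξ in (0 - e)..0, g ξ) := by
      intro b
      have hc1 : Continuous fun ξ => -((wl ξ - wr ξ) * g (ξ - e)) := by fun_prop
      have h1 : ∫ ξ in (0 : ℝ)..b, (-((wl ξ - wr ξ) * g (ξ - e)) - D ξ * h₁ (ξ - e))
          = -(D b * g (b - e)) := by
        rw [intervalIntegral.integral_eq_sub_of_hasDerivAt
          (f := fun ξ => -(D ξ * g (ξ - e)))
          (f' := fun ξ => -((wl ξ - wr ξ) * g (ξ - e)) - D ξ * h₁ (ξ - e)) (fun x _ => ?_) (hci _ _ (hc1.sub hDh)), hD0]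
        · ring
        · exact ((hDd x).mul (hged x)).neg.congr_deriv (by ring)
      rw [← h1, intervalIntegral.integral_sub (hci _ _ hc1) (hci _ _ hDh), sub_add_cancel,
        ← hwin 0 b, ← intervalIntegral.integral_const_mul, ← intervalIntegral.integral_add
          (((hui _ _).sub (hci _ _ hφc)).sub (hci _ _ hwr)) (hci _ _ hc1),
        ← intervalIntegral.integral_add
          ((((hui _ _).sub (hci _ _ hφc)).sub (hci _ _ hwr)).add (hci _ _ hc1))
          (hci _ _ (by fun_prop))]
      congr 1; funext ξ
      rw [hφ]; ring
    simp_rw [hform]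
    have h2 : Tendsto (fun b => D b * g (b - e)) atTop (𝓝 0) := by
      apply hbdd
      have := htop.comp (hst (-e))
      simpa [Function.comp_def, ← sub_eq_add_neg] using this
    have h3 := intervalIntegral_tendsto_integral_Ioi (μ := volume) 0 hDi.integrableOn tendsto_id
    have h4 := tendsto_integral_window hg hB htop hst e
    have := (hIr.add (h2.neg.add h3)).add ((h4.sub_const (∫ ξ in (0 - e)..0, g ξ)).const_mul
      (ubl - ubr))
    simpa using this
  have hII : ∀ a b, IntervalIntegrable (fun ξ => (u₀ ξ - (ubl + wl ξ)) * g (ξ - e)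
      + (u₀ ξ - (ubr + wr ξ)) * (1 - g (ξ - e))) volume a b := by
    intro a b
    refine IntervalIntegrable.add ?_ ?_
    · exact ((hui a b).sub (hci a b (continuous_const.add hwl))).mul_continuousOn hge.continuousOn
    · exact ((hui a b).sub (hci a b (continuous_const.add hwr))).mul_continuousOn
        (continuous_const.sub hge).continuousOn
  have hsum := (hleft.comp tendsto_fst).add (hright.comp (tendsto_snd (f := (atBot : Filter ℝ))))
  have hval : (Il + (∫ ξ in Iic 0, D ξ * h₁ (ξ - e))
        + (ubl - ubr) * ((∫ ξ in (0 - e)..0, g ξ) - e * 1))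
      + (Ir + (∫ ξ in Ioi 0, D ξ * h₁ (ξ - e)) + (ubl - ubr) * (e * 0 - ∫ ξ in (0 - e)..0, g ξ))
      = Il + Ir + correlate h₁ D e - (ubl - ubr) * e := by
    have h1 := intervalIntegral.integral_Iic_add_Ioi (b := 0) hDi.integrableOn hDi.integrableOn
    rw [integral_mul_comp_sub] at h1
    rw [← h1]; ring
  rw [hval] at hsum
  refine hsum.congr fun q => ?_
  simp only [Function.comp]
  exact intervalIntegral.integral_add_adjacent_intervals (hII _ _) (hII _ _)

/-! ### The normalized profile as a kernel -/

section Front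

variable {f : ℝ → ℝ} {μ γ s ubl ubr : ℝ} {φ : ℝ → ℝ}

theorem eq_add_mul_normProfile (hlr : ubr < ubl) (φ : ℝ → ℝ) (x : ℝ) :
    φ x = ubr + (ubl - ubr) * normProfile ubl ubr φ x := by
  have : ubl - ubr ≠ 0 := by linarith
  rw [normProfile]; field_simp; ring

theorem IsShockProfile.contDiff_normProfile (hφ : IsShockProfile f μ γ s ubl ubr φ) :
    ContDiff ℝ 3 (normProfile ubl ubr φ) :=
  (hφ.contDiff.sub contDiff_const).div_const _

theorem IsShockProfile.tendsto_normProfile_atBot (hφ : IsShockProfile f μ γ s ubl ubr φ)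
    (hlr : ubr < ubl) : Tendsto (normProfile ubl ubr φ) atBot (𝓝 1) := by
  have h1 := (hφ.tendsto_left.sub_const ubr).div_const (ubl - ubr)
  rwa [div_self (by linarith)] at h1

theorem IsShockProfile.tendsto_normProfile_atTop (hφ : IsShockProfile f μ γ s ubl ubr φ) :
    Tendsto (normProfile ubl ubr φ) atTop (𝓝 0) := by
  have h1 := (hφ.tendsto_right.sub_const ubr).div_const (ubl - ubr)
  rwa [sub_self, zero_div] at h1

theorem IsShockProfile.exists_bound_normProfile (hφ : IsShockProfile f μ γ s ubl ubr φ) :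
    ∃ B, ∀ x, |normProfile ubl ubr φ x| ≤ B := by
  obtain ⟨B, hB⟩ := hφ.exists_bound
  refine ⟨(B + |ubr|) / |ubl - ubr|, fun x => ?_⟩
  rw [normProfile, abs_div]
  gcongr
  exact (abs_sub _ _).trans (by gcongr; exact hB x)

theorem IsShockProfile.isFrontKernel (hφ : IsShockProfile f μ γ s ubl ubr φ)
    (hf : ContDiff ℝ 1 f) (hconv : StrictConvexOn ℝ univ f) (hμ : 0 < μ) (hγ : 0 < γ)
    (hlr : ubr < ubl) (hRH : s * (ubl - ubr) = f ubl - f ubr) :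
    IsFrontKernel (deriv (normProfile ubl ubr φ)) (iteratedDeriv 2 (normProfile ubl ubr φ))
      (iteratedDeriv 3 (normProfile ubl ubr φ)) := by
  obtain ⟨i1, i2, i3⟩ := hφ.integrable_derivs hf hconv hμ hγ hlr hRH
  have hd := hasDerivAt_of_contDiff_three hφ.contDiff
  have hg := hasDerivAt_of_contDiff_three hφ.contDiff_normProfile
  have e1 : deriv (normProfile ubl ubr φ) = fun x => deriv φ x / (ubl - ubr) := funext fun x =>
    (hg x).1.unique (((hd x).1.sub_const ubr).div_const _)
  have e2 : iteratedDeriv 2 (normProfile ubl ubr φ) = fun x => iteratedDeriv 2 φ x / (ubl - ubr) := by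
    funext x
    have h1 := (hg x).2.1
    rw [e1] at h1
    exact h1.unique ((hd x).2.1.div_const _)
  have e3 : iteratedDeriv 3 (normProfile ubl ubr φ) = fun x => iteratedDeriv 3 φ x / (ubl - ubr) := by
    funext x
    have h1 := (hg x).2.2
    rw [e2] at h1
    exact h1.unique ((hd x).2.2.div_const _)
  have j1 : Integrable (deriv (normProfile ubl ubr φ)) := by rw [e1]; exact i1.div_const _
  refine ⟨j1, by rw [e2]; exact i2.div_const _, by rw [e3]; exact i3.div_const _,
    fun x => (hg x).2.1, fun x => (hg x).2.2, ?_⟩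
  rw [integral_of_hasDerivAt_of_tendsto (fun x => (hg x).1) j1
    (hφ.tendsto_normProfile_atBot hlr) hφ.tendsto_normProfile_atTop]
  norm_num

/-- Makes the constant states invisible to the diffusion term of the shift equation; the next
identity does the same for the dispersion term. -/
theorem IsFrontKernel.integral₂ {h₁ h₂ h₃ : ℝ → ℝ} (hk : IsFrontKernel h₁ h₂ h₃) :
    ∫ x, h₂ x = 0 := integral_eq_zero_of_hasDerivAt_of_integrable hk.deriv₁ hk.int₂ hk.int₁

theorem IsFrontKernel.integral₃ {h₁ h₂ h₃ : ℝ → ℝ} (hk : IsFrontKernel h₁ h₂ h₃) :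
    ∫ x, h₃ x = 0 := integral_eq_zero_of_hasDerivAt_of_integrable hk.deriv₂ hk.int₃ hk.int₂

end Front

/-! ### Bounds for exponentially decaying perturbations -/

/-- `v` decays exponentially for positive times and is frozen for negative times. -/
structure IsDecaying (v : ℝ → ℝ → ℝ) (D θ : ℝ) : Prop where
  frozen : ∀ ξ t, v ξ t = v ξ (max t 0)
  bound : ∀ ξ t, 0 ≤ t → |v ξ t| ≤ D * Real.exp (-θ * t)

section Decaying

variable {f : ℝ → ℝ} {μ γ s p ub D θ M : ℝ} {v : ℝ → ℝ → ℝ} {h₁ h₂ h₃ : ℝ → ℝ}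

theorem IsDecaying.nonneg (h : IsDecaying v D θ) : 0 ≤ D := by
  have := h.bound 0 0 le_rfl
  simp only [mul_zero, Real.exp_zero, mul_one] at this
  exact (abs_nonneg _).trans this

theorem IsDecaying.abs_le (h : IsDecaying v D θ) (hθ : 0 < θ) (ξ t : ℝ) : |v ξ t| ≤ D := by
  rw [h.frozen]
  refine (h.bound ξ _ (le_max_right t 0)).trans (mul_le_of_le_one_right h.nonneg ?_)
  exact Real.exp_le_one_iff.2 (by
    have : 0 ≤ θ * max t 0 := mul_nonneg hθ.le (le_max_right _ _)
    linarith)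

theorem IsDecaying.abs_flux_le (h : IsDecaying v D θ) (hθ : 0 < θ) (hD : D ≤ 1) (hM0 : 0 ≤ M)
    (hM : ∀ (v : ℝ → ℝ → ℝ) (ξ t : ℝ), |v ξ t| ≤ 1 → |fluxPerturbation f ub v ξ t| ≤ M * |v ξ t|)
    (ξ t : ℝ) : |fluxPerturbation f ub v ξ t| ≤ M * D :=
  (hM v ξ t ((h.abs_le hθ ξ t).trans hD)).trans (by gcongr; exact h.abs_le hθ ξ t)

theorem IsDecaying.abs_flux_le_exp (h : IsDecaying v D θ) (hθ : 0 < θ) (hD : D ≤ 1) (hM0 : 0 ≤ M)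
    (hM : ∀ (v : ℝ → ℝ → ℝ) (ξ t : ℝ), |v ξ t| ≤ 1 → |fluxPerturbation f ub v ξ t| ≤ M * |v ξ t|)
    (ξ : ℝ) {t : ℝ} (ht : 0 ≤ t) :
    |fluxPerturbation f ub v ξ t| ≤ M * (D * Real.exp (-θ * t)) :=
  (hM v ξ t ((h.abs_le hθ ξ t).trans hD)).trans (by gcongr; exact h.bound ξ t ht)

theorem IsDecaying.abs_meanFlux_le (h : IsDecaying v D θ) (hp : 0 < p) (hθ : 0 < θ) (hD : D ≤ 1)
    (hM0 : 0 ≤ M)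
    (hM : ∀ (v : ℝ → ℝ → ℝ) (ξ t : ℝ), |v ξ t| ≤ 1 → |fluxPerturbation f ub v ξ t| ≤ M * |v ξ t|)
    {t : ℝ} (ht : 0 ≤ t) :
    |meanFluxPerturbation f p ub v t| ≤ M * D * Real.exp (-θ * t) := by
  have := intervalIntegral.norm_integral_le_of_norm_le_const (a := 0) (b := p)
    (f := fun ξ => fluxPerturbation f ub v ξ t) (C := M * (D * Real.exp (-θ * t)))
    (fun x _ => h.abs_flux_le_exp hθ hD hM0 hM x ht)
  rw [sub_zero, abs_of_pos hp, Real.norm_eq_abs] at this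
  rw [meanFluxPerturbation, abs_mul, abs_of_pos (by positivity : 0 < 1 / p), one_div,
    inv_mul_le_iff₀ hp]
  linarith

theorem integral_exp_tail {θ : ℝ} (hθ : 0 < θ) (t : ℝ) :
    IntegrableOn (fun τ => Real.exp (-θ * τ)) (Ioi t) ∧
      ∫ τ in Ioi t, Real.exp (-θ * τ) = Real.exp (-θ * t) / θ := by
  refine ⟨integrableOn_exp_mul_Ioi (by linarith) t, ?_⟩
  rw [integral_exp_mul_Ioi (by linarith)]
  rw [neg_div_neg_eq]

theorem abs_tail_le {m : ℝ → ℝ} (hm : Continuous m) {A θ : ℝ} (hθ : 0 < θ)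
    (hb : ∀ t, 0 ≤ t → |m t| ≤ A * Real.exp (-θ * t)) :
    IntegrableOn m (Ioi 0) ∧ ∀ t, 0 ≤ t →
      |(∫ τ in Ioi 0, m τ) - ∫ τ in (0 : ℝ)..t, m τ| ≤ A / θ * Real.exp (-θ * t) := by
  have hint : IntegrableOn m (Ioi 0) := by
    refine Integrable.mono' ((integral_exp_tail hθ 0).1.const_mul A) hm.aestronglyMeasurable ?_
    rw [ae_restrict_iff' measurableSet_Ioi]
    exact ae_of_all _ fun t ht => hb t (le_of_lt ht)
  refine ⟨hint, fun t ht => ?_⟩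
  have h1 := intervalIntegral.integral_Ioi_sub_Ioi hint ht
  have h2 : (∫ τ in Ioi 0, m τ) - ∫ τ in (0 : ℝ)..t, m τ = ∫ τ in Ioi t, m τ := by linarith
  rw [h2]
  have h3 : ‖∫ τ in Ioi t, m τ‖ ≤ ∫ τ in Ioi t, A * Real.exp (-θ * τ) := by
    refine norm_integral_le_of_norm_le ((integral_exp_tail hθ t).1.const_mul A) ?_
    rw [ae_restrict_iff' measurableSet_Ioi]
    exact ae_of_all _ fun τ hτ => hb τ (ht.trans (le_of_lt hτ))
  rw [integral_const_mul, (integral_exp_tail hθ t).2] at h3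
  refine h3.trans (le_of_eq ?_)
  ring

theorem IsDecaying.abs_shiftNumerator_le (h : IsDecaying v D θ) (hθ : 0 < θ) (hD : D ≤ 1)
    (hM0 : 0 ≤ M)
    (hM : ∀ (v : ℝ → ℝ → ℝ) (ξ t : ℝ), |v ξ t| ≤ 1 → |fluxPerturbation f ub v ξ t| ≤ M * |v ξ t|)
    (hμ : 0 < μ) (hγ : 0 < γ) (hk : IsFrontKernel h₁ h₂ h₃) (e : ℝ) {t : ℝ} (ht : 0 ≤ t) :
    |shiftNumerator f μ γ s ub h₁ h₂ h₃ v e t| ≤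
      (γ * (∫ y, |h₂ y|) + μ * (∫ y, |h₃ y|) + (M + |s|) * ∫ y, |h₁ y|)
        * (D * Real.exp (-θ * t)) := by
  have b1 := abs_correlate_le (fun x => h.bound x t ht) hk.int₁ e
  have b2 := abs_correlate_le (fun x => h.bound x t ht) hk.int₂ e
  have b3 := abs_correlate_le (fun x => h.bound x t ht) hk.int₃ e
  have b4 := abs_correlate_le (fun x => h.abs_flux_le_exp hθ hD hM0 hM x ht) hk.int₁ e
  rw [shiftNumerator]
  refine (abs_sub _ _).trans ?_
  have h5 := (abs_add_le (γ * correlate h₂ (fun ξ => v ξ t) e + μ * correlate h₃ (fun ξ => v ξ t) e)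
    (correlate h₁ (fun ξ => fluxPerturbation f ub v ξ t) e))
  have h6 := abs_add_le (γ * correlate h₂ (fun ξ => v ξ t) e) (μ * correlate h₃ (fun ξ => v ξ t) e)
  rw [abs_mul, abs_mul, abs_of_pos hγ, abs_of_pos hμ] at h6
  rw [abs_mul s]
  have c1 := mul_le_mul_of_nonneg_left b1 (abs_nonneg s)
  have c2 := mul_le_mul_of_nonneg_left b2 hγ.le
  have c3 := mul_le_mul_of_nonneg_left b3 hμ.le
  linarith

/-- The transport part `-s v` averages to zero, so the flux in the limit formula is the one in the
potential. -/
theorem IsModeSolution.meanFlux_eq (hf : Continuous f) (hv : IsModeSolution f μ γ s p ub v)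
    {u : ℝ → ℝ → ℝ} {t : ℝ} (hu : ∀ ξ, u ξ t = ub + v ξ t) :
    meanFlux f s p ub u t = meanFluxPerturbation f p ub v t := by
  have hsv : Continuous fun ξ => s * v ξ t :=
    continuous_const.mul (continuous_slice hv.continuous t)
  have hFs := continuous_slice (v := fluxPerturbation f ub v)
    (continuous_fluxPerturbation hf hv.continuous) t
  have h1 : ∀ ξ, f (u ξ t) - f ub - s * u ξ t + s * ub
      = fluxPerturbation f ub v ξ t - s * v ξ t := by
    intro ξ; rw [hu, fluxPerturbation]; ring
  rw [meanFlux, meanFluxPerturbation]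
  simp_rw [h1]
  rw [intervalIntegral.integral_sub (hFs.intervalIntegrable _ _)
    (hsv.intervalIntegrable _ _), intervalIntegral.integral_const_mul,
    hv.mean_zero, mul_zero, sub_zero]

end Decaying

/-! ### Solving the shift equation and its large time limit -/

section Core

variable {f : ℝ → ℝ} {μ γ s pl pr ubl ubr D θ M : ℝ} {vl vr : ℝ → ℝ → ℝ} {h₁ h₂ h₃ : ℝ → ℝ}

/-- Minus the denominator of the shift equation. -/
def shiftSlope (ubl ubr : ℝ) (h₁ : ℝ → ℝ) (vl vr : ℝ → ℝ → ℝ) (e t : ℝ) : ℝ :=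
  (ubl - ubr) - correlate h₁ (fun ξ => vl ξ t) e + correlate h₁ (fun ξ => vr ξ t) e

/-- The conserved quantity of the shift equation. -/
def shiftInvariant (f : ℝ → ℝ) (pl pr ubl ubr : ℝ) (h₁ : ℝ → ℝ) (vl vr : ℝ → ℝ → ℝ) (e t : ℝ) : ℝ :=
  (ubl - ubr) * e - shiftPotential f pl ubl h₁ vl e t + shiftPotential f pr ubr h₁ vr e t

/-- Each of the two correlations is at most a quarter of the jump, so half of the jump survives. The
same bound keeps the denominator of the shift equation away from zero. -/
theorem shiftSlope_ge (hθ : 0 < θ) (hdl : IsDecaying vl D θ) (hdr : IsDecaying vr D θ)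
    (hi : Integrable h₁) (hsmall : D * ∫ y, |h₁ y| ≤ (ubl - ubr) / 4) (e t : ℝ) :
    (ubl - ubr) / 2 ≤ shiftSlope ubl ubr h₁ vl vr e t := by
  have b1 := (abs_le.1 ((abs_correlate_le (fun x => hdl.abs_le hθ x t) hi e).trans hsmall)).2
  have b2 := (abs_le.1 ((abs_correlate_le (fun x => hdr.abs_le hθ x t) hi e).trans hsmall)).1
  rw [shiftSlope]; linarith

theorem continuous_shiftSlope (hθ : 0 < θ) (hvl : Continuous fun q : ℝ × ℝ => vl q.1 q.2)
    (hvr : Continuous fun q : ℝ × ℝ => vr q.1 q.2) (hdl : IsDecaying vl D θ)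
    (hdr : IsDecaying vr D θ) (hi : Integrable h₁) :
    Continuous fun q : ℝ × ℝ => shiftSlope ubl ubr h₁ vl vr q.1 q.2 :=
  (continuous_const.sub (continuous_correlate hvl (hdl.abs_le hθ) hi)).add
    (continuous_correlate hvr (hdr.abs_le hθ) hi)

theorem hasDerivAt_shiftInvariant (hpl : 0 < pl) (hpr : 0 < pr) (hθ : 0 < θ)
    (hvl : IsModeSolution f μ γ s pl ubl vl) (hvr : IsModeSolution f μ γ s pr ubr vr)
    (hdl : IsDecaying vl D θ) (hdr : IsDecaying vr D θ) (hi : Integrable h₁) (e t : ℝ) :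
    HasDerivAt (fun e => shiftInvariant f pl pr ubl ubr h₁ vl vr e t)
      (shiftSlope ubl ubr h₁ vl vr e t) e := by
  have h1 := ((hasDerivAt_id e).const_mul (ubl - ubr)).sub
    (hvl.hasDerivAt_shiftPotential hpl hi (hdl.abs_le hθ) e t) |>.add
    (hvr.hasDerivAt_shiftPotential hpr hi (hdr.abs_le hθ) e t)
  exact h1.congr_deriv (by rw [mul_one, shiftSlope])

/-- The level curve lemma is applied to the invariant, whose partial derivatives are `shiftSlope`
and the difference of the two numerators. The derivative bound is a decaying numerator over a slope
of at least half the jump. The bound on the position uses conservation: the primitives and the tails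
of the flux integrals are all that separates `η t` from its limit. -/
theorem exists_shift (hf : ContDiff ℝ 2 f) (hμ : 0 < μ) (hγ : 0 < γ) (hpl : 0 < pl) (hpr : 0 < pr)
    (hlr : ubr < ubl) (hk : IsFrontKernel h₁ h₂ h₃) (hθ : 0 < θ) (hD : D ≤ 1) (hM0 : 0 ≤ M)
    (hMl : ∀ (v : ℝ → ℝ → ℝ) (ξ t : ℝ), |v ξ t| ≤ 1 →
      |fluxPerturbation f ubl v ξ t| ≤ M * |v ξ t|)
    (hMr : ∀ (v : ℝ → ℝ → ℝ) (ξ t : ℝ), |v ξ t| ≤ 1 →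
      |fluxPerturbation f ubr v ξ t| ≤ M * |v ξ t|)
    (hvl : IsModeSolution f μ γ s pl ubl vl) (hvr : IsModeSolution f μ γ s pr ubr vr)
    (hdl : IsDecaying vl D θ) (hdr : IsDecaying vr D θ)
    (hsmall : D * ∫ y, |h₁ y| ≤ (ubl - ubr) / 4) (η₀ : ℝ) :
    ∃ η : ℝ → ℝ, η 0 = η₀ ∧
      (∀ t, 0 ≤ t → HasDerivWithinAt η (-(shiftNumerator f μ γ s ubl h₁ h₂ h₃ vl (η t) t
        - shiftNumerator f μ γ s ubr h₁ h₂ h₃ vr (η t) t) / shiftSlope ubl ubr h₁ vl vr (η t) t)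
        (Ici 0) t) ∧
      ContDiffOn ℝ 1 η (Ici 0) ∧
      (∀ η' : ℝ → ℝ, η' 0 = η₀ →
        (∀ t, 0 ≤ t → HasDerivWithinAt η' (-(shiftNumerator f μ γ s ubl h₁ h₂ h₃ vl (η' t) t
          - shiftNumerator f μ γ s ubr h₁ h₂ h₃ vr (η' t) t)
            / shiftSlope ubl ubr h₁ vl vr (η' t) t) (Ici 0) t) → EqOn η' η (Ici 0)) ∧
      ∀ t, 0 ≤ t →
        |derivWithin η (Ici 0) t| ≤ 4 / (ubl - ubr) *
          (γ * (∫ y, |h₂ y|) + μ * (∫ y, |h₃ y|) + (M + |s|) * ∫ y, |h₁ y|)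
            * (D * Real.exp (-θ * t)) ∧
        |η t - (1 / (ubl - ubr)) * (shiftInvariant f pl pr ubl ubr h₁ vl vr η₀ 0
          + (∫ τ in Ioi 0, meanFluxPerturbation f pl ubl vl τ)
          - ∫ τ in Ioi 0, meanFluxPerturbation f pr ubr vr τ)|
          ≤ 1 / (ubl - ubr) * (2 * M / θ + 2 * (pl + pr) * ∫ y, |h₁ y|)
            * (D * Real.exp (-θ * t)) := by
  have hfc : Continuous f := hf.continuous
  have hΔ : 0 < ubl - ubr := by linarith
  have bl := hdl.abs_le hθ
  have br := hdr.abs_le hθ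
  have bFl := hdl.abs_flux_le hθ hD hM0 hMl
  have bFr := hdr.abs_flux_le hθ hD hM0 hMr
  set N := fun e t => shiftNumerator f μ γ s ubl h₁ h₂ h₃ vl e t
        - shiftNumerator f μ γ s ubr h₁ h₂ h₃ vr e t with hN
  have hNl := continuous_shiftNumerator (μ := μ) (γ := γ) (s := s) hfc hvl.continuous hk bl bFl
  have hNr := continuous_shiftNumerator (μ := μ) (γ := γ) (s := s) hfc hvr.continuous hk br bFr
  have hNc : Continuous fun q : ℝ × ℝ => N q.1 q.2 := hNl.sub hNr
  have hPc := continuous_shiftSlope (ubl := ubl) (ubr := ubr) hθ hvl.continuous hvr.continuous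
    hdl hdr hk.int₁
  have hlow : ∀ e t, (ubl - ubr) / 2 ≤ shiftSlope ubl ubr h₁ vl vr e t :=
    shiftSlope_ge hθ hdl hdr hk.int₁ hsmall
  have hPd := hasDerivAt_shiftInvariant hpl hpr hθ hvl hvr hdl hdr hk.int₁
  have hRt : ∀ e t, 0 ≤ t → shiftInvariant f pl pr ubl ubr h₁ vl vr e t
      = shiftInvariant f pl pr ubl ubr h₁ vl vr e 0 + ∫ τ in (0 : ℝ)..t, N e τ := by
    intro e t ht
    have hNle : Continuous fun τ => shiftNumerator f μ γ s ubl h₁ h₂ h₃ vl e τ :=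
      hNl.comp (Continuous.prodMk_right e)
    have hNre : Continuous fun τ => shiftNumerator f μ γ s ubr h₁ h₂ h₃ vr e τ :=
      hNr.comp (Continuous.prodMk_right e)
    simp only [shiftInvariant, hN]
    rw [hvl.shiftPotential_eq_add_integral hfc hpl hk bl bFl e ht,
      hvr.shiftPotential_eq_add_integral hfc hpr hk br bFr e ht,
      intervalIntegral.integral_sub (hNle.intervalIntegrable _ _) (hNre.intervalIntegrable _ _)]
    ring
  obtain ⟨η, hη0, hinv, hder, huniq⟩ := exists_unique_level_curve hPc hNc hPd hRt
    (half_pos hΔ) hlow η₀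
  have hdw : ∀ t, 0 ≤ t → derivWithin η (Ici 0) t
      = -N (η t) t / shiftSlope ubl ubr h₁ vl vr (η t) t := fun t ht =>
    (hder t ht).derivWithin (uniqueDiffOn_Ici 0 t ht)
  have hηc : ContinuousOn η (Ici 0) := fun t ht => (hder t ht).continuousWithinAt
  refine ⟨η, hη0, hder, ?_, huniq, fun t ht => ⟨?_, ?_⟩⟩
  · have h1 : ContDiffOn ℝ (0 + 1) η (Ici 0) := by
      rw [contDiffOn_succ_iff_derivWithin (uniqueDiffOn_Ici 0)]
      refine ⟨fun t ht => (hder t ht).differentiableWithinAt, by simp, ?_⟩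
      rw [contDiffOn_zero]
      have h2 : ContinuousOn (fun t => -N (η t) t / shiftSlope ubl ubr h₁ vl vr (η t) t)
          (Ici 0) := by
        have h3 : ContinuousOn (fun t => (η t, t)) (Ici 0) := hηc.prodMk continuousOn_id
        exact ((hNc.comp_continuousOn h3).neg).div (hPc.comp_continuousOn h3)
          fun t _ => ((half_pos hΔ).trans_le (hlow _ _)).ne'
      exact h2.congr hdw
    rwa [zero_add] at h1
  · rw [hdw t ht, abs_div, abs_neg, abs_of_pos ((half_pos hΔ).trans_le (hlow _ _)),
      div_le_iff₀ ((half_pos hΔ).trans_le (hlow _ _))]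
    have n1 := hdl.abs_shiftNumerator_le (s := s) hθ hD hM0 hMl hμ hγ hk (η t) ht
    have n2 := hdr.abs_shiftNumerator_le (s := s) hθ hD hM0 hMr hμ hγ hk (η t) ht
    have n3 := abs_sub (shiftNumerator f μ γ s ubl h₁ h₂ h₃ vl (η t) t)
      (shiftNumerator f μ γ s ubr h₁ h₂ h₃ vr (η t) t)
    set A := γ * (∫ y, |h₂ y|) + μ * (∫ y, |h₃ y|) + (M + |s|) * ∫ y, |h₁ y|
    set E := D * Real.exp (-θ * t)
    have hAE : 0 ≤ A * E := (abs_nonneg _).trans n1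
    have n4 : |N (η t) t| ≤ 2 * (A * E) := by simp only [hN]; linarith
    refine n4.trans ?_
    have h5 : 4 / (ubl - ubr) * A * E * ((ubl - ubr) / 2) = 2 * (A * E) := by
      field_simp; ring
    rw [← h5]
    have : 0 ≤ 4 / (ubl - ubr) * A * E := by
      rw [mul_assoc]; positivity
    gcongr
    exact hlow _ _
  · have t1 := (abs_tail_le (continuous_meanFluxPerturbation (p := pl) (ub := ubl) hfc
      hvl.continuous) hθ (fun t ht => hdl.abs_meanFlux_le hpl hθ hD hM0 hMl ht)).2 t ht
    have t2 := (abs_tail_le (continuous_meanFluxPerturbation (p := pr) (ub := ubr) hfc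
      hvr.continuous) hθ (fun t ht => hdr.abs_meanFlux_le hpr hθ hD hM0 hMr ht)).2 t ht
    have x1 := abs_correlate_le (fun x => abs_meanZeroPrimitive_le hpl
      (continuous_slice hvl.continuous t) (hvl.periodic t) (hvl.mean_zero t)
      (fun x => hdl.bound x t ht) x) hk.int₁ (η t)
    have x2 := abs_correlate_le (fun x => abs_meanZeroPrimitive_le hpr
      (continuous_slice hvr.continuous t) (hvr.periodic t) (hvr.mean_zero t)
      (fun x => hdr.bound x t ht) x) hk.int₁ (η t)
    have hI := hinv t ht
    rw [shiftInvariant, shiftPotential, shiftPotential] at hI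
    set I₀ := shiftInvariant f pl pr ubl ubr h₁ vl vr η₀ 0
    set Xl := correlate h₁ (meanZeroPrimitive pl fun ξ => vl ξ t) (η t)
    set Xr := correlate h₁ (meanZeroPrimitive pr fun ξ => vr ξ t) (η t)
    set Tl := ∫ τ in Ioi 0, meanFluxPerturbation f pl ubl vl τ
    set Tr := ∫ τ in Ioi 0, meanFluxPerturbation f pr ubr vr τ
    set ml := ∫ τ in (0 : ℝ)..t, meanFluxPerturbation f pl ubl vl τ
    set mr := ∫ τ in (0 : ℝ)..t, meanFluxPerturbation f pr ubr vr τ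
    -- Conservation of the invariant solved for `η t`: the error is exactly the two correlations
    -- with the primitives at time `t` and the two tails of the flux integrals.
    have h1 : η t - 1 / (ubl - ubr) * (I₀ + Tl - Tr)
        = 1 / (ubl - ubr) * ((Xl - (Tl - ml)) + ((Tr - mr) - Xr)) := by
      field_simp
      linarith
    rw [h1, abs_mul, abs_of_pos (by positivity : 0 < 1 / (ubl - ubr)), mul_assoc (1 / (ubl - ubr))]
    gcongr
    have a1 := abs_add_le (Xl - (Tl - ml)) ((Tr - mr) - Xr)
    have a2 := abs_sub Xl (Tl - ml)
    have a3 := abs_sub (Tr - mr) Xr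
    have e1 : (2 * M / θ + 2 * (pl + pr) * ∫ y, |h₁ y|) * (D * Real.exp (-θ * t))
        = 2 * (M * D / θ * Real.exp (-θ * t)) + 2 * pl * (D * Real.exp (-θ * t)) * (∫ y, |h₁ y|)
          + 2 * pr * (D * Real.exp (-θ * t)) * (∫ y, |h₁ y|) := by ring
    rw [e1]
    linarith

end Core

/-! ### Return to the integrals of the original problem -/

section Difference

variable {a b h : ℝ → ℝ} {A B : ℝ}

theorem integrable_const_add_sub_mul_comp_sub (ha : Continuous a) (hA : ∀ x, |a x| ≤ A)
    (hb : Continuous b) (hB : ∀ x, |b x| ≤ B) (hh : Integrable h) (c e : ℝ) :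
    Integrable fun ξ => (c + a ξ - b ξ) * h (ξ - e) := by
  refine integrable_mul_comp_sub (B := |c| + A + B) (by fun_prop) (fun x => ?_) hh e
  have h1 := abs_sub (c + a x) (b x)
  have h2 := abs_add_le c (a x)
  linarith [hA x, hB x]

theorem integral_const_add_sub_mul_comp_sub (ha : Continuous a) (hA : ∀ x, |a x| ≤ A)
    (hb : Continuous b) (hB : ∀ x, |b x| ≤ B) (hh : Integrable h) (c e : ℝ) :
    ∫ ξ, (c + a ξ - b ξ) * h (ξ - e) = c * (∫ y, h y) + correlate h a e - correlate h b e := by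
  have hcA : ∀ x, |c + a x| ≤ |c| + A := fun x => (abs_add_le _ _).trans (by gcongr; exact hA x)
  rw [integral_mul_comp_sub (fun ξ => c + a ξ - b ξ),
    correlate_sub (by fun_prop) hcA hb hB hh, correlate_add continuous_const (fun _ => le_rfl) ha hA hh,
    correlate_const]

end Difference

section ShiftProblem

variable {f : ℝ → ℝ} {μ γ s pl pr ubl ubr D θ M : ℝ} {vl vr ul ur : ℝ → ℝ → ℝ} {g : ℝ → ℝ}

theorem shiftDenom_eq {t : ℝ} (hθ : 0 < θ) (hvl : Continuous fun q : ℝ × ℝ => vl q.1 q.2)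
    (hvr : Continuous fun q : ℝ × ℝ => vr q.1 q.2) (hdl : IsDecaying vl D θ)
    (hdr : IsDecaying vr D θ)
    (hk : IsFrontKernel (deriv g) (iteratedDeriv 2 g) (iteratedDeriv 3 g))
    (hul : ∀ ξ, ul ξ t = ubl + vl ξ t) (hur : ∀ ξ, ur ξ t = ubr + vr ξ t) (e : ℝ) :
    shiftDenom g ul ur e t = -shiftSlope ubl ubr (deriv g) vl vr e t := by
  have h1 : ∀ ξ, ul ξ t - ur ξ t = (ubl - ubr) + vl ξ t - vr ξ t := fun ξ => by
    rw [hul, hur]; ring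
  simp_rw [shiftDenom, h1]
  rw [integral_const_add_sub_mul_comp_sub (continuous_slice hvl t) (fun x => hdl.abs_le hθ x t)
    (continuous_slice hvr t) (fun x => hdr.abs_le hθ x t) hk.int₁, hk.integral₁, shiftSlope]
  ring

/-- Splitting off the constant states, the flux integral contributes `-(f ubl - f ubr) = -s (ubl -
ubr)` since the kernel has mass `-1`, and the two other constants integrate to zero. By
Rankine-Hugoniot this cancels against the constant part of `-s` times the denominator, and only
decaying terms remain. -/
theorem shiftRHS_eq {t : ℝ} (hfc : Continuous f) (hlr : ubr < ubl)
    (hRH : s * (ubl - ubr) = f ubl - f ubr) (hθ : 0 < θ) (hD : D ≤ 1) (hM0 : 0 ≤ M)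
    (hMl : ∀ (v : ℝ → ℝ → ℝ) (ξ t : ℝ), |v ξ t| ≤ 1 →
      |fluxPerturbation f ubl v ξ t| ≤ M * |v ξ t|)
    (hMr : ∀ (v : ℝ → ℝ → ℝ) (ξ t : ℝ), |v ξ t| ≤ 1 →
      |fluxPerturbation f ubr v ξ t| ≤ M * |v ξ t|)
    (hvl : Continuous fun q : ℝ × ℝ => vl q.1 q.2)
    (hvr : Continuous fun q : ℝ × ℝ => vr q.1 q.2) (hdl : IsDecaying vl D θ)
    (hdr : IsDecaying vr D θ)
    (hk : IsFrontKernel (deriv g) (iteratedDeriv 2 g) (iteratedDeriv 3 g))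
    (hsmall : D * ∫ y, |deriv g y| ≤ (ubl - ubr) / 4)
    (hul : ∀ ξ, ul ξ t = ubl + vl ξ t) (hur : ∀ ξ, ur ξ t = ubr + vr ξ t) (e : ℝ) :
    ShiftRHSWellDefined f g ul ur e t ∧
    shiftRHS f μ γ s g ul ur e t =
      -(shiftNumerator f μ γ s ubl (deriv g) (iteratedDeriv 2 g) (iteratedDeriv 3 g) vl e t
        - shiftNumerator f μ γ s ubr (deriv g) (iteratedDeriv 2 g) (iteratedDeriv 3 g) vr e t)
        / shiftSlope ubl ubr (deriv g) vl vr e t := by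
  have h1 : ∀ ξ, ul ξ t - ur ξ t = (ubl - ubr) + vl ξ t - vr ξ t := fun ξ => by
    rw [hul, hur]; ring
  have h2 : ∀ ξ, f (ul ξ t) - f (ur ξ t)
      = (f ubl - f ubr) + fluxPerturbation f ubl vl ξ t - fluxPerturbation f ubr vr ξ t := fun ξ => by
    rw [hul, hur, fluxPerturbation, fluxPerturbation]; ring
  have cl := continuous_slice hvl t
  have cr := continuous_slice hvr t
  have cFl := continuous_slice (v := fluxPerturbation f ubl vl)
    (continuous_fluxPerturbation hfc hvl) t
  have cFr := continuous_slice (v := fluxPerturbation f ubr vr)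
    (continuous_fluxPerturbation hfc hvr) t
  have bl := fun x => hdl.abs_le hθ x t
  have br := fun x => hdr.abs_le hθ x t
  have bFl := fun x => hdl.abs_flux_le hθ hD hM0 hMl x t
  have bFr := fun x => hdr.abs_flux_le hθ hD hM0 hMr x t
  have hS : 0 < shiftSlope ubl ubr (deriv g) vl vr e t :=
    (half_pos (sub_pos.2 hlr)).trans_le (shiftSlope_ge hθ hdl hdr hk.int₁ hsmall e t)
  have hden := shiftDenom_eq hθ hvl hvr hdl hdr hk hul hur e
  constructor
  · constructor
    · simp_rw [h1]; exact integrable_const_add_sub_mul_comp_sub cl bl cr br hk.int₁ _ e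
    · simp_rw [h1]; exact integrable_const_add_sub_mul_comp_sub cl bl cr br hk.int₂ _ e
    · simp_rw [h1]; exact integrable_const_add_sub_mul_comp_sub cl bl cr br hk.int₃ _ e
    · simp_rw [h2]; exact integrable_const_add_sub_mul_comp_sub cFl bFl cFr bFr hk.int₁ _ e
    · rw [hden]; exact neg_ne_zero.2 hS.ne'
  · rw [shiftRHS, hden]
    simp_rw [h1, h2]
    rw [integral_const_add_sub_mul_comp_sub cl bl cr br hk.int₂,
      integral_const_add_sub_mul_comp_sub cl bl cr br hk.int₃,
      integral_const_add_sub_mul_comp_sub cFl bFl cFr bFr hk.int₁, hk.integral₁, hk.integral₂,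
      hk.integral₃, ← hRH, div_neg, neg_div, ← neg_add', neg_inj, div_add' _ _ _ hS.ne']
    congr 1
    rw [shiftNumerator, shiftNumerator, shiftSlope]
    ring

/-- The mass of the deviation with shift `e` converges to the right side of the second condition
minus `H(e,0)`, with `H` the invariant. Replacing the primitive of `wl - wr` by zero-mean primitives
produces the two mean primitives, because the kernel has mass `-1`. -/
theorem isInitialShift_iff {φ u₀ wl wr : ℝ → ℝ} {Il Ir B : ℝ} (hpl : 0 < pl) (hpr : 0 < pr)
    (hφ : ∀ x, φ x = ubr + (ubl - ubr) * g x) (hd : ∀ x, HasDerivAt g (deriv g x) x)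
    (hh : Continuous (deriv g)) (hk : IsFrontKernel (deriv g) (iteratedDeriv 2 g) (iteratedDeriv 3 g))
    (hB : ∀ x, |g x| ≤ B) (hbot : Tendsto g atBot (𝓝 1)) (htop : Tendsto g atTop (𝓝 0))
    (hθ : 0 < θ) (hvl : IsModeSolution f μ γ s pl ubl vl) (hvr : IsModeSolution f μ γ s pr ubr vr)
    (hdl : IsDecaying vl D θ) (hdr : IsDecaying vr D θ)
    (hwl : ∀ ξ, vl ξ 0 = wl ξ) (hwr : ∀ ξ, vr ξ 0 = wr ξ) (hu : LocallyIntegrable u₀)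
    (hIl : Tendsto (fun R => ∫ ξ in R..(0 : ℝ), (u₀ ξ - φ ξ - wl ξ)) atBot (𝓝 Il))
    (hIr : Tendsto (fun R => ∫ ξ in (0 : ℝ)..R, (u₀ ξ - φ ξ - wr ξ)) atTop (𝓝 Ir)) (e : ℝ) :
    IsInitialShift g u₀ (fun ξ => ubl + wl ξ) (fun ξ => ubr + wr ξ) e ↔
      shiftInvariant f pl pr ubl ubr (deriv g) vl vr e 0
        = Il + Ir - meanPrimitive pl wl + meanPrimitive pr wr := by
  obtain rfl : (fun ξ => vl ξ 0) = wl := funext hwl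
  obtain rfl : (fun ξ => vr ξ 0) = wr := funext hwr
  have cl := continuous_slice hvl.continuous 0
  have cr := continuous_slice hvr.continuous 0
  set Vl := meanZeroPrimitive pl fun ξ => vl ξ 0 with hVl
  set Vr := meanZeroPrimitive pr fun ξ => vr ξ 0 with hVr
  set ml := meanPrimitive pl fun ξ => vl ξ 0 with hml
  set mr := meanPrimitive pr fun ξ => vr ξ 0 with hmr
  have bVl : ∀ x, |Vl x| ≤ 2 * pl * D := abs_meanZeroPrimitive_le hpl cl (hvl.periodic 0)
    (hvl.mean_zero 0) fun x => hdl.abs_le hθ x 0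
  have bVr : ∀ x, |Vr x| ≤ 2 * pr * D := abs_meanZeroPrimitive_le hpr cr (hvr.periodic 0)
    (hvr.mean_zero 0) fun x => hdr.abs_le hθ x 0
  have cVl : Continuous Vl := continuous_iff_continuousAt.2 fun x =>
    (hasDerivAt_meanZeroPrimitive cl x).continuousAt
  have cVr : Continuous Vr := continuous_iff_continuousAt.2 fun x =>
    (hasDerivAt_meanZeroPrimitive cr x).continuousAt
  have hprim : ∀ x, ∫ y in (0 : ℝ)..x, (vl y 0 - vr y 0) = (ml - mr) + Vl x - Vr x := by
    intro x
    rw [intervalIntegral.integral_sub (cl.intervalIntegrable _ _) (cr.intervalIntegrable _ _), hVl,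
      hVr, meanZeroPrimitive, meanZeroPrimitive]
    ring
  have hbd : ∀ x, |∫ y in (0 : ℝ)..x, (vl y 0 - vr y 0)|
      ≤ |ml - mr| + 2 * pl * D + 2 * pr * D := by
    intro x
    rw [hprim]
    have h1 := abs_sub (ml - mr + Vl x) (Vr x)
    have h2 := abs_add_le (ml - mr) (Vl x)
    linarith [bVl x, bVr x]
  have hlim := tendsto_initial_mass hφ hd hh hk.int₁ hB hbot htop cl cr hbd hu hIl hIr e
  have hcorr : correlate (deriv g) (fun x => ∫ y in (0 : ℝ)..x, (vl y 0 - vr y 0)) e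
      = (ml - mr) * (-1) + correlate (deriv g) Vl e - correlate (deriv g) Vr e := by
    simp_rw [hprim]
    rw [← integral_mul_comp_sub, integral_const_add_sub_mul_comp_sub cVl bVl cVr bVr hk.int₁,
      hk.integral₁]
  have hinv : shiftInvariant f pl pr ubl ubr (deriv g) vl vr e 0
      = (ubl - ubr) * e - correlate (deriv g) Vl e + correlate (deriv g) Vr e := by
    simp only [shiftInvariant, shiftPotential, intervalIntegral.integral_same, zero_add, hVl, hVr]
  rw [hcorr] at hlim
  rw [hinv, IsInitialShift]
  constructor
  · intro h
    have := tendsto_nhds_unique h hlim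
    linarith
  · intro h
    convert hlim using 2
    linarith

theorem integrableOn_meanFlux {p ub : ℝ} {u v : ℝ → ℝ → ℝ} (hfc : Continuous f) (hp : 0 < p)
    (hθ : 0 < θ) (hD : D ≤ 1) (hM0 : 0 ≤ M)
    (hM : ∀ (v : ℝ → ℝ → ℝ) (ξ t : ℝ), |v ξ t| ≤ 1 → |fluxPerturbation f ub v ξ t| ≤ M * |v ξ t|)
    (hv : IsModeSolution f μ γ s p ub v) (hd : IsDecaying v D θ)
    (hu : ∀ t, 0 ≤ t → ∀ ξ, u ξ t = ub + v ξ t) :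
    IntegrableOn (meanFlux f s p ub u) (Ioi 0) ∧
      ∫ t in Ioi 0, meanFlux f s p ub u t = ∫ t in Ioi 0, meanFluxPerturbation f p ub v t := by
  have h1 : EqOn (meanFlux f s p ub u) (meanFluxPerturbation f p ub v) (Ioi 0) := fun t ht =>
    hv.meanFlux_eq hfc (hu t (le_of_lt ht))
  refine ⟨?_, setIntegral_congr_fun measurableSet_Ioi h1⟩
  rw [integrableOn_congr_fun h1 measurableSet_Ioi]
  exact (abs_tail_le (continuous_meanFluxPerturbation hfc hv.continuous) hθ
    fun t ht => hd.abs_meanFlux_le hp hθ hD hM0 hM ht).1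

theorem isDecaying_clampedPerturbation {ub κ c : ℝ} {u : ℝ → ℝ → ℝ} (hθ : θ ≤ κ) (hc : c ≤ D)
    (hc0 : 0 ≤ c) (h : ∀ t, 0 ≤ t → ∀ ξ,
      |clampedPerturbation ub u ξ t| ≤ c * Real.exp (-κ * t)) :
    IsDecaying (clampedPerturbation ub u) D θ where
  frozen ξ t := by simp [clampedPerturbation]
  bound ξ t ht := by
    refine (h t ht ξ).trans ?_
    have : -κ * t ≤ -θ * t := by nlinarith
    gcongr
    exact hc0.trans hc

end ShiftProblem

end KdVBurgers

/-! ### The main theorem -/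

open KdVBurgers in
theorem mainTheorem3
    (f : ℝ → ℝ) (hf : ContDiff ℝ 3 f) (hconv : StrictConvexOn ℝ Set.univ f)
    (μ γ : ℝ) (hμ : 0 < μ) (hγ : 0 < γ)
    (ubl ubr s : ℝ) (hlr : ubr < ubl) (hRH : s * (ubl - ubr) = f ubl - f ubr)
    (pl pr : ℝ) (hpl : 0 < pl) (hpr : 0 < pr)
    (φ : ℝ → ℝ) (hφ : KdVBurgers.IsShockProfile f μ γ s ubl ubr φ) :
    ∃ δ₀ C θ : ℝ, 0 < δ₀ ∧ 0 < C ∧ 0 < θ ∧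
      -- the periodic perturbations
      ∀ (wl wr : ℝ → ℝ),
        KdVBurgers.IsPerturbation pl wl → KdVBurgers.IsPerturbation pr wr →
      ∀ δ : ℝ, δ = max (KdVBurgers.h1Norm pl wl) (KdVBurgers.h1Norm pr wr) → δ < δ₀ →
      -- the periodic solutions
      ∀ (ul ur : ℝ → ℝ → ℝ),
        KdVBurgers.IsPeriodicSolution f μ γ s pl (fun ξ => ubl + wl ξ) ul →
        KdVBurgers.IsPeriodicSolution f μ γ s pr (fun ξ => ubr + wr ξ) ur →
      -- the initial data, with the two (improper) integrals `Il`, `Ir`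
      ∀ (u₀ : ℝ → ℝ) (Il Ir : ℝ), MeasureTheory.LocallyIntegrable u₀ →
        Filter.Tendsto (fun R : ℝ => ∫ ξ in R..0, (u₀ ξ - φ ξ - wl ξ))
          Filter.atBot (nhds Il) →
        Filter.Tendsto (fun R : ℝ => ∫ ξ in (0 : ℝ)..R, (u₀ ξ - φ ξ - wr ξ))
          Filter.atTop (nhds Ir) →
      -- well-definedness of the shift problem
      (∃! η₀ : ℝ, KdVBurgers.IsInitialShift (KdVBurgers.normProfile ubl ubr φ) u₀
          (fun ξ => ubl + wl ξ) (fun ξ => ubr + wr ξ) η₀) ∧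
      (∀ e t : ℝ, 0 ≤ t →
        KdVBurgers.ShiftRHSWellDefined f (KdVBurgers.normProfile ubl ubr φ) ul ur e t) ∧
      MeasureTheory.IntegrableOn (KdVBurgers.meanFlux f s pl ubl ul) (Set.Ioi 0) ∧
      MeasureTheory.IntegrableOn (KdVBurgers.meanFlux f s pr ubr ur) (Set.Ioi 0) ∧
      -- existence, uniqueness and asymptotics of the shift
      ∀ η₀ : ℝ,
        KdVBurgers.IsInitialShift (KdVBurgers.normProfile ubl ubr φ) u₀
          (fun ξ => ubl + wl ξ) (fun ξ => ubr + wr ξ) η₀ →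
        ∃ η : ℝ → ℝ,
          KdVBurgers.IsShiftSolution f μ γ s (KdVBurgers.normProfile ubl ubr φ) ul ur η₀ η ∧
          ContDiffOn ℝ 1 η (Set.Ici 0) ∧
          (∀ η' : ℝ → ℝ,
            KdVBurgers.IsShiftSolution f μ γ s (KdVBurgers.normProfile ubl ubr φ) ul ur η₀ η' →
            Set.EqOn η' η (Set.Ici 0)) ∧
          ∀ t : ℝ, 0 ≤ t →
            |derivWithin η (Set.Ici 0) t|
              + |η t - (1 / (ubl - ubr)) *
                  ((Il + Ir) + KdVBurgers.etaInfty₂ f s pl pr ubl ubr wl wr ul ur)|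
              ≤ C * δ * Real.exp (-θ * t) := by
  have hf2 : ContDiff ℝ 2 f := hf.of_le (by norm_num)
  have hfc : Continuous f := hf.continuous
  have hk := hφ.isFrontKernel (hf.of_le (by norm_num)) hconv hμ hγ hlr hRH
  set g := normProfile ubl ubr φ with hg
  have hgc : ContDiff ℝ 3 g := hφ.contDiff_normProfile
  have hgd := hasDerivAt_of_contDiff_three hgc
  obtain ⟨B, hB⟩ := hφ.exists_bound_normProfile
  obtain ⟨δl, Cl, θl, hδl, hCl, hθl, hdecl⟩ := exists_periodic_decay hf2 μ s ubl hpl hγ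
  obtain ⟨δr, Cr, θr, hδr, hCr, hθr, hdecr⟩ := exists_periodic_decay hf2 μ s ubr hpr hγ
  obtain ⟨Ml, hMl0, hMl⟩ := exists_abs_fluxPerturbation_le hf2 ubl
  obtain ⟨Mr, hMr0, hMr⟩ := exists_abs_fluxPerturbation_le hf2 ubr
  have hΔ : 0 < ubl - ubr := sub_pos.2 hlr
  set L₁ := ∫ y, |deriv g y|
  have hL₁ : 0 ≤ L₁ := integral_nonneg fun _ => abs_nonneg _
  have hL₂ : 0 ≤ ∫ y, |iteratedDeriv 2 g y| := integral_nonneg fun _ => abs_nonneg _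
  have hL₃ : 0 ≤ ∫ y, |iteratedDeriv 3 g y| := integral_nonneg fun _ => abs_nonneg _
  set M := Ml + Mr with hM
  have hM0 : 0 ≤ M := by positivity
  have hMl' : ∀ (v : ℝ → ℝ → ℝ) (ξ t : ℝ), |v ξ t| ≤ 1 →
      |fluxPerturbation f ubl v ξ t| ≤ M * |v ξ t| := fun v ξ t h =>
    (hMl v ξ t h).trans (by gcongr; linarith)
  have hMr' : ∀ (v : ℝ → ℝ → ℝ) (ξ t : ℝ), |v ξ t| ≤ 1 →
      |fluxPerturbation f ubr v ξ t| ≤ M * |v ξ t| := fun v ξ t h =>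
    (hMr v ξ t h).trans (by gcongr; linarith)
  set θ := min θl θr
  have hθ : 0 < θ := lt_min hθl hθr
  set c := Cl + Cr
  have hc : 0 < c := by positivity
  set K₁ := 4 / (ubl - ubr) * (γ * (∫ y, |iteratedDeriv 2 g y|)
    + μ * (∫ y, |iteratedDeriv 3 g y|) + (M + |s|) * L₁)
  set K₂ := 1 / (ubl - ubr) * (2 * M / θ + 2 * (pl + pr) * L₁)
  have hK₁ : 0 ≤ K₁ := by positivity
  have hK₂ : 0 ≤ K₂ := by positivity
  -- `1 / c` keeps the perturbations below `1`, where the linear bound on the flux is valid; the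
  -- last bound gives the smallness needed for the slope, with `L₁ + 1` avoiding a division by zero.
  -- The `+ 1` in the constant ensures its positivity.
  refine ⟨min (min δl δr) (min (1 / c) ((ubl - ubr) / (4 * c * (L₁ + 1)))), (K₁ + K₂ + 1) * c, θ,
    by positivity, by positivity, hθ, ?_⟩
  intro wl wr hwl hwr δ hδ hδ₀ ul ur hul hur u₀ Il Ir hu₀ hIl hIr
  simp only [lt_min_iff] at hδ₀
  obtain ⟨⟨hδ1, hδ2⟩, hδ3, hδ4⟩ := hδ₀
  have hnl : h1Norm pl wl ≤ δ := hδ ▸ le_max_left _ _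
  have hnr : h1Norm pr wr ≤ δ := hδ ▸ le_max_right _ _
  have hnl0 := h1Norm_nonneg pl wl
  have hnr0 := h1Norm_nonneg pr wr
  have hδ0 : 0 ≤ δ := hnl0.trans hnl
  obtain ⟨hvl, hbl⟩ := hdecl wl ul hwl (hnl.trans_lt hδ1) hul
  obtain ⟨hvr, hbr⟩ := hdecr wr ur hwr (hnr.trans_lt hδ2) hur
  set vl := clampedPerturbation ubl ul
  set vr := clampedPerturbation ubr ur
  have hdl : IsDecaying vl (c * δ) θ := isDecaying_clampedPerturbation (min_le_left _ _)
    (mul_le_mul (by simp only [c]; linarith) hnl hnl0 hc.le) (by positivity) hbl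
  have hdr : IsDecaying vr (c * δ) θ := isDecaying_clampedPerturbation (min_le_right _ _)
    (mul_le_mul (by simp only [c]; linarith) hnr hnr0 hc.le) (by positivity) hbr
  have hD : c * δ ≤ 1 := by
    rw [lt_div_iff₀ hc] at hδ3; linarith
  have hsmall : c * δ * L₁ ≤ (ubl - ubr) / 4 := by
    rw [lt_div_iff₀ (by positivity)] at hδ4
    have : 0 ≤ c * δ := by positivity
    nlinarith
  have hul' : ∀ t, 0 ≤ t → ∀ ξ, ul ξ t = ubl + vl ξ t := fun t ht ξ => by
    simp only [vl]; rw [clampedPerturbation_of_nonneg ht]; ring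
  have hur' : ∀ t, 0 ≤ t → ∀ ξ, ur ξ t = ubr + vr ξ t := fun t ht ξ => by
    simp only [vr]; rw [clampedPerturbation_of_nonneg ht]; ring
  have hwl' : ∀ ξ, vl ξ 0 = wl ξ := fun ξ => by
    simp only [vl]; rw [clampedPerturbation_of_nonneg le_rfl, hul.initial]; ring
  have hwr' : ∀ ξ, vr ξ 0 = wr ξ := fun ξ => by
    simp only [vr]; rw [clampedPerturbation_of_nonneg le_rfl, hur.initial]; ring
  have hrhs := fun (e t : ℝ) (ht : 0 ≤ t) => shiftRHS_eq (μ := μ) (γ := γ) (t := t) hfc hlr hRH hθ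
    hD hM0 hMl' hMr' hvl.continuous hvr.continuous hdl hdr hk hsmall (hul' t ht) (hur' t ht) e
  have hinit := isInitialShift_iff (g := g) hpl hpr (eq_add_mul_normProfile hlr φ)
    (fun x => (hgd x).1) (hgc.continuous_deriv (by norm_num)) hk hB
    (hφ.tendsto_normProfile_atBot hlr) hφ.tendsto_normProfile_atTop hθ hvl hvr hdl hdr hwl' hwr'
    hu₀ hIl hIr
  have hml := integrableOn_meanFlux hfc hpl hθ hD hM0 hMl' hvl hdl hul'
  have hmr := integrableOn_meanFlux hfc hpr hθ hD hM0 hMr' hvr hdr hur'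
  refine ⟨?_, fun e t ht => (hrhs e t ht).1, hml.1, hmr.1, fun η₀ hη₀ => ?_⟩
  -- The admissible shifts form a level set of the invariant at time `0`, which is a single point.
  · simp_rw [hinit]
    exact existsUnique_eq_of_hasDerivAt
      (continuous_shiftSlope hθ hvl.continuous hvr.continuous hdl hdr hk.int₁)
      (hasDerivAt_shiftInvariant hpl hpr hθ hvl hvr hdl hdr hk.int₁) (half_pos hΔ)
      (shiftSlope_ge hθ hdl hdr hk.int₁ hsmall) 0 _
  · obtain ⟨η, h0, hode, hC1, huniq, hest⟩ := exists_shift hf2 hμ hγ hpl hpr hlr hk hθ hD hM0 hMl'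
      hMr' hvl hvr hdl hdr hsmall η₀
    refine ⟨η, ⟨h0, fun t ht => ?_⟩, hC1, fun η' hη' => huniq η' hη'.initial fun t ht => ?_,
      fun t ht => ?_⟩
    · rw [(hrhs (η t) t ht).2]; exact hode t ht
    · rw [← (hrhs (η' t) t ht).2]; exact hη'.ode t ht
    · obtain ⟨e1, e2⟩ := hest t ht
      -- The level fixed by the initial condition supplies the integrals `Il`, `Ir` and the mean
      -- primitives; the flux integrals of `etaInfty₂` are those of the potential.
      have e3 : Il + Ir + etaInfty₂ f s pl pr ubl ubr wl wr ul ur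
          = shiftInvariant f pl pr ubl ubr (deriv g) vl vr η₀ 0
            + (∫ τ in Ioi 0, meanFluxPerturbation f pl ubl vl τ)
            - ∫ τ in Ioi 0, meanFluxPerturbation f pr ubr vr τ := by
        rw [(hinit η₀).1 hη₀, etaInfty₂, hml.2, hmr.2]; ring
      rw [e3]
      have hE : 0 ≤ c * δ * Real.exp (-θ * t) := by positivity
      calc _ ≤ K₁ * (c * δ * Real.exp (-θ * t)) + K₂ * (c * δ * Real.exp (-θ * t)) :=
            add_le_add e1 e2
        _ ≤ (K₁ + K₂ + 1) * c * δ * Real.exp (-θ * t) := by linarith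

end
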